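/- Let $M>0$ and let the Schwarzschild exterior $\mathbb{R}_t\times(2M,\infty)_r\times S^2$ carry the metric $$g=(1-2M/r)\,dt^2-(1-2M/r)^{-1}dr^2-r^2(d\theta^2+\sin^2\theta\,d\phi^2).$$ Let $F_{ab}$ be a smooth real $2$-form on the exterior with $\nabla^aF_{ab}=0$ and $\nabla_{[a}F_{bc]}=0$. Put $\xi=\partial_t$, $U_a=-r^{-1}\nabla_a r$, $Y_{ab}=-2r^3\sin\theta\,d\theta_{[a}d\phi_{b]}$, and $$Z_{ab}=-\tfrac43\,{*F}_{[a}{}^{c}Y_{b]c},\qquad \beta_a=-\tfrac12U^bZ_{ab}-\tfrac i2U^b\,{*Z}_{ab}-\tfrac12\nabla_bZ_a{}^b-\tfrac i2\nabla_b{*Z}_a{}^b,\qquad \mathbf H_{ab}=\beta_{(a}\bar\beta_{b)}-\tfrac12g_{ab}\beta^c\bar\beta_c .$$ With $$A^a=\frac{(r-3M)(r-2M)}{2r^2}(\partial_r)^a,\qquad q=\frac{9M^2(r-2M)(2r-3M)}{4r^5},$$ let $$\mathbf P_a=\mathbf H_{ab}A^b+\tfrac14q\beta^bZ_{ab}+\tfrac14q\bar\beta^bZ_{ab}-\tfrac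 i4q\beta^b\,{*Z}_{ab}+\tfrac i4q\bar\beta^b\,{*Z}_{ab}+\tfrac1{16}Z_{bc}Z^{bc}\nabla_aq-\tfrac14Z_a{}^cZ_{bc}\nabla^bq .$$ For a smooth spacelike hypersurface $\Sigma$ with future-directed unit normal $N^a$ ($N^aN_a=1$) and induced volume element $d\mu_\Sigma$, let $$E_\xi(\Sigma)=\int_\Sigma\mathbf H_{ab}\xi^bN^a\,d\mu_\Sigma,\qquad E_{\xi+A,q}(\Sigma)=\int_\Sigma(\mathbf H_{ab}\xi^b+\mathbf P_a)N^a\,d\mu_\Sigma .$$ Let $\Sigma$ be a spherically symmetric spacelike slice of the exterior, that is, an $SO(3)$-invariant spacelike hypersurface which is the graph $t=h(x)$ of a smooth function over an open subset of $(2M,\infty)\times S^2$. Then the integral defining $E_\xi(\Sigma)$ converges absolutely if and only if the integral defining $E_{\xi+A,q}(\Sigma)$ does, and in that case $$\tfrac1{10}E_\xi(\Sigma)\le E_{\xi+A,q}(\Sigma)\le\tfrac{19}{10}E_\xi(\Sigma).$$ -/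

import Mathlib

open MeasureTheory
open scoped ContDiff

noncomputable section

namespace Schwarzschild

/-! The exterior of the Schwarzschild black hole of mass `M` is the manifold
`ℝ × (2M, ∞) × S²`. Writing `x = r ω ∈ ℝ³` (with `ω ∈ S²`) identifies it with the open set
`{(t, x) : 2M < |x|}` of `ℝ × ℝ³`, so that `(t, x¹, x², x³)` is a global smooth chart (regular
also on the axis of the spherical coordinates). All tensors are given by their components in
this chart; the index `0` is `t`, and the indices `1, 2, 3` are `x¹, x², x³`.
The signature is `(+, -, -, -)`. -/

/-- Coordinates `(t, x¹, x², x³)` of a spacetime point. -/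
abbrev Point : Type := Fin 4 → ℝ

/-- Euclidean three-space, the range of `x = r ω`. -/
abbrev Space : Type := EuclideanSpace ℝ (Fin 3)

/-- The spacetime point with time coordinate `t` and space coordinates `x`. -/
def point (t : ℝ) (x : Space) : Point := ![t, x 0, x 1, x 2]

/-- The area radius `r`. -/
def radius (p : Point) : ℝ := Real.sqrt (p 1 ^ 2 + p 2 ^ 2 + p 3 ^ 2)

/-- The exterior region `r > 2M`. -/
def exterior (M : ℝ) : Set Point := {p | 2 * M < radius p}

/-- The coordinate derivative `∂_a f`. -/
def pd (a : Fin 4) (f : Point → ℝ) (p : Point) : ℝ := fderiv ℝ f p (Pi.single a 1)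

/-- The components of the one-form `dt`. -/
def dt (a : Fin 4) : ℝ := if a = 0 then 1 else 0

/-- The components of the one-form `dr`; as `r dr = x · dx`, they are `(0, x / r)`. -/
def dr (p : Point) (a : Fin 4) : ℝ := if a = 0 then 0 else p a / radius p

/-- The components of `r² (dθ² + sin² θ dφ²) = |dx|² - dr²`. -/
def sphereMetric (p : Point) (a b : Fin 4) : ℝ :=
  (if a = b ∧ a ≠ 0 then 1 else 0) - dr p a * dr p b

/-- The Schwarzschild metric
`g = (1 - 2M/r) dt² - (1 - 2M/r)⁻¹ dr² - r² (dθ² + sin² θ dφ²)`. -/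
def metric (M : ℝ) (p : Point) : Matrix (Fin 4) (Fin 4) ℝ := fun a b =>
  (1 - 2 * M / radius p) * dt a * dt b
    - (1 - 2 * M / radius p)⁻¹ * dr p a * dr p b - sphereMetric p a b

/-- The inverse metric `g^{ab}`. -/
def invMetric (M : ℝ) (p : Point) : Matrix (Fin 4) (Fin 4) ℝ := (metric M p)⁻¹

/-- The Christoffel symbol `Γ^a_{bc}` of the Levi-Civita connection. -/
def christoffel (M : ℝ) (p : Point) (a b c : Fin 4) : ℝ :=
  1 / 2 * ∑ d, invMetric M p a d *
    (pd b (fun y => metric M y d c) p + pd c (fun y => metric M y d b) p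
      - pd d (fun y => metric M y b c) p)

/-- A field of covariant tensors of rank two. -/
abbrev TensorField : Type := Point → Fin 4 → Fin 4 → ℝ

/-- The covariant derivative `∇_c T_{ab}`. -/
def covDeriv (M : ℝ) (T : TensorField) (p : Point) (c a b : Fin 4) : ℝ :=
  pd c (fun y => T y a b) p
    - ∑ d, christoffel M p d c a * T p d b - ∑ d, christoffel M p d c b * T p a d

/-- The divergence `∇_b T_a{}^b = g^{bc} ∇_c T_{ab}` over the second index. -/
def divSnd (M : ℝ) (T : TensorField) (p : Point) (a : Fin 4) : ℝ :=
  ∑ b, ∑ c, invMetric M p b c * covDeriv M T p c a b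

/-- The totally antisymmetric symbol with value `1` at `(0, 1, 2, 3)`. -/
def leviCivita (a b c d : Fin 4) : ℝ :=
  Matrix.det (Matrix.of fun i j : Fin 4 => if ![a, b, c, d] i = j then (1 : ℝ) else 0)

/-- The volume form `e_{abcd}`. -/
def volForm (M : ℝ) (p : Point) (a b c d : Fin 4) : ℝ :=
  Real.sqrt |(metric M p).det| * leviCivita a b c d

/-- The Hodge dual `*T_{ab} = ½ e_{abcd} T^{cd}` of a two-form. -/
def hodge (M : ℝ) (T : TensorField) : TensorField := fun p a b =>
  1 / 2 * ∑ c, ∑ d, ∑ e, ∑ f,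
    volForm M p a b c d * invMetric M p c e * invMetric M p d f * T p e f

/-- `F` is a (test) Maxwell field on the exterior: a smooth real two-form with
`∇^a F_{ab} = 0` and `∇_{[a} F_{bc]} = 0`. -/
structure IsMaxwellField (M : ℝ) (F : TensorField) : Prop where
  smooth : ∀ a b, ContDiffOn ℝ ∞ (fun p => F p a b) (exterior M)
  antisymm : ∀ p ∈ exterior M, ∀ a b, F p a b = -F p b a
  divergence_free : ∀ p ∈ exterior M, ∀ b,
    ∑ a, ∑ c, invMetric M p a c * covDeriv M F p c a b = 0
  closed : ∀ p ∈ exterior M, ∀ a b c,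
    covDeriv M F p a b c + covDeriv M F p b c a + covDeriv M F p c a b = 0

/-- The Killing-Yano tensor
`Y_{ab} = -2 r³ sin θ dθ_{[a} dφ_{b]} = - r³ sin θ (dθ_a dφ_b - dφ_a dθ_b)`. The form
`r² sin θ dθ ∧ dφ` is the area form of the spheres, with components `ε_{ijk} x^k / r`. -/
def killingYano (p : Point) (a b : Fin 4) : ℝ := -∑ c, leviCivita 0 a b c * p c

/-- The mixed contraction `*F_a{}^c Y_{bc}`. -/
def starFY (M : ℝ) (F : TensorField) (p : Point) (a b : Fin 4) : ℝ :=
  ∑ c, ∑ d, hodge M F p a d * invMetric M p d c * killingYano p b c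

/-- The two-form `Z_{ab} = -(4/3) *F_{[a}{}^c Y_{b]c}`. -/
def Z (M : ℝ) (F : TensorField) : TensorField := fun p a b =>
  -(4 / 3) * (1 / 2 * (starFY M F p a b - starFY M F p b a))

/-- The one-form `U_a = - r⁻¹ ∇_a r`. -/
def U (p : Point) (a : Fin 4) : ℝ := -(radius p)⁻¹ * pd a radius p

/-- The vector `U^a`. -/
def Uup (M : ℝ) (p : Point) (a : Fin 4) : ℝ := ∑ b, invMetric M p a b * U p b

/-- The complex one-form
`β_a = -½ U^b Z_{ab} - ½ i U^b *Z_{ab} - ½ ∇_b Z_a{}^b - ½ i ∇_b *Z_a{}^b`. -/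
def beta (M : ℝ) (F : TensorField) (p : Point) (a : Fin 4) : ℂ :=
  -(1 / 2) * ((∑ b, Uup M p b * Z M F p a b : ℝ) : ℂ)
    - 1 / 2 * Complex.I * ((∑ b, Uup M p b * hodge M (Z M F) p a b : ℝ) : ℂ)
    - 1 / 2 * ((divSnd M (Z M F) p a : ℝ) : ℂ)
    - 1 / 2 * Complex.I * ((divSnd M (hodge M (Z M F)) p a : ℝ) : ℂ)

/-- The complex vector `β^a`. -/
def betaUp (M : ℝ) (F : TensorField) (p : Point) (a : Fin 4) : ℂ :=
  ∑ b, (invMetric M p a b : ℂ) * beta M F p b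

/-- The superenergy tensor `H_{ab} = β_{(a} β̄_{b)} - ½ g_{ab} β^c β̄_c`; note that
`β_{(a} β̄_{b)} = Re (β_a β̄_b)`, and that `β^c β̄_c` is real. -/
def H (M : ℝ) (F : TensorField) (p : Point) (a b : Fin 4) : ℝ :=
  (beta M F p a * star (beta M F p b)).re
    - 1 / 2 * metric M p a b * (∑ c, betaUp M F p c * star (beta M F p c)).re

/-- The static Killing field `ξ = ∂_t`. -/
def xi (_p : Point) (a : Fin 4) : ℝ := if a = 0 then 1 else 0

/-- The radial vector field `A = (r - 3M) (r - 2M) / (2 r²) ∂_r`; the components of `∂_r`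
are `(0, x / r)`. -/
def A (M : ℝ) (p : Point) (a : Fin 4) : ℝ :=
  (radius p - 3 * M) * (radius p - 2 * M) / (2 * radius p ^ 2)
    * (if a = 0 then 0 else p a / radius p)

/-- The scalar field `q = 9 M² (r - 2M) (2r - 3M) / (4 r⁵)`. -/
def q (M : ℝ) (p : Point) : ℝ :=
  9 * M ^ 2 * (radius p - 2 * M) * (2 * radius p - 3 * M) / (4 * radius p ^ 5)

/-- The terms of the Morawetz current that are linear in `β` (their sum is real):
`¼ q β^b Z_{ab} + ¼ q β̄^b Z_{ab} - ¼ i q β^b *Z_{ab} + ¼ i q β̄^b *Z_{ab}`. -/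
def crossTerm (M : ℝ) (F : TensorField) (p : Point) (a : Fin 4) : ℂ :=
  ∑ b, (1 / 4 * (q M p : ℂ) * betaUp M F p b * (Z M F p a b : ℂ)
    + 1 / 4 * (q M p : ℂ) * star (betaUp M F p b) * (Z M F p a b : ℂ)
    - 1 / 4 * Complex.I * (q M p : ℂ) * betaUp M F p b * (hodge M (Z M F) p a b : ℂ)
    + 1 / 4 * Complex.I * (q M p : ℂ) * star (betaUp M F p b) * (hodge M (Z M F) p a b : ℂ))

/-- The contraction `Z_a{}^c Z_{bc}`. -/
def ZZ (M : ℝ) (F : TensorField) (p : Point) (a b : Fin 4) : ℝ :=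
  ∑ c, ∑ d, Z M F p a d * invMetric M p d c * Z M F p b c

/-- The Morawetz current
`P_a = H_{ab} A^b + ¼ q β^b Z_{ab} + ¼ q β̄^b Z_{ab} - ¼ i q β^b *Z_{ab} + ¼ i q β̄^b *Z_{ab}
  + (1/16) Z_{bc} Z^{bc} ∇_a q - ¼ Z_a{}^c Z_{bc} ∇^b q`. -/
def P (M : ℝ) (F : TensorField) (p : Point) (a : Fin 4) : ℝ :=
  (∑ b, H M F p a b * A M p b) + (crossTerm M F p a).re
    + 1 / 16 * (∑ b, ∑ c, invMetric M p b c * ZZ M F p b c) * pd a (q M) p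
    - 1 / 4 * ∑ b, ∑ c, ZZ M F p a b * invMetric M p b c * pd c (q M) p

/-- The derivative `∂_i h` of a function on space. -/
def spd (i : Fin 3) (h : Space → ℝ) (x : Space) : ℝ :=
  fderiv ℝ h x (EuclideanSpace.single i 1)

/-- The tangent vector `∂_i (h(x), x)` of the graph `t = h(x)`. -/
def graphTangent (h : Space → ℝ) (x : Space) (i : Fin 3) : Fin 4 → ℝ :=
  point (spd i h x) (EuclideanSpace.single i 1)

/-- The metric induced on the graph `t = h(x)`, in the coordinates `x`. -/
def inducedMetric (M : ℝ) (h : Space → ℝ) (x : Space) : Matrix (Fin 3) (Fin 3) ℝ := fun i j =>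
  ∑ a, ∑ b, metric M (point (h x) x) a b * graphTangent h x i a * graphTangent h x j b

/-- A smooth spacelike slice of the exterior: a spacelike hypersurface that meets each integral
curve of the static Killing field `∂_t` at most once, that is, the graph `t = h(x)` of a smooth
function over an open set. With the signature `(+, -, -, -)`, spacelike means that the induced
metric is negative definite. -/
structure SpacelikeSlice (M : ℝ) where
  /-- the projection of the slice to space -/
  dom : Set Space
  /-- the time function `h` whose graph the slice is -/
  height : Space → ℝ
  isOpen_dom : IsOpen dom
  dom_subset : ∀ x ∈ dom, 2 * M < ‖x‖
  smooth : ContDiffOn ℝ ∞ height dom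
  spacelike : ∀ x ∈ dom, (-inducedMetric M height x).PosDef

namespace SpacelikeSlice

variable {M : ℝ}

/-- The hypersurface itself. -/
def carrier (S : SpacelikeSlice M) : Set Point :=
  {p | ∃ x ∈ S.dom, p = point (S.height x) x}

/-- The slice is invariant under the action of `SO(3)` on spacetime. -/
def IsSphericallySymmetric (S : SpacelikeSlice M) : Prop :=
  ∀ R : Space ≃ₗᵢ[ℝ] Space, LinearMap.det (R.toLinearEquiv : Space →ₗ[ℝ] Space) = 1 →
    ∀ t x, point t x ∈ S.carrier → point t (R x) ∈ S.carrier

/-- The conormal `d(t - h)`. -/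
def conormal (S : SpacelikeSlice M) (x : Space) : Fin 4 → ℝ :=
  ![1, -spd 0 S.height x, -spd 1 S.height x, -spd 2 S.height x]

/-- The future-directed unit normal `N^a`, `N^a N_a = 1`. -/
def normal (S : SpacelikeSlice M) (x : Space) (a : Fin 4) : ℝ :=
  (∑ b, invMetric M (point (S.height x) x) a b * S.conormal x b) /
    Real.sqrt (∑ b, ∑ c, invMetric M (point (S.height x) x) b c
      * S.conormal x b * S.conormal x c)

/-- The density of the induced volume element `dμ_Σ` with respect to `d³x`. -/
def volDensity (S : SpacelikeSlice M) (x : Space) : ℝ :=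
  Real.sqrt (-inducedMetric M S.height x).det

/-- The density `J_a N^a dμ_Σ / d³x` of the flux of a current through the slice. -/
def fluxDensity (S : SpacelikeSlice M) (J : Point → Fin 4 → ℝ) (x : Space) : ℝ :=
  (∑ a, J (point (S.height x) x) a * S.normal x a) * S.volDensity x

/-- The integral of `J_a N^a` over the slice converges absolutely. -/
def FluxIntegrable (S : SpacelikeSlice M) (J : Point → Fin 4 → ℝ) : Prop :=
  IntegrableOn (S.fluxDensity J) S.dom volume

/-- The flux `∫_Σ J_a N^a dμ_Σ`. -/
def flux (S : SpacelikeSlice M) (J : Point → Fin 4 → ℝ) : ℝ :=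
  ∫ x in S.dom, S.fluxDensity J x

end SpacelikeSlice

/-- The superenergy current `H_{ab} ξ^b`. -/
def currentXi (M : ℝ) (F : TensorField) (p : Point) (a : Fin 4) : ℝ :=
  ∑ b, H M F p a b * xi p b

/-- The modified current `H_{ab} ξ^b + P_a`. -/
def currentXiAq (M : ℝ) (F : TensorField) (p : Point) (a : Fin 4) : ℝ :=
  currentXi M F p a + P M F p a

/-- The superenergy `E_ξ(Σ) = ∫_Σ H_{ab} ξ^b N^a dμ_Σ`. -/
def energyXi {M : ℝ} (F : TensorField) (S : SpacelikeSlice M) : ℝ :=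
  S.flux (currentXi M F)

/-- The modified energy `E_{ξ+A,q}(Σ) = ∫_Σ (H_{ab} ξ^b + P_a) N^a dμ_Σ`. -/
def energyXiAq {M : ℝ} (F : TensorField) (S : SpacelikeSlice M) : ℝ :=
  S.flux (currentXiAq M F)

end Schwarzschild

end

/-!
The two-form `Z` has only mixed components between the `(t, r)`-plane and the orbit spheres, so it
is determined by its contractions `w_s = l_s^a Z_{ab}` with the radial null vectors
`l_s = ∂_t + s (1 - 2M/r) ∂_r`, `s = ± 1`, and these are tangent to the spheres. The divergences in
the definition of `β` combine to `l_s^a β_a = (div w_s + i s curl w_s) / 2`.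

The unit normal of a spherically symmetric slice is a positive combination of `l_+` and `l_-`, so
only the null components of the two currents matter. Those of `H_{ab} ξ^b` are
`(|l_s^a β_a|² + (1 - 2M/r) |β_T|²) / 2`, with `β_T` the part of `β` tangent to the spheres; those
of the modified current are a quadratic form in `l_s^a β_a`, `β_T` and `w_s`. The negative `|w_s|²`
terms of that form are absorbed by the Poincaré inequality
`∫ (|div w|² + |curl w|²) ≥ (2 / r²) ∫ |w|²` for tangential fields on spheres, which comes from
Bochner's identity for the rotation generators. The inequality only holds after integration over
whole spheres, so the convergence of the two energies is compared along an exhaustion of the slice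
by compact rotation-invariant sets.
-/

noncomputable section

namespace Schwarzschild

/-! ### The Schwarzschild metric in the chart `(t, x)` -/

/-- The components `δ_{ij}` of the Euclidean metric `|dx|²` of the slices of constant `t`. -/
def spatialDelta (a b : Fin 4) : ℝ := if a = b ∧ a ≠ 0 then 1 else 0

/-- The function `1 - 2M/r`, the square of the lapse of the static slicing. -/
def lapseSq (M : ℝ) (p : Point) : ℝ := 1 - 2 * M / radius p

theorem radius_sq (p : Point) : radius p ^ 2 = p 1 ^ 2 + p 2 ^ 2 + p 3 ^ 2 :=
  Real.sq_sqrt (by positivity)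

theorem spatialDelta_comm (a b : Fin 4) : spatialDelta a b = spatialDelta b a := by
  unfold spatialDelta
  grind

theorem spatialDelta_zero (a : Fin 4) : spatialDelta a 0 = 0 :=
  if_neg fun h => h.2 h.1

@[simp] theorem dr_zero (p : Point) : dr p 0 = 0 := if_pos rfl

theorem dr_of_ne_zero (p : Point) {a : Fin 4} (ha : a ≠ 0) : dr p a = p a / radius p := if_neg ha

theorem sum_dr_sq {p : Point} (hr : 0 < radius p) : dr p 1 ^ 2 + dr p 2 ^ 2 + dr p 3 ^ 2 = 1 := by
  simp only [dr_of_ne_zero p (show (1 : Fin 4) ≠ 0 by decide),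
    dr_of_ne_zero p (show (2 : Fin 4) ≠ 0 by decide),
    dr_of_ne_zero p (show (3 : Fin 4) ≠ 0 by decide), div_pow, ← add_div, ← radius_sq]
  exact div_self (by positivity)

theorem sum_dr_mul_dr {p : Point} (hr : 0 < radius p) : ∑ b, dr p b * dr p b = 1 := by
  rw [Fin.sum_univ_four, dr_zero]
  linarith [sum_dr_sq hr]

section Contractions

variable (a : Fin 4) (v : Fin 4 → ℝ)

theorem sum_dt_mul : ∑ b, dt b * v b = v 0 := by
  simp [dt]

theorem sum_spatialDelta_mul : ∑ b, spatialDelta a b * v b = v a - dt a * v 0 := by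
  rw [Fin.sum_univ_four]
  fin_cases a <;> simp [spatialDelta, dt]

end Contractions

theorem metric_eq (M : ℝ) (p : Point) (a b : Fin 4) :
    metric M p a b = lapseSq M p * dt a * dt b - spatialDelta a b
      + (1 - (lapseSq M p)⁻¹) * dr p a * dr p b := by
  simp only [metric, sphereMetric, lapseSq, spatialDelta]
  ring

theorem det_metric {M : ℝ} {p : Point} (hr : 0 < radius p) (hf : lapseSq M p ≠ 0) :
    (metric M p).det = -1 := by
  have h := sum_dr_sq hr
  have hg : lapseSq M p * (lapseSq M p)⁻¹ = 1 := mul_inv_cancel₀ hf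
  rw [Matrix.det_succ_row_zero]
  simp [Matrix.det_fin_three, Matrix.submatrix_apply, metric_eq, dt, spatialDelta, Fin.succAbove]
  linear_combination (lapseSq M p - 1) * h
    - (dr p 1 ^ 2 + dr p 2 ^ 2 + dr p 3 ^ 2) * hg

section Exterior

variable {M : ℝ} {p : Point}

theorem radius_pos (hM : 0 ≤ M) (hp : p ∈ exterior M) : 0 < radius p := by
  have h : 2 * M < radius p := hp
  linarith

theorem lapseSq_pos (hM : 0 ≤ M) (hp : p ∈ exterior M) : 0 < lapseSq M p := by
  rw [lapseSq, sub_pos, div_lt_one (radius_pos hM hp)]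
  exact hp

theorem isOpen_exterior (M : ℝ) : IsOpen (exterior M) :=
  isOpen_lt continuous_const (by unfold radius; fun_prop)

theorem invMetric_eq (hM : 0 ≤ M) (hp : p ∈ exterior M) (a b : Fin 4) :
    invMetric M p a b = (lapseSq M p)⁻¹ * dt a * dt b - spatialDelta a b
      + (1 - lapseSq M p) * dr p a * dr p b := by
  let G : Matrix (Fin 4) (Fin 4) ℝ := fun a b =>
    (lapseSq M p)⁻¹ * dt a * dt b - spatialDelta a b + (1 - lapseSq M p) * dr p a * dr p b
  suffices metric M p * G = 1 by rw [invMetric, Matrix.inv_eq_right_inv this]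
  have h := sum_dr_sq (radius_pos hM hp)
  have hg : lapseSq M p * (lapseSq M p)⁻¹ = 1 := mul_inv_cancel₀ (lapseSq_pos hM hp).ne'
  have h0 := dr_zero p
  ext a b
  simp only [Matrix.mul_apply, Fin.sum_univ_four, metric_eq, Matrix.one_apply]
  simp only [G]
  generalize dr p = n at *
  generalize (lapseSq M p)⁻¹ = g at *
  generalize lapseSq M p = f at *
  fin_cases a <;> fin_cases b <;> simp [dt, spatialDelta, h0] <;> grind

theorem invMetric_comm (hM : 0 ≤ M) (hp : p ∈ exterior M) (a b : Fin 4) :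
    invMetric M p a b = invMetric M p b a := by
  rw [invMetric_eq hM hp, invMetric_eq hM hp, spatialDelta_comm]
  ring

theorem sum_invMetric_mul (hM : 0 ≤ M) (hp : p ∈ exterior M) (a : Fin 4) (v : Fin 4 → ℝ) :
    ∑ b, invMetric M p a b * v b = ((lapseSq M p)⁻¹ + 1) * dt a * v 0 - v a
      + (1 - lapseSq M p) * dr p a * ∑ b, dr p b * v b := by
  have expand (b : Fin 4) : invMetric M p a b * v b = (lapseSq M p)⁻¹ * dt a * (dt b * v b)
      - spatialDelta a b * v b + (1 - lapseSq M p) * dr p a * (dr p b * v b) := by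
    rw [invMetric_eq hM hp]
    ring
  simp only [expand, Finset.sum_add_distrib, Finset.sum_sub_distrib, ← Finset.mul_sum,
    sum_dt_mul, sum_spatialDelta_mul]
  ring

theorem sum_invMetric_dt (hM : 0 ≤ M) (hp : p ∈ exterior M) (a : Fin 4) :
    ∑ b, invMetric M p a b * dt b = (lapseSq M p)⁻¹ * dt a := by
  rw [sum_invMetric_mul hM hp, show dt 0 = 1 from rfl]
  simp only [mul_comm (dr p _), sum_dt_mul, dr_zero]
  ring

theorem sum_invMetric_dr (hM : 0 ≤ M) (hp : p ∈ exterior M) (a : Fin 4) :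
    ∑ b, invMetric M p a b * dr p b = -lapseSq M p * dr p a := by
  rw [sum_invMetric_mul hM hp, sum_dr_mul_dr (radius_pos hM hp), dr_zero]
  ring

end Exterior

/-! ### Coordinate derivatives and the connection -/

section CoordinateDerivative

variable {f g : Point → ℝ} {p : Point} (a : Fin 4)

theorem pd_const (c : ℝ) : pd a (fun _ => c) p = 0 := by
  simp [pd]

theorem pd_congr (h : f =ᶠ[nhds p] g) : pd a f p = pd a g p := by
  rw [pd, pd, h.fderiv_eq]

theorem pd_add (hf : DifferentiableAt ℝ f p) (hg : DifferentiableAt ℝ g p) :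
    pd a (fun y => f y + g y) p = pd a f p + pd a g p := by
  simp [pd, fderiv_fun_add hf hg]

theorem pd_sub (hf : DifferentiableAt ℝ f p) (hg : DifferentiableAt ℝ g p) :
    pd a (fun y => f y - g y) p = pd a f p - pd a g p := by
  simp [pd, fderiv_fun_sub hf hg]

theorem pd_mul (hf : DifferentiableAt ℝ f p) (hg : DifferentiableAt ℝ g p) :
    pd a (fun y => f y * g y) p = pd a f p * g p + f p * pd a g p := by
  simp only [pd, fderiv_fun_mul hf hg, add_apply, smul_apply, smul_eq_mul]
  ring

theorem pd_sum {ι : Type*} (s : Finset ι) {F : ι → Point → ℝ}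
    (hF : ∀ i ∈ s, DifferentiableAt ℝ (F i) p) :
    pd a (fun y => ∑ i ∈ s, F i y) p = ∑ i ∈ s, pd a (F i) p := by
  simp [pd, fderiv_fun_sum hF]

theorem pd_comp {φ : ℝ → ℝ} {φ' : ℝ} (hφ : HasDerivAt φ φ' (f p)) (hf : DifferentiableAt ℝ f p) :
    pd a (fun y => φ (f y)) p = φ' * pd a f p := by
  have h := (hφ.comp_hasFDerivAt p hf.hasFDerivAt).fderiv
  simp only [pd]
  exact congrArg (· (Pi.single a 1)) h

theorem pd_coord (b : Fin 4) : pd a (fun y => y b) p = if a = b then 1 else 0 := by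
  have h : HasFDerivAt (fun y : Point => y b) (ContinuousLinearMap.proj (R := ℝ) b) p :=
    (ContinuousLinearMap.proj (R := ℝ) (φ := fun _ : Fin 4 => ℝ) b).hasFDerivAt
  rw [pd, h.fderiv]
  simp [Pi.single_apply, eq_comm]

end CoordinateDerivative

section Derivatives

variable {M : ℝ} {p : Point}

theorem contDiffAt_radius (hr : 0 < radius p) {n : WithTop ℕ∞} : ContDiffAt ℝ n radius p := by
  have h : p 1 ^ 2 + p 2 ^ 2 + p 3 ^ 2 ≠ 0 := by
    rw [← radius_sq]
    positivity
  exact ContDiffAt.sqrt (f := fun p : Point => p 1 ^ 2 + p 2 ^ 2 + p 3 ^ 2) (by fun_prop) h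

theorem contDiffAt_dr (hr : 0 < radius p) {n : WithTop ℕ∞} (a : Fin 4) :
    ContDiffAt ℝ n (fun y => dr y a) p := by
  unfold dr
  split_ifs
  · fun_prop
  · exact ContDiffAt.div (by fun_prop) (contDiffAt_radius hr) hr.ne'

theorem contDiffAt_lapseSq (hr : 0 < radius p) {n : WithTop ℕ∞} (M : ℝ) :
    ContDiffAt ℝ n (lapseSq M) p := by
  unfold lapseSq
  exact contDiffAt_const.sub (contDiffAt_const.div (contDiffAt_radius hr) hr.ne')

theorem differentiableAt_radius (hr : 0 < radius p) : DifferentiableAt ℝ radius p :=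
  (contDiffAt_radius hr).differentiableAt one_ne_zero

theorem differentiableAt_dr (hr : 0 < radius p) (a : Fin 4) :
    DifferentiableAt ℝ (fun y => dr y a) p :=
  (contDiffAt_dr hr a).differentiableAt one_ne_zero

theorem differentiableAt_lapseSq (hr : 0 < radius p) (M : ℝ) :
    DifferentiableAt ℝ (lapseSq M) p :=
  (contDiffAt_lapseSq hr M).differentiableAt one_ne_zero

theorem pd_radius (hr : 0 < radius p) (a : Fin 4) : pd a radius p = dr p a := by
  have hd := differentiableAt_radius hr
  have hsq : (fun y => radius y * radius y)
      = fun y : Point => y 1 * y 1 + y 2 * y 2 + y 3 * y 3 := by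
    ext y
    linarith [radius_sq y]
  have h := congrArg (fun F => pd a F p) hsq
  rw [pd_mul a hd hd, pd_add, pd_add, pd_mul, pd_mul, pd_mul] at h <;> try fun_prop
  have hdr : radius p * dr p a = if a = 0 then 0 else p a := by
    unfold dr
    split_ifs <;> field_simp
    simp
  apply mul_left_cancel₀ hr.ne'
  rw [hdr]
  simp only [pd_coord] at h
  fin_cases a <;> simp [-mul_eq_zero] at h ⊢ <;> linarith

theorem pd_comp_radius (hr : 0 < radius p) (a : Fin 4) {φ : ℝ → ℝ} {φ' : ℝ}
    (hφ : HasDerivAt φ φ' (radius p)) : pd a (fun y => φ (radius y)) p = φ' * dr p a := by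
  rw [pd_comp a hφ (differentiableAt_radius hr), pd_radius hr]

theorem pd_dr (hr : 0 < radius p) (c a : Fin 4) :
    pd c (fun y => dr y a) p = (spatialDelta c a - dr p c * dr p a) / radius p := by
  by_cases ha : a = 0
  · subst ha
    simp only [dr_zero, pd_const]
    simp [spatialDelta]
  · have hinv := hasDerivAt_inv hr.ne'
    simp only [dr_of_ne_zero _ ha, div_eq_mul_inv]
    rw [pd_mul c (by fun_prop) ((differentiableAt_radius hr).fun_inv hr.ne'),
      pd_comp_radius hr c hinv, pd_coord]
    have : spatialDelta c a = if c = a then 1 else 0 := by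
      unfold spatialDelta
      grind
    rw [this]
    field_simp
    ring

theorem pd_lapseSq (hr : 0 < radius p) (M : ℝ) (c : Fin 4) :
    pd c (lapseSq M) p = 2 * M / radius p ^ 2 * dr p c := by
  have h := ((hasDerivAt_inv hr.ne').const_mul (2 * M)).const_sub 1
  unfold lapseSq
  simp only [div_eq_mul_inv (2 * M)]
  rw [pd_comp_radius hr c h, mul_neg, neg_neg]

theorem pd_metric (hr : 0 < radius p) (hf : lapseSq M p ≠ 0) (c a b : Fin 4) :
    pd c (fun y => metric M y a b) p =
      2 * M / radius p ^ 2 * dr p c * (dt a * dt b + ((lapseSq M p)⁻¹) ^ 2 * dr p a * dr p b)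
      + (1 - (lapseSq M p)⁻¹) / radius p
        * ((spatialDelta c a - dr p c * dr p a) * dr p b
          + dr p a * (spatialDelta c b - dr p c * dr p b)) := by
  have hl := differentiableAt_lapseSq hr M
  have hda := differentiableAt_dr hr a
  have hdb := differentiableAt_dr hr b
  simp only [metric_eq]
  rw [pd_add, pd_sub, pd_mul, pd_mul, pd_mul, pd_mul, pd_sub, pd_comp c (hasDerivAt_inv hf) hl,
    pd_lapseSq hr, pd_dr hr, pd_dr hr]
  · simp only [pd_const]
    field_simp
    ring
  all_goals fun_prop

end Derivatives

/-- The `∂_t`-components `Γ^t_{bc}` of the Levi-Civita connection. -/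
def connT (M : ℝ) (p : Point) (b c : Fin 4) : ℝ :=
  (lapseSq M p)⁻¹ * (M / radius p ^ 2) * (dr p b * dt c + dr p c * dt b)

/-- The `∂_r`-components `Γ^r_{bc}` of the Levi-Civita connection; in the chart `(t, x)` the
remaining components of `Γ^a_{bc}` vanish. -/
def connR (M : ℝ) (p : Point) (b c : Fin 4) : ℝ :=
  lapseSq M p * (M / radius p ^ 2) * (dt b * dt c - ((lapseSq M p)⁻¹) ^ 2 * dr p b * dr p c)
    + (1 - lapseSq M p) / radius p * (spatialDelta b c - dr p b * dr p c)

theorem christoffel_eq {M : ℝ} (hM : 0 ≤ M) {p : Point} (hp : p ∈ exterior M) (a b c : Fin 4) :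
    christoffel M p a b c = dt a * connT M p b c + dr p a * connR M p b c := by
  have hr := radius_pos hM hp
  have hf := (lapseSq_pos hM hp).ne'
  have lowered (d : Fin 4) : pd b (fun y => metric M y d c) p + pd c (fun y => metric M y d b) p
      - pd d (fun y => metric M y b c) p
      = dt d * (2 * M / radius p ^ 2 * (dr p b * dt c + dr p c * dt b))
        + dr p d * (2 * M / radius p ^ 2 * (((lapseSq M p)⁻¹) ^ 2 * dr p b * dr p c - dt b * dt c)
          + 2 * (1 - (lapseSq M p)⁻¹) / radius p * (spatialDelta b c - dr p b * dr p c)) := by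
    simp only [pd_metric hr hf]
    rw [spatialDelta_comm b d, spatialDelta_comm c d, spatialDelta_comm c b]
    ring
  have sum_dr_mul_span (u v : ℝ) : ∑ d, dr p d * (dt d * u + dr p d * v) = v := by
    simp only [Fin.sum_univ_four, dt, dr_zero]
    simp
    linear_combination v * sum_dr_sq hr
  rw [christoffel, sum_invMetric_mul hM hp]
  simp only [lowered, sum_dr_mul_span, connT, connR, dr_zero, show dt 0 = 1 from rfl]
  field_simp
  ring

/-! ### Transverse two-forms and their divergence along the null directions -/

/-- A covector tangential to the orbit spheres: its `∂_t` and `∂_r` components vanish. -/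
structure IsTangential (p : Point) (v : Fin 4 → ℝ) : Prop where
  time_eq_zero : v 0 = 0
  sum_dr_eq_zero : ∑ b, dr p b * v b = 0

/-- A two-form on the exterior whose `t`-`r` component vanishes. -/
structure IsTransverse (M : ℝ) (T : TensorField) : Prop where
  antisymm : ∀ p ∈ exterior M, ∀ a b, T p a b = -T p b a
  sum_dr_time : ∀ p ∈ exterior M, ∑ b, dr p b * T p 0 b = 0

/-- The vector `l = ∂_t + s (1 - 2M/r) ∂_r`, a radial null vector for `s = ± 1`. -/
def nullVec (M s : ℝ) (p : Point) (a : Fin 4) : ℝ := dt a + s * lapseSq M p * dr p a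

/-- The component `l^a v_a` of a covector along the radial null vector `nullVec`. -/
def nullComp (M s : ℝ) (p : Point) (v : Fin 4 → ℝ) : ℝ := ∑ a, nullVec M s p a * v a

/-- The contraction `(∂_r)^a T_{ab}`. -/
def radial (T : TensorField) (p : Point) (b : Fin 4) : ℝ := ∑ a, dr p a * T p a b

/-- The contraction `l^a T_{ab}` with the radial null vector `nullVec`. -/
def nullContr (M s : ℝ) (T : TensorField) (p : Point) (b : Fin 4) : ℝ :=
  nullComp M s p fun a => T p a b

/-- The flat divergence `∂_b w_b` of a one-form; for a tangential one-form it is the divergence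
along the orbit spheres. -/
def divergence (w : Point → Fin 4 → ℝ) (p : Point) : ℝ := ∑ b, pd b (fun y => w y b) p

section NullComponents

variable (M s : ℝ) (p : Point)

theorem nullComp_eq (v : Fin 4 → ℝ) :
    nullComp M s p v = v 0 + s * lapseSq M p * ∑ a, dr p a * v a := by
  simp only [nullComp, nullVec, add_mul, mul_assoc, Finset.sum_add_distrib, ← Finset.mul_sum,
    sum_dt_mul]

theorem nullContr_eq (T : TensorField) (b : Fin 4) :
    nullContr M s T p b = T p 0 b + s * lapseSq M p * radial T p b :=
  nullComp_eq M s p _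

theorem nullComp_add (v w : Fin 4 → ℝ) :
    nullComp M s p (fun a => v a + w a) = nullComp M s p v + nullComp M s p w := by
  simp only [nullComp, mul_add, Finset.sum_add_distrib]

theorem nullComp_sub (v w : Fin 4 → ℝ) :
    nullComp M s p (fun a => v a - w a) = nullComp M s p v - nullComp M s p w := by
  simp only [nullComp, mul_sub, Finset.sum_sub_distrib]

theorem nullComp_const_mul (k : ℝ) (v : Fin 4 → ℝ) :
    nullComp M s p (fun a => k * v a) = k * nullComp M s p v := by
  simp only [nullComp, mul_left_comm _ k, ← Finset.mul_sum]

theorem nullComp_sum {ι : Type*} (t : Finset ι) (v : ι → Fin 4 → ℝ) :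
    nullComp M s p (fun a => ∑ i ∈ t, v i a) = ∑ i ∈ t, nullComp M s p (v i) := by
  simp only [nullComp, Finset.mul_sum]
  rw [Finset.sum_comm]

end NullComponents

section Transverse

variable {M : ℝ} {T : TensorField} {p : Point}

namespace IsTransverse

theorem isTangential_time (hT : IsTransverse M T) (hp : p ∈ exterior M) :
    IsTangential p (T p 0) :=
  ⟨by linarith [hT.antisymm p hp 0 0], hT.sum_dr_time p hp⟩

theorem isTangential_radial (hT : IsTransverse M T) (hp : p ∈ exterior M) :
    IsTangential p (radial T p) where
  time_eq_zero := by
    rw [← neg_eq_zero, ← hT.sum_dr_time p hp, radial, ← Finset.sum_neg_distrib]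
    exact Finset.sum_congr rfl fun b _ => by rw [hT.antisymm p hp 0 b]; ring
  sum_dr_eq_zero := by
    have flip : ∑ b, dr p b * radial T p b = -∑ b, dr p b * radial T p b := by
      simp only [radial, Finset.mul_sum, ← Finset.sum_neg_distrib]
      rw [Finset.sum_comm]
      refine Finset.sum_congr rfl fun b _ => Finset.sum_congr rfl fun c _ => ?_
      rw [hT.antisymm p hp]
      ring
    linarith

theorem isTangential_nullContr (hT : IsTransverse M T) (hp : p ∈ exterior M) (s : ℝ) :
    IsTangential p (nullContr M s T p) where
  time_eq_zero := by
    rw [nullContr_eq, (hT.isTangential_time hp).time_eq_zero,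
      (hT.isTangential_radial hp).time_eq_zero, mul_zero, add_zero]
  sum_dr_eq_zero := by
    simp only [nullContr_eq, mul_add, mul_left_comm (dr p _), Finset.sum_add_distrib,
      ← Finset.mul_sum, (hT.isTangential_time hp).sum_dr_eq_zero,
      (hT.isTangential_radial hp).sum_dr_eq_zero, mul_zero, add_zero]

end IsTransverse

theorem IsTangential.sum_invMetric_mul (hM : 0 ≤ M) (hp : p ∈ exterior M) {v : Fin 4 → ℝ}
    (hv : IsTangential p v) (a : Fin 4) : ∑ b, invMetric M p a b * v b = -v a := by
  rw [Schwarzschild.sum_invMetric_mul hM hp, hv.time_eq_zero, hv.sum_dr_eq_zero]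
  ring

theorem IsTangential.sum_christoffel_mul (hM : 0 ≤ M) (hp : p ∈ exterior M) {v : Fin 4 → ℝ}
    (hv : IsTangential p v) (b c : Fin 4) : ∑ d, christoffel M p d b c * v d = 0 := by
  have expand (d : Fin 4) : christoffel M p d b c * v d
      = connT M p b c * (dt d * v d) + connR M p b c * (dr p d * v d) := by
    rw [christoffel_eq hM hp]
    ring
  simp only [expand, Finset.sum_add_distrib, ← Finset.mul_sum, sum_dt_mul, hv.time_eq_zero,
    hv.sum_dr_eq_zero, mul_zero, add_zero]

theorem pd_time_of_isTangential {w : Point → Fin 4 → ℝ} (hw : ∀ᶠ y in nhds p, IsTangential y (w y))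
    (c : Fin 4) : pd c (fun y => w y 0) p = 0 := by
  rw [pd_congr c (g := fun _ => 0) (hw.mono fun y hy => hy.time_eq_zero), pd_const]

theorem sum_dr_mul_pd_of_isTangential (hr : 0 < radius p) {w : Point → Fin 4 → ℝ}
    (hw : ∀ᶠ y in nhds p, IsTangential y (w y)) (hd : ∀ b, DifferentiableAt ℝ (fun y => w y b) p)
    (c : Fin 4) : ∑ b, dr p b * pd c (fun y => w y b) p = -w p c / radius p := by
  have h : pd c (fun y => ∑ b, dr y b * w y b) p = 0 := by
    rw [pd_congr c (g := fun _ => 0) (hw.mono fun y hy => hy.sum_dr_eq_zero), pd_const]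
  have leibniz (b : Fin 4) : pd c (fun y => dr y b * w y b) p
      = (spatialDelta c b * w p b - dr p c * (dr p b * w p b)) / radius p
        + dr p b * pd c (fun y => w y b) p := by
    rw [pd_mul c (differentiableAt_dr hr b) (hd b), pd_dr hr]
    ring
  have hwp := hw.self_of_nhds
  rw [pd_sum _ _ fun b _ => (differentiableAt_dr hr b).fun_mul (hd b)] at h
  simp only [leibniz, Finset.sum_add_distrib, ← Finset.sum_div, Finset.sum_sub_distrib,
    ← Finset.mul_sum, sum_spatialDelta_mul, hwp.sum_dr_eq_zero, hwp.time_eq_zero,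
    mul_zero, sub_zero] at h
  linear_combination h

theorem sum_invMetric_mul_pd_of_isTangential (hM : 0 ≤ M) (hp : p ∈ exterior M)
    {w : Point → Fin 4 → ℝ} (hw : ∀ᶠ y in nhds p, IsTangential y (w y))
    (hd : ∀ b, DifferentiableAt ℝ (fun y => w y b) p) :
    ∑ b, ∑ c, invMetric M p b c * pd c (fun y => w y b) p = -divergence w p := by
  have contract (c : Fin 4) : ∑ b, invMetric M p b c * pd c (fun y => w y b) p
      = -pd c (fun y => w y c) p - (1 - lapseSq M p) / radius p * (dr p c * w p c) := by
    simp only [fun b => invMetric_comm hM hp b c]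
    rw [sum_invMetric_mul hM hp, pd_time_of_isTangential hw,
      sum_dr_mul_pd_of_isTangential (radius_pos hM hp) hw hd]
    ring
  rw [Finset.sum_comm]
  simp only [contract, Finset.sum_sub_distrib, ← Finset.mul_sum, hw.self_of_nhds.sum_dr_eq_zero,
    Finset.sum_neg_distrib, mul_zero, sub_zero, divergence]

theorem sum_mul_covDeriv {X : Point → Fin 4 → ℝ} (hX : ∀ a, DifferentiableAt ℝ (fun y => X y a) p)
    (hT : ∀ a b, DifferentiableAt ℝ (fun y => T y a b) p) (b c : Fin 4) :
    ∑ a, X p a * covDeriv M T p c a b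
      = pd c (fun y => ∑ a, X y a * T y a b) p
        - ∑ d, christoffel M p d c b * (∑ a, X p a * T p a d)
        - ∑ a, (pd c (fun y => X y a) p + ∑ d, christoffel M p a c d * X p d) * T p a b := by
  have leibniz (a : Fin 4) : pd c (fun y => X y a * T y a b) p
      = pd c (fun y => X y a) p * T p a b + X p a * pd c (fun y => T y a b) p :=
    pd_mul c (hX a) (hT a b)
  have hfst : ∑ a, X p a * ∑ d, christoffel M p d c a * T p d b
      = ∑ a, (∑ d, christoffel M p a c d * X p d) * T p a b := by
    simp only [Finset.mul_sum, Finset.sum_mul]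
    rw [Finset.sum_comm]
    exact Finset.sum_congr rfl fun d _ => Finset.sum_congr rfl fun a _ => by ring
  have hsnd : ∑ a, X p a * ∑ d, christoffel M p d c b * T p a d
      = ∑ d, christoffel M p d c b * (∑ a, X p a * T p a d) := by
    simp only [Finset.mul_sum]
    rw [Finset.sum_comm]
    exact Finset.sum_congr rfl fun d _ => Finset.sum_congr rfl fun a _ => by ring
  simp only [covDeriv, mul_sub, Finset.sum_sub_distrib, hfst, hsnd, add_mul,
    Finset.sum_add_distrib, pd_sum c Finset.univ fun a _ => (hX a).fun_mul (hT a b), leibniz]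
  ring

theorem sum_dr_mul_christoffel (hM : 0 ≤ M) (hp : p ∈ exterior M) (a c : Fin 4) :
    ∑ d, dr p d * christoffel M p a c d = M / radius p ^ 2 * (lapseSq M p)⁻¹
      * (dt a * dt c - dr p a * dr p c) := by
  have hr := radius_pos hM hp
  have hf := (lapseSq_pos hM hp).ne'
  have expand (d : Fin 4) : dr p d * christoffel M p a c d
      = (lapseSq M p)⁻¹ * (M / radius p ^ 2) * dt a
          * (dr p c * (dt d * dr p d) + dt c * (dr p d * dr p d))
        + dr p a * (lapseSq M p * (M / radius p ^ 2) * (dt c * (dt d * dr p d)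
            - ((lapseSq M p)⁻¹) ^ 2 * dr p c * (dr p d * dr p d))
          + (1 - lapseSq M p) / radius p
            * (spatialDelta c d * dr p d - dr p c * (dr p d * dr p d))) := by
    rw [christoffel_eq hM hp, connT, connR]
    ring
  simp only [expand, Finset.sum_add_distrib, Finset.sum_sub_distrib, ← Finset.mul_sum, sum_dt_mul,
    sum_spatialDelta_mul, sum_dr_mul_dr hr, dr_zero]
  field_simp
  ring

theorem differentiableAt_nullVec (hr : 0 < radius p) (s : ℝ) (a : Fin 4) :
    DifferentiableAt ℝ (fun y => nullVec M s y a) p := by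
  have hf := differentiableAt_lapseSq hr M
  have hn := differentiableAt_dr hr a
  unfold nullVec
  fun_prop

theorem covDeriv_nullVec (hM : 0 ≤ M) (hp : p ∈ exterior M) (s : ℝ) (a c : Fin 4) :
    pd c (fun y => nullVec M s y a) p + ∑ d, christoffel M p a c d * nullVec M s p d
      = s * lapseSq M p / radius p * (spatialDelta c a - dr p c * dr p a)
        + M / radius p ^ 2 * ((s * dr p c + lapseSq M p * dt c) * dr p a
          + (s * dt c + (lapseSq M p)⁻¹ * dr p c) * dt a) := by
  have hr := radius_pos hM hp
  have hf := differentiableAt_lapseSq hr M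
  have hn := differentiableAt_dr hr a
  have hpd : pd c (fun y => nullVec M s y a) p = s * (2 * M / radius p ^ 2 * dr p c) * dr p a
      + s * lapseSq M p * ((spatialDelta c a - dr p c * dr p a) / radius p) := by
    simp only [nullVec]
    rw [pd_add c (by fun_prop) (by fun_prop), pd_mul c (by fun_prop) hn, pd_mul c (by fun_prop) hf,
      pd_const, pd_const, pd_lapseSq hr, pd_dr hr]
    ring
  have hΓ : ∑ d, christoffel M p a c d * nullVec M s p d
      = christoffel M p a c 0 + s * lapseSq M p * ∑ d, dr p d * christoffel M p a c d := by
    rw [← nullComp_eq]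
    exact Finset.sum_congr rfl fun d _ => mul_comm _ _
  have hff : lapseSq M p * (lapseSq M p)⁻¹ = 1 := mul_inv_cancel₀ (lapseSq_pos hM hp).ne'
  rw [hpd, hΓ, sum_dr_mul_christoffel hM hp, christoffel_eq hM hp]
  simp only [connT, connR, dr_zero, show dt 0 = 1 from rfl, spatialDelta_zero]
  linear_combination (M / radius p ^ 2 * s * (dt a * dt c - dr p a * dr p c)) * hff

theorem IsTransverse.sum_invMetric_mul (hM : 0 ≤ M) (hT : IsTransverse M T)
    (hp : p ∈ exterior M) : ∑ b, ∑ c, invMetric M p b c * T p c b = 0 := by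
  have flip : ∑ b, ∑ c, invMetric M p b c * T p c b = -∑ b, ∑ c, invMetric M p b c * T p c b := by
    conv_lhs => rw [Finset.sum_comm]
    simp only [← Finset.sum_neg_distrib]
    refine Finset.sum_congr rfl fun b _ => Finset.sum_congr rfl fun c _ => ?_
    rw [hT.antisymm p hp b c, invMetric_comm hM hp]
    ring
  linarith

theorem IsTangential.sum_invMetric_mul_mul (hM : 0 ≤ M) (hp : p ∈ exterior M) {v : Fin 4 → ℝ}
    (hv : IsTangential p v) (α β : ℝ) :
    ∑ b, ∑ c, invMetric M p b c * ((α * dt c + β * dr p c) * v b) = 0 := by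
  have raise (c : Fin 4) : ∑ b, invMetric M p b c * ((α * dt c + β * dr p c) * v b)
      = -(α * (dt c * v c) + β * (dr p c * v c)) := by
    have h := hv.sum_invMetric_mul hM hp c
    simp only [invMetric_comm hM hp _ c, mul_left_comm _ (α * dt c + β * dr p c),
      ← Finset.mul_sum, h]
    ring
  rw [Finset.sum_comm]
  simp only [raise, Finset.sum_neg_distrib, Finset.sum_add_distrib, ← Finset.mul_sum, sum_dt_mul,
    hv.time_eq_zero, hv.sum_dr_eq_zero, mul_zero, add_zero, neg_zero]

theorem IsTransverse.sum_covDeriv_nullVec_mul (hM : 0 ≤ M) (hT : IsTransverse M T)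
    (hp : p ∈ exterior M) (s : ℝ) :
    ∑ b, ∑ c, invMetric M p b c * ∑ a,
      (pd c (fun y => nullVec M s y a) p + ∑ d, christoffel M p a c d * nullVec M s p d)
        * T p a b = 0 := by
  let f := lapseSq M p
  let k := s * f / radius p
  let m := M / radius p ^ 2
  have contract (b c : Fin 4) : ∑ a,
      (pd c (fun y => nullVec M s y a) p + ∑ d, christoffel M p a c d * nullVec M s p d) * T p a b
      = k * T p c b + ((m * s - k) * dt c + m * f⁻¹ * dr p c) * T p 0 b
        + (m * f * dt c + (m * s - k) * dr p c) * radial T p b := by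
    have expand (a : Fin 4) :
        (pd c (fun y => nullVec M s y a) p + ∑ d, christoffel M p a c d * nullVec M s p d) * T p a b
        = k * (spatialDelta c a * T p a b)
          + (m * f * dt c + (m * s - k) * dr p c) * (dr p a * T p a b)
          + m * (s * dt c + f⁻¹ * dr p c) * (dt a * T p a b) := by
      rw [covDeriv_nullVec hM hp]
      ring
    simp only [expand, Finset.sum_add_distrib, ← Finset.mul_sum, sum_spatialDelta_mul, sum_dt_mul,
      radial]
    ring
  simp only [contract, mul_add (invMetric M p _ _), Finset.sum_add_distrib,
    (hT.isTangential_time hp).sum_invMetric_mul_mul hM hp,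
    (hT.isTangential_radial hp).sum_invMetric_mul_mul hM hp, mul_left_comm _ k, ← Finset.mul_sum,
    hT.sum_invMetric_mul hM hp, mul_zero, add_zero]

theorem IsTransverse.nullComp_divSnd (hM : 0 ≤ M) (hT : IsTransverse M T) (hp : p ∈ exterior M)
    (hd : ∀ a b, DifferentiableAt ℝ (fun y => T y a b) p) (s : ℝ) :
    nullComp M s p (divSnd M T p) = -divergence (nullContr M s T) p := by
  have hl := differentiableAt_nullVec (M := M) (radius_pos hM hp) s
  have hdw (b : Fin 4) : DifferentiableAt ℝ (fun y => nullContr M s T y b) p := by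
    unfold nullContr nullComp
    exact DifferentiableAt.fun_sum fun a _ => (hl a).fun_mul (hd a b)
  have hcontract : nullComp M s p (divSnd M T p)
      = ∑ b, ∑ c, invMetric M p b c * ∑ a, nullVec M s p a * covDeriv M T p c a b := by
    simp only [nullComp, divSnd, Finset.mul_sum]
    rw [Finset.sum_comm]
    refine Finset.sum_congr rfl fun b _ => ?_
    rw [Finset.sum_comm]
    exact Finset.sum_congr rfl fun c _ => Finset.sum_congr rfl fun a _ => by ring
  have htangent := hT.isTangential_nullContr hp s
  simp only [hcontract, sum_mul_covDeriv hl hd, mul_sub, Finset.sum_sub_distrib,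
    hT.sum_covDeriv_nullVec_mul hM hp, sub_zero]
  have hΓ (b c : Fin 4) := htangent.sum_christoffel_mul hM hp c b
  simp only [nullContr, nullComp] at hΓ
  simp only [hΓ, mul_zero, Finset.sum_const_zero, sub_zero]
  exact sum_invMetric_mul_pd_of_isTangential hM hp
    (Filter.eventually_of_mem ((isOpen_exterior M).mem_nhds hp) fun y hy =>
      hT.isTangential_nullContr hy s) hdw

end Transverse

/-! ### Hodge duality and the field `Z` -/

set_option maxRecDepth 100000 in
theorem twelve_mul_det_eq_vandermonde : ∀ a b c d : Fin 4,
    12 * (Matrix.of fun i j : Fin 4 => if ![a, b, c, d] i = j then (1 : ℤ) else 0).det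
      = ((b : ℤ) - a) * ((c : ℤ) - a) * ((d : ℤ) - a) * ((c : ℤ) - b) * ((d : ℤ) - b)
        * ((d : ℤ) - c) := by
  decide

theorem leviCivita_eq (a b c d : Fin 4) : leviCivita a b c d =
    ((b : ℝ) - a) * ((c : ℝ) - a) * ((d : ℝ) - a) * ((c : ℝ) - b) * ((d : ℝ) - b)
      * ((d : ℝ) - c) / 12 := by
  have h := congrArg (Int.cast : ℤ → ℝ) (twelve_mul_det_eq_vandermonde a b c d)
  have hcast : ((Matrix.of fun i j : Fin 4 => if ![a, b, c, d] i = j then (1 : ℤ) else 0).det : ℝ)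
      = leviCivita a b c d := by
    rw [Int.cast_det, leviCivita]
    congr 1
    ext i j
    simp
  rw [Int.cast_mul, hcast] at h
  push_cast at h
  rw [← h]
  ring

theorem leviCivita_swap_fst (a b c d : Fin 4) : leviCivita b a c d = -leviCivita a b c d := by
  rw [leviCivita_eq, leviCivita_eq]
  ring

theorem leviCivita_swap_snd (a b c d : Fin 4) : leviCivita a c b d = -leviCivita a b c d := by
  rw [leviCivita_eq, leviCivita_eq]
  ring

theorem leviCivita_swap_thd (a b c d : Fin 4) : leviCivita a b d c = -leviCivita a b c d := by
  rw [leviCivita_eq, leviCivita_eq]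
  ring

theorem killingYano_antisymm (p : Point) (a b : Fin 4) :
    killingYano p a b = -killingYano p b a := by
  simp only [killingYano, leviCivita_swap_snd 0 b a, neg_mul, Finset.sum_neg_distrib]

theorem isTangential_killingYano (p : Point) (a : Fin 4) : IsTangential p (killingYano p a) where
  time_eq_zero := by simp [killingYano, leviCivita_eq]
  sum_dr_eq_zero := by
    fin_cases a <;> simp [killingYano, leviCivita_eq, Fin.sum_univ_four, dr] <;> ring

/-- The cross product `n × w` of the radial unit vector `n` with a tangential covector `w`: the
rotation of `w` by a right angle in the tangent plane of the sphere. -/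
def rotate (p : Point) (w : Fin 4 → ℝ) (b : Fin 4) : ℝ :=
  ∑ c, ∑ d, leviCivita 0 b c d * dr p c * w d

theorem isTangential_rotate (p : Point) (w : Fin 4 → ℝ) : IsTangential p (rotate p w) where
  time_eq_zero := by simp [rotate, leviCivita_eq]
  sum_dr_eq_zero := by
    simp [rotate, Fin.sum_univ_four, leviCivita_eq]
    ring

theorem rotate_add_const_mul (p : Point) (v w : Fin 4 → ℝ) (k : ℝ) (b : Fin 4) :
    rotate p (fun d => v d + k * w d) b = rotate p v b + k * rotate p w b := by
  simp only [rotate, mul_add, mul_left_comm _ k, Finset.sum_add_distrib, Finset.mul_sum]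

/-- A two-form whose only components are mixed, one index in the `t`-`r` plane and one along the
orbit spheres; these are the components of extreme spin weight. -/
structure IsExtreme (M : ℝ) (T : TensorField) : Prop extends IsTransverse M T where
  trace_sphere : ∀ p ∈ exterior M, dr p 1 * T p 2 3 + dr p 2 * T p 3 1 + dr p 3 * T p 1 2 = 0

section Hodge

variable {M : ℝ} {T F : TensorField} {p : Point}

theorem volForm_eq (hM : 0 ≤ M) (hp : p ∈ exterior M) (a b c d : Fin 4) :
    volForm M p a b c d = leviCivita a b c d := by
  rw [volForm, det_metric (radius_pos hM hp) (lapseSq_pos hM hp).ne', abs_neg, abs_one,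
    Real.sqrt_one, one_mul]

theorem hodge_antisymm (M : ℝ) (T : TensorField) (p : Point) (a b : Fin 4) :
    hodge M T p a b = -hodge M T p b a := by
  simp only [hodge, volForm, leviCivita_swap_fst b a, mul_neg, neg_mul, Finset.sum_neg_distrib]

theorem starFY_eq (hM : 0 ≤ M) (F : TensorField) (hp : p ∈ exterior M) (a b : Fin 4) :
    starFY M F p a b = -∑ d, hodge M F p a d * killingYano p b d := by
  rw [starFY, Finset.sum_comm, ← Finset.sum_neg_distrib]
  refine Finset.sum_congr rfl fun d _ => ?_
  rw [← mul_neg, ← (isTangential_killingYano p b).sum_invMetric_mul hM hp d, Finset.mul_sum]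
  exact Finset.sum_congr rfl fun c _ => by ring

theorem Z_eq (hM : 0 ≤ M) (F : TensorField) (hp : p ∈ exterior M) (a b : Fin 4) :
    Z M F p a b = 2 / 3 * ∑ d, (hodge M F p a d * killingYano p b d
      - hodge M F p b d * killingYano p a d) := by
  rw [Z, starFY_eq hM F hp, starFY_eq hM F hp, Finset.sum_sub_distrib]
  ring

theorem isExtreme_Z (hM : 0 ≤ M) (F : TensorField) : IsExtreme M (Z M F) where
  antisymm p _ a b := by
    simp only [Z]
    ring
  sum_dr_time p hp := by
    have hY (d : Fin 4) : killingYano p 0 d = 0 := by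
      rw [killingYano_antisymm, (isTangential_killingYano p d).time_eq_zero, neg_zero]
    have expand (b : Fin 4) : dr p b * Z M F p 0 b
        = -(2 / 3) * ∑ d, hodge M F p 0 d * (dr p b * killingYano p d b) := by
      rw [Z_eq hM F hp, Finset.mul_sum, Finset.mul_sum, Finset.mul_sum]
      refine Finset.sum_congr rfl fun d _ => ?_
      rw [hY, killingYano_antisymm p b d]
      ring
    simp only [expand, ← Finset.mul_sum]
    rw [Finset.sum_comm]
    simp only [← Finset.mul_sum, (isTangential_killingYano p _).sum_dr_eq_zero, mul_zero,
      Finset.sum_const_zero]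
  trace_sphere p hp := by
    have hanti := hodge_antisymm M F p
    have hdiag (a : Fin 4) : hodge M F p a a = 0 := by linarith [hanti a a]
    rw [Z_eq hM F hp, Z_eq hM F hp, Z_eq hM F hp]
    simp [killingYano, leviCivita_eq, Fin.sum_univ_four, dr, hdiag, hanti 2 1, hanti 3 1,
      hanti 3 2]
    norm_num
    ring

namespace IsExtreme

theorem eq_wedge (hM : 0 ≤ M) (hT : IsExtreme M T) (hp : p ∈ exterior M) (a b : Fin 4) :
    T p a b = dt a * T p 0 b - dt b * T p 0 a + dr p a * radial T p b - dr p b * radial T p a := by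
  have h1 := sum_dr_sq (radius_pos hM hp)
  have h2 := hT.trace_sphere p hp
  have h3 := hT.sum_dr_time p hp
  have hanti := hT.antisymm p hp
  have hdiag (a : Fin 4) : T p a a = 0 := by linarith [hanti a a]
  have h00 := hdiag 0
  have h11 := hdiag 1
  have h22 := hdiag 2
  have h33 := hdiag 3
  have h10 := hanti 1 0
  have h20 := hanti 2 0
  have h30 := hanti 3 0
  have h21 := hanti 2 1
  have h31 := hanti 3 1
  have h32 := hanti 3 2
  clear hanti hdiag
  have h0 := dr_zero p
  simp only [radial, Fin.sum_univ_four, h0, zero_mul, zero_add] at h1 h2 h3 ⊢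
  generalize T p = T at *
  generalize dr p = n at *
  fin_cases a <;> fin_cases b <;> simp [dt] <;> grind

theorem sum_invMetric_mul_invMetric_mul (hM : 0 ≤ M) (hT : IsExtreme M T) (hp : p ∈ exterior M)
    (c d : Fin 4) :
    ∑ e, ∑ f, invMetric M p c e * invMetric M p d f * T p e f
      = -(lapseSq M p)⁻¹ * (dt c * T p 0 d - dt d * T p 0 c)
        + lapseSq M p * (dr p c * radial T p d - dr p d * radial T p c) := by
  have hE := (hT.isTangential_time hp).sum_invMetric_mul hM hp
  have hR := (hT.isTangential_radial hp).sum_invMetric_mul hM hp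
  have expand (e f : Fin 4) : invMetric M p c e * invMetric M p d f * T p e f
      = (invMetric M p c e * dt e) * (invMetric M p d f * T p 0 f)
        - (invMetric M p c e * T p 0 e) * (invMetric M p d f * dt f)
        + (invMetric M p c e * dr p e) * (invMetric M p d f * radial T p f)
        - (invMetric M p c e * radial T p e) * (invMetric M p d f * dr p f) := by
    rw [hT.eq_wedge hM hp e f]
    ring
  simp only [expand, Finset.sum_add_distrib, Finset.sum_sub_distrib, ← Finset.mul_sum,
    ← Finset.sum_mul, hE, hR, sum_invMetric_dt hM hp, sum_invMetric_dr hM hp]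
  ring

theorem hodge_eq (hM : 0 ≤ M) (hT : IsExtreme M T) (hp : p ∈ exterior M) (a b : Fin 4) :
    hodge M T p a b = ∑ c, ∑ d, leviCivita a b c d *
      (-(lapseSq M p)⁻¹ * dt c * T p 0 d + lapseSq M p * dr p c * radial T p d) := by
  let Q (c d : Fin 4) : ℝ := leviCivita a b c d *
    (-(lapseSq M p)⁻¹ * dt c * T p 0 d + lapseSq M p * dr p c * radial T p d)
  have expand (c d : Fin 4) : ∑ e, ∑ f, volForm M p a b c d * invMetric M p c e
      * invMetric M p d f * T p e f = Q c d + Q d c := by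
    calc _ = leviCivita a b c d * ∑ e, ∑ f, invMetric M p c e * invMetric M p d f * T p e f := by
          simp only [volForm_eq hM hp, Finset.mul_sum, mul_assoc]
      _ = Q c d + Q d c := by
          simp only [Q]
          rw [hT.sum_invMetric_mul_invMetric_mul hM hp, leviCivita_swap_thd a b c d]
          ring
  have swap : ∑ c, ∑ d, Q d c = ∑ c, ∑ d, Q c d := Finset.sum_comm
  simp only [hodge, expand, Finset.sum_add_distrib, swap, Q]
  ring

theorem hodge_time (hM : 0 ≤ M) (hT : IsExtreme M T) (hp : p ∈ exterior M) (b : Fin 4) :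
    hodge M T p 0 b = lapseSq M p * rotate p (radial T p) b := by
  rw [hT.hodge_eq hM hp, rotate]
  simp only [Finset.mul_sum]
  refine Finset.sum_congr rfl fun c _ => Finset.sum_congr rfl fun d _ => ?_
  by_cases hc : c = 0
  · subst hc
    simp [leviCivita_eq]
  · rw [dt, if_neg hc]
    ring

theorem radial_hodge (hM : 0 ≤ M) (hT : IsExtreme M T) (hp : p ∈ exterior M) (b : Fin 4) :
    radial (hodge M T) p b = (lapseSq M p)⁻¹ * rotate p (T p 0) b := by
  have h00 := (hT.isTangential_time hp).time_eq_zero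
  simp only [radial, hT.hodge_eq hM hp, rotate]
  generalize radial T p = X at *
  generalize T p 0 = E at *
  fin_cases b <;> simp [Fin.sum_univ_four, leviCivita_eq, dt, h00] <;> ring

theorem isTransverse_hodge (hM : 0 ≤ M) (hT : IsExtreme M T) : IsTransverse M (hodge M T) where
  antisymm p _ := hodge_antisymm M T p
  sum_dr_time p hp := by
    simp only [hT.hodge_time hM hp, mul_left_comm (dr p _), ← Finset.mul_sum,
      (isTangential_rotate p _).sum_dr_eq_zero, mul_zero]

theorem nullContr_hodge (hM : 0 ≤ M) (hT : IsExtreme M T) (hp : p ∈ exterior M) {s : ℝ}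
    (hs : s ^ 2 = 1) (b : Fin 4) :
    nullContr M s (hodge M T) p b = s * rotate p (nullContr M s T p) b := by
  have hf : lapseSq M p * (lapseSq M p)⁻¹ = 1 := mul_inv_cancel₀ (lapseSq_pos hM hp).ne'
  have hw : nullContr M s T p = fun d => T p 0 d + s * lapseSq M p * radial T p d :=
    funext (nullContr_eq M s p T)
  rw [nullContr_eq, hT.hodge_time hM hp, hT.radial_hodge hM hp, hw, rotate_add_const_mul]
  linear_combination s * rotate p (T p 0) b * hf - lapseSq M p * rotate p (radial T p) b * hs

end IsExtreme

end Hodge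

section Smoothness

variable {M : ℝ} {T F : TensorField} {n : WithTop ℕ∞} {p : Point}

theorem contDiffAt_invMetric (hM : 0 ≤ M) (hp : p ∈ exterior M) (a b : Fin 4) :
    ContDiffAt ℝ n (fun y => invMetric M y a b) p := by
  have hr := radius_pos hM hp
  have hf := contDiffAt_lapseSq hr M (n := n)
  have ha := contDiffAt_dr hr a (n := n)
  have hb := contDiffAt_dr hr b (n := n)
  have hf0 := (lapseSq_pos hM hp).ne'
  have h : ContDiffAt ℝ n (fun y => (lapseSq M y)⁻¹ * dt a * dt b - spatialDelta a b
      + (1 - lapseSq M y) * dr y a * dr y b) p := by fun_prop (disch := assumption)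
  refine h.congr_of_eventuallyEq ?_
  filter_upwards [(isOpen_exterior M).mem_nhds hp] with y hy
  exact invMetric_eq hM hy a b

theorem contDiffAt_hodge (hM : 0 ≤ M) (hp : p ∈ exterior M)
    (hT : ∀ a b, ContDiffAt ℝ n (fun y => T y a b) p) (a b : Fin 4) :
    ContDiffAt ℝ n (fun y => hodge M T y a b) p := by
  have hg := fun a b => contDiffAt_invMetric hM hp a b (n := n)
  have h : ContDiffAt ℝ n (fun y => 1 / 2 * ∑ c, ∑ d, ∑ e, ∑ f,
      leviCivita a b c d * invMetric M y c e * invMetric M y d f * T y e f) p := by fun_prop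
  refine h.congr_of_eventuallyEq ?_
  filter_upwards [(isOpen_exterior M).mem_nhds hp] with y hy
  simp only [hodge, volForm_eq hM hy]

theorem contDiffAt_Z (hM : 0 ≤ M) (hp : p ∈ exterior M)
    (hF : ∀ a b, ContDiffAt ℝ n (fun y => F y a b) p) (a b : Fin 4) :
    ContDiffAt ℝ n (fun y => Z M F y a b) p := by
  have hg := fun a b => contDiffAt_invMetric hM hp a b (n := n)
  have hh := contDiffAt_hodge hM hp hF
  unfold Z starFY killingYano
  fun_prop

theorem contDiffAt_nullContr (hr : 0 < radius p)
    (hT : ∀ a b, ContDiffAt ℝ n (fun y => T y a b) p) (s : ℝ) (b : Fin 4) :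
    ContDiffAt ℝ n (fun y => nullContr M s T y b) p := by
  have hf := contDiffAt_lapseSq hr M (n := n)
  have hn := fun a => contDiffAt_dr hr a (n := n)
  unfold nullContr nullComp nullVec
  fun_prop

end Smoothness

/-- The radial component `-n · (∇ × w)` of the curl of a one-form `w`, with the sign that makes it
the divergence of `rotate`; for a tangential one-form it is the curl along the orbit spheres. -/
def radialCurl (w : Point → Fin 4 → ℝ) (p : Point) : ℝ :=
  ∑ b, ∑ c, ∑ d, leviCivita 0 b c d * dr p c * pd b (fun y => w y d) p

theorem radialCurl_eq (w : Point → Fin 4 → ℝ) (p : Point) :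
    radialCurl w p = dr p 1 * (pd 3 (fun y => w y 2) p - pd 2 (fun y => w y 3) p)
      + dr p 2 * (pd 1 (fun y => w y 3) p - pd 3 (fun y => w y 1) p)
      + dr p 3 * (pd 2 (fun y => w y 1) p - pd 1 (fun y => w y 2) p) := by
  norm_num [radialCurl, Fin.sum_univ_four, leviCivita_eq]
  ring

/-- The one-form `Re β`. -/
def betaRe (M : ℝ) (F : TensorField) (p : Point) (a : Fin 4) : ℝ := (beta M F p a).re

/-- The one-form `Im β`. -/
def betaIm (M : ℝ) (F : TensorField) (p : Point) (a : Fin 4) : ℝ := (beta M F p a).im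

section NullComponentsBeta

variable {M s : ℝ} {T F : TensorField} {p : Point}

theorem pd_rotate (hr : 0 < radius p) {w : Point → Fin 4 → ℝ}
    (hw : ∀ b, DifferentiableAt ℝ (fun y => w y b) p) (a b : Fin 4) :
    pd a (fun y => rotate y (w y) b) p
      = ∑ c, ∑ d, leviCivita 0 b c d * ((spatialDelta a c - dr p a * dr p c) / radius p) * w p d
        + ∑ c, ∑ d, leviCivita 0 b c d * dr p c * pd a (fun y => w y d) p := by
  have hn := differentiableAt_dr hr
  simp only [rotate, ← Finset.sum_add_distrib]
  rw [pd_sum _ _ fun c _ => by fun_prop]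
  refine Finset.sum_congr rfl fun c _ => ?_
  rw [pd_sum _ _ fun d _ => by fun_prop]
  refine Finset.sum_congr rfl fun d _ => ?_
  rw [pd_mul a (by fun_prop) (hw d), pd_mul a (by fun_prop) (hn c), pd_const, pd_dr hr]
  ring

theorem divergence_rotate (hr : 0 < radius p) {w : Point → Fin 4 → ℝ}
    (hw : ∀ b, DifferentiableAt ℝ (fun y => w y b) p) :
    divergence (fun y => rotate y (w y)) p = radialCurl w p := by
  let Q (b c : Fin 4) : ℝ :=
    ∑ d, leviCivita 0 b c d * ((spatialDelta b c - dr p b * dr p c) / radius p) * w p d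
  have hQ (b c : Fin 4) : Q c b = -Q b c := by
    simp only [Q, ← Finset.sum_neg_distrib]
    refine Finset.sum_congr rfl fun d _ => ?_
    rw [spatialDelta_comm c b, leviCivita_swap_snd]
    ring
  have hsum : ∑ b, ∑ c, Q b c = 0 := by
    have flip : ∑ b, ∑ c, Q b c = -∑ b, ∑ c, Q b c := by
      simp only [← Finset.sum_neg_distrib]
      rw [Finset.sum_comm]
      exact Finset.sum_congr rfl fun b _ => Finset.sum_congr rfl fun c _ => hQ b c
    linarith
  simp only [divergence, pd_rotate hr hw, Finset.sum_add_distrib, radialCurl]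
  rw [hsum, zero_add]

theorem IsExtreme.nullComp_divSnd_hodge (hM : 0 ≤ M) (hT : IsExtreme M T) (hp : p ∈ exterior M)
    (hd : ∀ a b, ContDiffAt ℝ 1 (fun y => T y a b) p) (hs : s ^ 2 = 1) :
    nullComp M s p (divSnd M (hodge M T) p) = -(s * radialCurl (nullContr M s T) p) := by
  have hr := radius_pos hM hp
  have hn := differentiableAt_dr hr
  have hw (b : Fin 4) : DifferentiableAt ℝ (fun y => nullContr M s T y b) p :=
    (contDiffAt_nullContr hr hd s b).differentiableAt one_ne_zero
  rw [(hT.isTransverse_hodge hM).nullComp_divSnd hM hp fun a b =>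
    (contDiffAt_hodge hM hp hd a b).differentiableAt one_ne_zero, ← divergence_rotate hr hw,
    divergence, divergence, Finset.mul_sum]
  congr 1
  refine Finset.sum_congr rfl fun b _ => ?_
  rw [pd_congr (g := fun y => s * rotate y (nullContr M s T y) b), pd_mul _ (by fun_prop), pd_const]
  · ring
  · unfold rotate
    fun_prop
  · filter_upwards [(isOpen_exterior M).mem_nhds hp] with y hy
    exact hT.nullContr_hodge hM hy hs b

theorem Uup_eq (hM : 0 ≤ M) (hp : p ∈ exterior M) (a : Fin 4) :
    Uup M p a = lapseSq M p / radius p * dr p a := by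
  have expand (b : Fin 4) :
      invMetric M p a b * U p b = -(radius p)⁻¹ * (invMetric M p a b * dr p b) := by
    rw [U, pd_radius (radius_pos hM hp)]
    ring
  simp only [Uup, expand, ← Finset.mul_sum, sum_invMetric_dr hM hp]
  ring

theorem IsTransverse.nullComp_sum_Uup_mul (hM : 0 ≤ M) (hT : IsTransverse M T)
    (hp : p ∈ exterior M) : nullComp M s p (fun a => ∑ b, Uup M p b * T p a b) = 0 := by
  calc nullComp M s p (fun a => ∑ b, Uup M p b * T p a b)
      = lapseSq M p / radius p * ∑ b, dr p b * nullContr M s T p b := by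
        simp only [nullContr, nullComp, Uup_eq hM hp, Finset.mul_sum]
        rw [Finset.sum_comm]
        exact Finset.sum_congr rfl fun b _ => Finset.sum_congr rfl fun a _ => by ring
    _ = 0 := by rw [(hT.isTangential_nullContr hp s).sum_dr_eq_zero, mul_zero]

theorem betaRe_eq (M : ℝ) (F : TensorField) (p : Point) (a : Fin 4) : betaRe M F p a
    = -(1 / 2) * (∑ b, Uup M p b * Z M F p a b) - 1 / 2 * divSnd M (Z M F) p a := by
  simp [betaRe, beta]

theorem betaIm_eq (M : ℝ) (F : TensorField) (p : Point) (a : Fin 4) : betaIm M F p a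
    = -(1 / 2) * (∑ b, Uup M p b * hodge M (Z M F) p a b)
      - 1 / 2 * divSnd M (hodge M (Z M F)) p a := by
  simp [betaIm, beta]

theorem nullComp_betaRe (hM : 0 ≤ M) (hp : p ∈ exterior M)
    (hF : ∀ a b, ContDiffAt ℝ 1 (fun y => F y a b) p) :
    nullComp M s p (betaRe M F p) = 1 / 2 * divergence (nullContr M s (Z M F)) p := by
  have hZ := (isExtreme_Z hM F).toIsTransverse
  rw [funext (betaRe_eq M F p), nullComp_sub, nullComp_const_mul, nullComp_const_mul,
    hZ.nullComp_sum_Uup_mul hM hp, hZ.nullComp_divSnd hM hp fun a b =>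
    (contDiffAt_Z hM hp hF a b).differentiableAt one_ne_zero]
  ring

theorem nullComp_betaIm (hM : 0 ≤ M) (hp : p ∈ exterior M)
    (hF : ∀ a b, ContDiffAt ℝ 1 (fun y => F y a b) p) (hs : s ^ 2 = 1) :
    nullComp M s p (betaIm M F p) = 1 / 2 * (s * radialCurl (nullContr M s (Z M F)) p) := by
  have hZ := isExtreme_Z hM F
  rw [funext (betaIm_eq M F p), nullComp_sub, nullComp_const_mul, nullComp_const_mul,
    (hZ.isTransverse_hodge hM).nullComp_sum_Uup_mul hM hp,
    hZ.nullComp_divSnd_hodge hM hp (contDiffAt_Z hM hp hF) hs]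
  ring

end NullComponentsBeta

/-! ### Null components of the currents -/

/-- The projection of a covector to the tangent plane of the orbit sphere. -/
def tangential (p : Point) (v : Fin 4 → ℝ) (a : Fin 4) : ℝ :=
  v a - dt a * v 0 - dr p a * ∑ b, dr p b * v b

/-- The superenergy tensor `v_a v_b - ½ g_{ab} v^c v_c` of a real one-form. -/
def stressTensor (M : ℝ) (p : Point) (v : Fin 4 → ℝ) (a b : Fin 4) : ℝ :=
  v a * v b - 1 / 2 * metric M p a b * ∑ c, (∑ d, invMetric M p c d * v d) * v c

/-- The squared modulus `|l^a β_a|²` of the component of `β` along the radial null vector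
`nullVec`. -/
def betaNullSq (M s : ℝ) (F : TensorField) (p : Point) : ℝ :=
  nullComp M s p (betaRe M F p) ^ 2 + nullComp M s p (betaIm M F p) ^ 2

/-- The squared length of the part of `β` tangential to the orbit spheres. -/
def betaTanSq (M : ℝ) (F : TensorField) (p : Point) : ℝ :=
  ∑ a, (tangential p (betaRe M F p) a ^ 2 + tangential p (betaIm M F p) a ^ 2)

section StressTensor

variable {M s : ℝ} {p : Point}

theorem nullComp_dr (hr : 0 < radius p) (M s : ℝ) : nullComp M s p (dr p) = s * lapseSq M p := by
  rw [nullComp_eq, sum_dr_mul_dr hr, dr_zero, zero_add, mul_one]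

theorem nullComp_metric (hM : 0 ≤ M) (hp : p ∈ exterior M) (s : ℝ) (b : Fin 4) :
    nullComp M s p (fun a => metric M p a b) = lapseSq M p * dt b - s * dr p b := by
  have hf := (lapseSq_pos hM hp).ne'
  have expand (a : Fin 4) : dr p a * metric M p a b = dt b * lapseSq M p * (dt a * dr p a)
      - spatialDelta b a * dr p a + (1 - (lapseSq M p)⁻¹) * dr p b * (dr p a * dr p a) := by
    rw [metric_eq, spatialDelta_comm]
    ring
  have time : metric M p 0 b = lapseSq M p * dt b := by
    rw [metric_eq, spatialDelta_comm, spatialDelta_zero, dr_zero, show dt 0 = 1 from rfl]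
    ring
  simp only [nullComp_eq, time, expand, Finset.sum_add_distrib, Finset.sum_sub_distrib,
    ← Finset.mul_sum, sum_dt_mul, sum_spatialDelta_mul, sum_dr_mul_dr (radius_pos hM hp), dr_zero]
  field_simp
  ring

theorem sum_tangential_sq (hr : 0 < radius p) (v : Fin 4 → ℝ) :
    ∑ a, tangential p v a ^ 2 = ∑ a, v a ^ 2 - v 0 ^ 2 - (∑ b, dr p b * v b) ^ 2 := by
  have expand (a : Fin 4) : tangential p v a ^ 2 = v a ^ 2 + v 0 ^ 2 * (dt a * dt a)
      + (∑ b, dr p b * v b) ^ 2 * (dr p a * dr p a) - 2 * v 0 * (dt a * v a)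
      - 2 * (∑ b, dr p b * v b) * (dr p a * v a)
      + 2 * v 0 * (∑ b, dr p b * v b) * (dt a * dr p a) := by
    rw [tangential]
    ring
  simp only [expand, Finset.sum_add_distrib, Finset.sum_sub_distrib, ← Finset.mul_sum, sum_dt_mul,
    sum_dr_mul_dr hr, dr_zero, show dt 0 = 1 from rfl]
  ring

theorem sum_sum_invMetric_mul_mul_self (hM : 0 ≤ M) (hp : p ∈ exterior M) (v : Fin 4 → ℝ) :
    ∑ c, (∑ d, invMetric M p c d * v d) * v c = (lapseSq M p)⁻¹ * v 0 ^ 2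
      - lapseSq M p * (∑ b, dr p b * v b) ^ 2 - ∑ a, tangential p v a ^ 2 := by
  have expand (c : Fin 4) : (∑ d, invMetric M p c d * v d) * v c
      = ((lapseSq M p)⁻¹ + 1) * v 0 * (dt c * v c) - v c ^ 2
        + (1 - lapseSq M p) * (∑ b, dr p b * v b) * (dr p c * v c) := by
    rw [sum_invMetric_mul hM hp]
    ring
  rw [sum_tangential_sq (radius_pos hM hp)]
  simp only [expand, Finset.sum_add_distrib, Finset.sum_sub_distrib, ← Finset.mul_sum, sum_dt_mul]
  ring

theorem nullComp_stressTensor (hM : 0 ≤ M) (hp : p ∈ exterior M) (s : ℝ) (v : Fin 4 → ℝ)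
    (b : Fin 4) :
    nullComp M s p (fun a => stressTensor M p v a b) = nullComp M s p v * v b
      - 1 / 2 * (lapseSq M p * dt b - s * dr p b) * ((lapseSq M p)⁻¹ * v 0 ^ 2
        - lapseSq M p * (∑ b, dr p b * v b) ^ 2 - ∑ a, tangential p v a ^ 2) := by
  have hlin (k : ℝ) : nullComp M s p (fun a => v a * v b - 1 / 2 * metric M p a b * k)
      = v b * nullComp M s p v - 1 / 2 * k * nullComp M s p (fun a => metric M p a b) := by
    rw [← nullComp_const_mul, ← nullComp_const_mul, ← nullComp_sub]
    congr 1
    ext a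
    ring
  simp only [stressTensor]
  rw [hlin, nullComp_metric hM hp, sum_sum_invMetric_mul_mul_self hM hp]
  ring

theorem nullComp_stressTensor_time (hM : 0 ≤ M) (hp : p ∈ exterior M) (hs : s ^ 2 = 1)
    (v : Fin 4 → ℝ) :
    nullComp M s p (fun a => stressTensor M p v a 0)
      = 1 / 2 * (nullComp M s p v ^ 2 + lapseSq M p * ∑ a, tangential p v a ^ 2) := by
  have hg : lapseSq M p * (lapseSq M p)⁻¹ = 1 := mul_inv_cancel₀ (lapseSq_pos hM hp).ne'
  rw [nullComp_stressTensor hM hp, nullComp_eq, dr_zero, show dt 0 = 1 from rfl]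
  linear_combination -(1 / 2) * v 0 ^ 2 * hg
    - 1 / 2 * lapseSq M p ^ 2 * (∑ b, dr p b * v b) ^ 2 * hs

theorem nullComp_stressTensor_radial (hM : 0 ≤ M) (hp : p ∈ exterior M) (hs : s ^ 2 = 1)
    (v : Fin 4 → ℝ) :
    nullComp M s p (fun a => ∑ b, stressTensor M p v a b * dr p b)
      = s * (lapseSq M p)⁻¹
        * (1 / 2 * (nullComp M s p v ^ 2 - lapseSq M p * ∑ a, tangential p v a ^ 2)) := by
  have hg : lapseSq M p * (lapseSq M p)⁻¹ = 1 := mul_inv_cancel₀ (lapseSq_pos hM hp).ne'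
  let k := (lapseSq M p)⁻¹ * v 0 ^ 2 - lapseSq M p * (∑ b, dr p b * v b) ^ 2
    - ∑ a, tangential p v a ^ 2
  have expand (b : Fin 4) : nullComp M s p (fun a => stressTensor M p v a b * dr p b)
      = nullComp M s p v * (dr p b * v b) - 1 / 2 * lapseSq M p * k * (dt b * dr p b)
        + 1 / 2 * s * k * (dr p b * dr p b) := by
    simp only [mul_comm _ (dr p b), nullComp_const_mul]
    rw [nullComp_stressTensor hM hp]
    ring
  simp only [nullComp_sum, expand, Finset.sum_add_distrib, Finset.sum_sub_distrib,
    ← Finset.mul_sum, sum_dt_mul, dr_zero, sum_dr_mul_dr (radius_pos hM hp)]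
  rw [nullComp_eq]
  simp only [k]
  generalize ∑ b, dr p b * v b = x
  generalize ∑ a, tangential p v a ^ 2 = t
  generalize (lapseSq M p)⁻¹ = g at *
  generalize lapseSq M p = f at *
  linear_combination (-(v 0 * x) * s ^ 2 + 1 / 2 * s * t - 1 / 2 * s ^ 3 * f * x ^ 2) * hg
    - (v 0 * x + 1 / 2 * s * f * x ^ 2) * hs

end StressTensor

section Superenergy

variable {M s : ℝ} {F : TensorField} {p : Point}

theorem betaUp_re (M : ℝ) (F : TensorField) (p : Point) (a : Fin 4) :
    (betaUp M F p a).re = ∑ b, invMetric M p a b * betaRe M F p b := by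
  simp [betaUp, betaRe]

theorem betaUp_im (M : ℝ) (F : TensorField) (p : Point) (a : Fin 4) :
    (betaUp M F p a).im = ∑ b, invMetric M p a b * betaIm M F p b := by
  simp [betaUp, betaIm]

theorem H_eq (M : ℝ) (F : TensorField) (p : Point) (a b : Fin 4) :
    H M F p a b = stressTensor M p (betaRe M F p) a b + stressTensor M p (betaIm M F p) a b := by
  simp only [stressTensor, ← betaUp_re, ← betaUp_im, H, Complex.re_sum, Complex.mul_re,
    Complex.star_def, Complex.conj_re, Complex.conj_im, mul_neg, sub_neg_eq_add,
    Finset.sum_add_distrib]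
  simp only [betaRe, betaIm]
  ring

theorem nullComp_currentXi (hM : 0 ≤ M) (hp : p ∈ exterior M) (hs : s ^ 2 = 1) :
    nullComp M s p (currentXi M F p)
      = 1 / 2 * (betaNullSq M s F p + lapseSq M p * betaTanSq M F p) := by
  have hJ : currentXi M F p = fun a =>
      stressTensor M p (betaRe M F p) a 0 + stressTensor M p (betaIm M F p) a 0 := by
    ext a
    simp [currentXi, xi, H_eq]
  rw [hJ, nullComp_add, nullComp_stressTensor_time hM hp hs, nullComp_stressTensor_time hM hp hs,
    betaNullSq, betaTanSq, Finset.sum_add_distrib]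
  ring

theorem A_eq (hM : 0 ≤ M) (hp : p ∈ exterior M) (b : Fin 4) :
    A M p b = lapseSq M p * ((radius p - 3 * M) / (2 * radius p)) * dr p b := by
  have hr := radius_pos hM hp
  simp only [A, lapseSq, dr]
  split_ifs <;> field_simp

theorem nullComp_sum_H_mul_A (hM : 0 ≤ M) (hp : p ∈ exterior M) (hs : s ^ 2 = 1) :
    nullComp M s p (fun a => ∑ b, H M F p a b * A M p b)
      = s * ((radius p - 3 * M) / (2 * radius p))
        * (1 / 2 * (betaNullSq M s F p - lapseSq M p * betaTanSq M F p)) := by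
  have hg : lapseSq M p * (lapseSq M p)⁻¹ = 1 := mul_inv_cancel₀ (lapseSq_pos hM hp).ne'
  have hHA : (fun a => ∑ b, H M F p a b * A M p b) = fun a =>
      lapseSq M p * ((radius p - 3 * M) / (2 * radius p))
        * (∑ b, stressTensor M p (betaRe M F p) a b * dr p b
          + ∑ b, stressTensor M p (betaIm M F p) a b * dr p b) := by
    ext a
    rw [← Finset.sum_add_distrib, Finset.mul_sum]
    exact Finset.sum_congr rfl fun b _ => by rw [H_eq, A_eq hM hp]; ring
  rw [hHA, nullComp_const_mul, nullComp_add, nullComp_stressTensor_radial hM hp hs,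
    nullComp_stressTensor_radial hM hp hs, betaNullSq, betaTanSq, Finset.sum_add_distrib]
  linear_combination s * ((radius p - 3 * M) / (2 * radius p)) * (1 / 2 *
    (nullComp M s p (betaRe M F p) ^ 2 + nullComp M s p (betaIm M F p) ^ 2
      - lapseSq M p * (∑ a, tangential p (betaRe M F p) a ^ 2
        + ∑ a, tangential p (betaIm M F p) a ^ 2))) * hg

theorem IsTangential.sum_tangential_mul {w : Fin 4 → ℝ} (hw : IsTangential p w)
    (v : Fin 4 → ℝ) : ∑ a, tangential p v a * w a = ∑ a, v a * w a := by
  have expand (a : Fin 4) : tangential p v a * w a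
      = v a * w a - v 0 * (dt a * w a) - (∑ b, dr p b * v b) * (dr p a * w a) := by
    rw [tangential]
    ring
  simp only [expand, Finset.sum_sub_distrib, ← Finset.mul_sum, sum_dt_mul, hw.time_eq_zero,
    hw.sum_dr_eq_zero, mul_zero, sub_zero]

theorem IsTransverse.nullComp_sum_raise_mul (hM : 0 ≤ M) {T : TensorField}
    (hT : IsTransverse M T) (hp : p ∈ exterior M) (s : ℝ) (v : Fin 4 → ℝ) :
    nullComp M s p (fun a => ∑ b, (∑ c, invMetric M p b c * v c) * T p a b)
      = -∑ b, tangential p v b * nullContr M s T p b := by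
  have hw := hT.isTangential_nullContr hp s
  simp only [nullComp_sum, nullComp_const_mul, hw.sum_tangential_mul, ← Finset.sum_neg_distrib,
    ← mul_neg]
  change ∑ b, (∑ c, invMetric M p b c * v c) * nullContr M s T p b = _
  simp only [← hw.sum_invMetric_mul hM hp, Finset.sum_mul, Finset.mul_sum]
  rw [Finset.sum_comm]
  exact Finset.sum_congr rfl fun b _ => Finset.sum_congr rfl fun c _ => by
    rw [invMetric_comm hM hp]
    ring

theorem crossTerm_re (M : ℝ) (F : TensorField) (p : Point) (a : Fin 4) :
    (crossTerm M F p a).re = 1 / 2 * q M p *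
      (∑ b, (∑ c, invMetric M p b c * betaRe M F p c) * Z M F p a b
        + ∑ b, (∑ c, invMetric M p b c * betaIm M F p c) * hodge M (Z M F) p a b) := by
  rw [crossTerm, Complex.re_sum, ← Finset.sum_add_distrib, Finset.mul_sum]
  refine Finset.sum_congr rfl fun b _ => ?_
  rw [← betaUp_re, ← betaUp_im, show (1 / 4 : ℂ) = ((1 / 4 : ℝ) : ℂ) by push_cast; rfl]
  simp only [Complex.add_re, Complex.sub_re, Complex.mul_re, Complex.mul_im, Complex.ofReal_re,
    Complex.ofReal_im, Complex.I_re, Complex.I_im, Complex.star_def, Complex.conj_re,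
    Complex.conj_im]
  ring

theorem nullComp_crossTerm (hM : 0 ≤ M) (hp : p ∈ exterior M) (s : ℝ) :
    nullComp M s p (fun a => (crossTerm M F p a).re) = -(1 / 2) * q M p *
      ∑ b, (tangential p (betaRe M F p) b * nullContr M s (Z M F) p b
        + tangential p (betaIm M F p) b * nullContr M s (hodge M (Z M F)) p b) := by
  have hZ := isExtreme_Z hM F
  rw [funext (crossTerm_re M F p), nullComp_const_mul, nullComp_add,
    hZ.toIsTransverse.nullComp_sum_raise_mul hM hp,
    (hZ.isTransverse_hodge hM).nullComp_sum_raise_mul hM hp, Finset.sum_add_distrib]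
  ring

end Superenergy

/-- The radial derivative of `q`. -/
def qDeriv (M : ℝ) (p : Point) : ℝ :=
  9 * M ^ 2 * (-6 * radius p ^ 2 + 28 * M * radius p - 30 * M ^ 2) / (4 * radius p ^ 6)

section PotentialTerms

variable {M s : ℝ} {F : TensorField} {p : Point}

theorem pd_q (hr : 0 < radius p) (M : ℝ) (a : Fin 4) : pd a (q M) p = qDeriv M p * dr p a := by
  have hnum : HasDerivAt (fun r : ℝ => 9 * M ^ 2 * (r - 2 * M) * (2 * r - 3 * M))
      (9 * M ^ 2 * (4 * radius p - 7 * M)) (radius p) := by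
    refine ((((hasDerivAt_id' (radius p)).sub_const (2 * M)).const_mul (9 * M ^ 2)).fun_mul
      (((hasDerivAt_id' (radius p)).const_mul 2).sub_const (3 * M))).congr_deriv ?_
    ring
  have hden : HasDerivAt (fun r : ℝ => 4 * r ^ 5) (4 * (5 * radius p ^ 4)) (radius p) := by
    simpa using (hasDerivAt_pow 5 (radius p)).const_mul 4
  refine pd_comp_radius hr a ((hnum.fun_div hden (by positivity)).congr_deriv ?_)
  rw [qDeriv]
  field_simp
  ring

theorem sum_sum_mul_wedge {T : Fin 4 → Fin 4 → ℝ} (hT : ∀ a b, T a b = -T b a)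
    (u v : Fin 4 → ℝ) :
    ∑ b, ∑ d, T b d * (u b * v d - u d * v b) = 2 * ∑ d, (∑ b, u b * T b d) * v d := by
  have hfst : ∑ b, ∑ d, T b d * (u b * v d) = ∑ d, (∑ b, u b * T b d) * v d := by
    rw [Finset.sum_comm]
    simp only [Finset.sum_mul]
    exact Finset.sum_congr rfl fun d _ => Finset.sum_congr rfl fun b _ => by ring
  have hsnd : ∑ b, ∑ d, T b d * (u d * v b) = -∑ d, (∑ b, u b * T b d) * v d := by
    simp only [Finset.sum_mul, ← Finset.sum_neg_distrib]
    exact Finset.sum_congr rfl fun d _ => Finset.sum_congr rfl fun b _ => by rw [hT d b]; ring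
  simp only [mul_sub, Finset.sum_sub_distrib, hfst, hsnd]
  ring

theorem sum_sum_invMetric_mul_ZZ (hM : 0 ≤ M) (hp : p ∈ exterior M) :
    ∑ b, ∑ c, invMetric M p b c * ZZ M F p b c
      = 2 * lapseSq M p * ∑ b, radial (Z M F) p b ^ 2
        - 2 * (lapseSq M p)⁻¹ * ∑ b, Z M F p 0 b ^ 2 := by
  have hZ := isExtreme_Z hM F
  have raise (b : Fin 4) : ∑ c, invMetric M p b c * ZZ M F p b c
      = ∑ d, Z M F p b d
        * ∑ e, ∑ f, invMetric M p b e * invMetric M p d f * Z M F p e f := by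
    simp only [ZZ, Finset.mul_sum]
    rw [Finset.sum_congr rfl fun _ _ => Finset.sum_comm, Finset.sum_comm]
    exact Finset.sum_congr rfl fun d _ => Finset.sum_congr rfl fun c _ =>
      Finset.sum_congr rfl fun e _ => by ring
  have hwedge := sum_sum_mul_wedge (hZ.antisymm p hp)
  simp only [raise, hZ.sum_invMetric_mul_invMetric_mul hM hp, mul_add (Z M F p _ _),
    mul_left_comm (Z M F p _ _), Finset.sum_add_distrib, ← Finset.mul_sum, hwedge, sum_dt_mul]
  simp only [← radial.eq_1, ← sq]
  ring

theorem nullComp_sum_ZZ_mul_dr (hM : 0 ≤ M) (hp : p ∈ exterior M) (s : ℝ) :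
    nullComp M s p (fun a => ∑ b, ZZ M F p a b * dr p b)
      = -∑ c, nullContr M s (Z M F) p c * radial (Z M F) p c := by
  have hZ := isExtreme_Z hM F
  have raise (a : Fin 4) : ∑ b, ZZ M F p a b * dr p b
      = ∑ d, (∑ c, invMetric M p d c * radial (Z M F) p c) * Z M F p a d := by
    simp only [ZZ, radial, Finset.sum_mul, Finset.mul_sum]
    rw [Finset.sum_comm, Finset.sum_congr rfl fun _ _ => Finset.sum_comm, Finset.sum_comm]
    exact Finset.sum_congr rfl fun d _ => Finset.sum_congr rfl fun c _ =>
      Finset.sum_congr rfl fun b _ => by ring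
  rw [funext raise, hZ.toIsTransverse.nullComp_sum_raise_mul hM hp]
  simp only [mul_comm (radial (Z M F) p _),
    (hZ.toIsTransverse.isTangential_nullContr hp s).sum_tangential_mul]

theorem sum_nullContr_mul_radial (M s : ℝ) (T : TensorField) (p : Point) :
    ∑ b, nullContr M s T p b * radial T p b
      = ∑ b, T p 0 b * radial T p b + s * lapseSq M p * ∑ b, radial T p b ^ 2 := by
  rw [Finset.mul_sum, ← Finset.sum_add_distrib]
  exact Finset.sum_congr rfl fun b _ => by rw [nullContr_eq]; ring

theorem sum_nullContr_sq (M s : ℝ) (T : TensorField) (p : Point) :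
    ∑ b, nullContr M s T p b ^ 2 = ∑ b, T p 0 b ^ 2
      + 2 * s * lapseSq M p * ∑ b, T p 0 b * radial T p b
      + s ^ 2 * lapseSq M p ^ 2 * ∑ b, radial T p b ^ 2 := by
  rw [Finset.mul_sum, Finset.mul_sum, ← Finset.sum_add_distrib, ← Finset.sum_add_distrib]
  exact Finset.sum_congr rfl fun b _ => by rw [nullContr_eq]; ring

theorem sum_sum_ZZ_mul_pd_q (hM : 0 ≤ M) (hp : p ∈ exterior M) (a : Fin 4) :
    ∑ b, ∑ c, ZZ M F p a b * invMetric M p b c * pd c (q M) p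
      = -(lapseSq M p * qDeriv M p) * ∑ b, ZZ M F p a b * dr p b := by
  simp only [pd_q (radius_pos hM hp), mul_assoc, mul_left_comm _ (qDeriv M p), ← Finset.mul_sum,
    sum_invMetric_dr hM hp]
  simp only [neg_mul, mul_neg, Finset.sum_neg_distrib, mul_left_comm _ (lapseSq M p),
    ← Finset.mul_sum]
  ring

theorem nullComp_potentialTerms (hM : 0 ≤ M) (hp : p ∈ exterior M) (hs : s ^ 2 = 1) :
    nullComp M s p (fun a =>
      1 / 16 * (∑ b, ∑ c, invMetric M p b c * ZZ M F p b c) * pd a (q M) p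
        - 1 / 4 * ∑ b, ∑ c, ZZ M F p a b * invMetric M p b c * pd c (q M) p)
      = -(1 / 8) * s * qDeriv M p * ∑ b, nullContr M s (Z M F) p b ^ 2 := by
  have hr := radius_pos hM hp
  have hg : lapseSq M p * (lapseSq M p)⁻¹ = 1 := mul_inv_cancel₀ (lapseSq_pos hM hp).ne'
  have hcov : (fun a => 1 / 16 * (∑ b, ∑ c, invMetric M p b c * ZZ M F p b c) * pd a (q M) p
        - 1 / 4 * ∑ b, ∑ c, ZZ M F p a b * invMetric M p b c * pd c (q M) p)
      = fun a => (1 / 16 * (∑ b, ∑ c, invMetric M p b c * ZZ M F p b c) * qDeriv M p) * dr p a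
        - -(1 / 4 * lapseSq M p * qDeriv M p) * ∑ b, ZZ M F p a b * dr p b := by
    ext a
    rw [sum_sum_ZZ_mul_pd_q hM hp, pd_q hr]
    ring
  rw [hcov, nullComp_sub, nullComp_const_mul, nullComp_const_mul, nullComp_dr hr,
    sum_sum_invMetric_mul_ZZ hM hp, nullComp_sum_ZZ_mul_dr hM hp, sum_nullContr_mul_radial,
    sum_nullContr_sq]
  generalize ∑ b, Z M F p 0 b * radial (Z M F) p b = ER
  generalize ∑ b, Z M F p 0 b ^ 2 = EE
  generalize ∑ b, radial (Z M F) p b ^ 2 = RR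
  linear_combination qDeriv M p * (-(1 / 8) * s * EE * hg
    + (1 / 4 * lapseSq M p * ER + 1 / 8 * s * lapseSq M p ^ 2 * RR) * hs)

theorem nullComp_currentXiAq (hM : 0 ≤ M) (hp : p ∈ exterior M) (hs : s ^ 2 = 1) :
    nullComp M s p (currentXiAq M F p)
      = 1 / 2 * ((1 + s * ((radius p - 3 * M) / (2 * radius p))) * betaNullSq M s F p
          + (1 - s * ((radius p - 3 * M) / (2 * radius p))) * (lapseSq M p * betaTanSq M F p))
        - 1 / 2 * q M p * ∑ b, (tangential p (betaRe M F p) b * nullContr M s (Z M F) p b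
          + tangential p (betaIm M F p) b * nullContr M s (hodge M (Z M F)) p b)
        - 1 / 8 * s * qDeriv M p * ∑ b, nullContr M s (Z M F) p b ^ 2 := by
  have hJ : currentXiAq M F p = fun a => currentXi M F p a + (((∑ b, H M F p a b * A M p b)
      + (crossTerm M F p a).re)
      + (1 / 16 * (∑ b, ∑ c, invMetric M p b c * ZZ M F p b c) * pd a (q M) p
        - 1 / 4 * ∑ b, ∑ c, ZZ M F p a b * invMetric M p b c * pd c (q M) p)) := by
    ext a
    rw [currentXiAq, P]
    ring
  rw [hJ, nullComp_add, nullComp_add, nullComp_add, nullComp_currentXi hM hp hs,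
    nullComp_sum_H_mul_A hM hp hs, nullComp_crossTerm hM hp, nullComp_potentialTerms hM hp hs]
  ring

end PotentialTerms

/-! ### The pointwise energy estimate -/

theorem potential_lower_bound {x s : ℝ} (h0 : 0 ≤ x) (h1 : x < 1 / 2) (hs : s ^ 2 = 1) :
    1 / 5 ≤ (9 / 10 + s * ((1 - 3 * x) / 2)) / 2
      - s * (9 / 16 * (-6 * x ^ 2 + 28 * x ^ 3 - 30 * x ^ 4)) := by
  rcases sq_eq_one_iff.mp hs with rfl | rfl
  · have hquad : -(8 / 15) ≤ 6 - 28 * x + 30 * x ^ 2 := by nlinarith [sq_nonneg (x - 7 / 15)]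
    have hx : x ^ 2 ≤ 1 / 4 := by nlinarith
    have hquartic : -(2 / 15) ≤ x ^ 2 * (6 - 28 * x + 30 * x ^ 2) := by nlinarith [sq_nonneg x]
    nlinarith
  · have hcube : x ^ 3 ≤ x ^ 2 / 2 := by nlinarith [sq_nonneg x]
    have hcubic : 6 * x - 28 * x ^ 2 + 30 * x ^ 3 ≤ 4 / 3 := by
      nlinarith [sq_nonneg (x - 3 / 13)]
    have hquartic : x * (6 * x - 28 * x ^ 2 + 30 * x ^ 3) ≤ x * (4 / 3) := by gcongr
    nlinarith

theorem cross_coefficient_bound {x : ℝ} (h0 : 0 ≤ x) (h1 : x < 1 / 2) :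
    81 / 16 * (x ^ 4 * (1 - 2 * x) * (2 - 3 * x) ^ 2) ≤ 4 / 25 := by
  have ha : x * (1 - 2 * x) ≤ 1 / 8 := by nlinarith [sq_nonneg (x - 1 / 4)]
  have hb : x * (2 - 3 * x) ≤ 1 / 3 := by nlinarith [sq_nonneg (x - 1 / 3)]
  have ha0 : 0 ≤ x * (1 - 2 * x) := by nlinarith
  have hc : (x * (2 - 3 * x)) ^ 2 ≤ (1 / 3) ^ 2 :=
    pow_le_pow_left₀ (mul_nonneg h0 (by linarith)) hb 2
  have hd : x * (x * (1 - 2 * x)) ≤ 1 / 16 := by nlinarith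
  calc 81 / 16 * (x ^ 4 * (1 - 2 * x) * (2 - 3 * x) ^ 2)
      = 81 / 16 * (x * (x * (1 - 2 * x)) * (x * (2 - 3 * x)) ^ 2) := by ring
    _ ≤ 81 / 16 * (1 / 16 * (1 / 3) ^ 2) := by gcongr
    _ ≤ 4 / 25 := by norm_num

/-- Here `x = M / r`, while `V` stands for the squared length of a null component of `Z`,
divided by `r²`. -/
theorem two_mul_abs_le_of_sq_le {x s B V c : ℝ} (h0 : 0 ≤ x) (h1 : x < 1 / 2) (hs : s ^ 2 = 1)
    (hB : 0 ≤ B) (hV : 0 ≤ V)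
    (hc : c ^ 2 ≤ 81 / 32 * (x ^ 2 * (1 - 2 * x) * (2 - 3 * x)) ^ 2 * B * V) :
    2 * |c| ≤ (9 / 10 - s * ((1 - 3 * x) / 2)) * ((1 - 2 * x) * B)
      + ((9 / 10 + s * ((1 - 3 * x) / 2)) / 2
        - s * (9 / 16 * (-6 * x ^ 2 + 28 * x ^ 3 - 30 * x ^ 4))) * V := by
  have hf : 0 ≤ 1 - 2 * x := by linarith
  have hK := potential_lower_bound h0 h1 hs
  set K := (9 / 10 + s * ((1 - 3 * x) / 2)) / 2
      - s * (9 / 16 * (-6 * x ^ 2 + 28 * x ^ 3 - 30 * x ^ 4))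
  have hL : 2 / 5 ≤ 9 / 10 - s * ((1 - 3 * x) / 2) := by
    rcases sq_eq_one_iff.mp hs with rfl | rfl <;> linarith
  set L := 9 / 10 - s * ((1 - 3 * x) / 2)
  have hKL : 2 / 5 * (1 / 5) ≤ L * K := by gcongr
  refine two_mul_le_add_of_sq_le_mul (by positivity) (by positivity) ?_
  calc |c| ^ 2 ≤ 81 / 32 * (x ^ 2 * (1 - 2 * x) * (2 - 3 * x)) ^ 2 * B * V := by rwa [sq_abs]
    _ = 81 / 16 * (x ^ 4 * (1 - 2 * x) * (2 - 3 * x) ^ 2) * (1 / 2 * (1 - 2 * x) * B * V) := by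
      ring
    _ ≤ 4 / 25 * (1 / 2 * (1 - 2 * x) * B * V) := by
      gcongr
      exact cross_coefficient_bound h0 h1
    _ ≤ 2 * (L * K) * (1 / 2 * (1 - 2 * x) * B * V) := by
      gcongr
      linarith
    _ = L * ((1 - 2 * x) * B) * (K * V) := by ring

theorem rotate_eq_vecCons (p : Point) (w : Fin 4 → ℝ) :
    rotate p w = ![0, dr p 2 * w 3 - dr p 3 * w 2, dr p 3 * w 1 - dr p 1 * w 3,
      dr p 1 * w 2 - dr p 2 * w 1] := by
  ext b
  fin_cases b <;> norm_num [rotate, Fin.sum_univ_four, leviCivita_eq] <;> ring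

theorem sum_sq_rotate {p : Point} (hr : 0 < radius p) {w : Fin 4 → ℝ} (hw : IsTangential p w) :
    ∑ b, rotate p w b ^ 2 = ∑ b, w b ^ 2 := by
  have hunit := sum_dr_sq hr
  have hn := hw.sum_dr_eq_zero
  simp only [Fin.sum_univ_four, dr_zero, hw.time_eq_zero, mul_zero, zero_add] at hn
  simp only [rotate_eq_vecCons, Fin.sum_univ_four, hw.time_eq_zero, Matrix.cons_val]
  linear_combination (w 1 ^ 2 + w 2 ^ 2 + w 3 ^ 2) * hunit
    - (dr p 1 * w 1 + dr p 2 * w 2 + dr p 3 * w 3) * hn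

theorem sq_sum_mul_add_mul_le {ι : Type*} [Fintype ι] (u v : ι → ℝ) {w z : ι → ℝ}
    (h : ∑ b, z b ^ 2 = ∑ b, w b ^ 2) :
    (∑ b, (u b * w b + v b * z b)) ^ 2 ≤ 2 * (∑ b, (u b ^ 2 + v b ^ 2)) * ∑ b, w b ^ 2 := by
  have hu := Finset.sum_mul_sq_le_sq_mul_sq Finset.univ u w
  have hv := Finset.sum_mul_sq_le_sq_mul_sq Finset.univ v z
  rw [h] at hv
  simp only [Finset.sum_add_distrib]
  linarith [add_sq_le (a := ∑ b, u b * w b) (b := ∑ b, v b * z b)]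

/-- The defect `|div w|² + |curl w|² - 2 |w|² / r²` in the Poincaré inequality for the tangential
field `w`. -/
def poincareDefect (w : Point → Fin 4 → ℝ) (p : Point) : ℝ :=
  divergence w p ^ 2 + radialCurl w p ^ 2 - 2 * (∑ b, w p b ^ 2) / radius p ^ 2

section PointwiseEstimate

variable {M s : ℝ} {F : TensorField} {p : Point}

theorem two_mul_abs_le (hM : 0 ≤ M) (hp : p ∈ exterior M) {B W c : ℝ} (hs : s ^ 2 = 1)
    (hB : 0 ≤ B) (hW : 0 ≤ W) (hc : c ^ 2 ≤ 1 / 2 * q M p ^ 2 * B * W) :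
    2 * |c| ≤ (9 / 10 - s * ((radius p - 3 * M) / (2 * radius p))) * (lapseSq M p * B)
      + (9 / 10 + s * ((radius p - 3 * M) / (2 * radius p))) * (W / (2 * radius p ^ 2))
      - 1 / 4 * s * qDeriv M p * W := by
  have hr := radius_pos hM hp
  have hr' : 2 * M < radius p := hp
  rw [lapseSq, qDeriv]
  rw [q] at hc
  generalize radius p = r at *
  obtain ⟨x, rfl⟩ : ∃ x, M = x * r := ⟨M / r, by field_simp⟩
  have hx0 : 0 ≤ x := nonneg_of_mul_nonneg_left hM hr
  have hx1 : x < 1 / 2 := by nlinarith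
  refine (two_mul_abs_le_of_sq_le (V := W / r ^ 2) hx0 hx1 hs hB (by positivity)
    (hc.trans_eq ?_)).trans_eq ?_
  · field_simp
    ring
  · field_simp
    ring

theorem betaNullSq_eq (hM : 0 ≤ M) (hp : p ∈ exterior M)
    (hF : ∀ a b, ContDiffAt ℝ 1 (fun y => F y a b) p) (hs : s ^ 2 = 1) :
    betaNullSq M s F p = 1 / 4 * (divergence (nullContr M s (Z M F)) p ^ 2
      + radialCurl (nullContr M s (Z M F)) p ^ 2) := by
  rw [betaNullSq, nullComp_betaRe hM hp hF, nullComp_betaIm hM hp hF hs]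
  linear_combination 1 / 4 * radialCurl (nullContr M s (Z M F)) p ^ 2 * hs

theorem sum_sq_nullContr_hodge_Z (hM : 0 ≤ M) (hp : p ∈ exterior M) (hs : s ^ 2 = 1) :
    ∑ b, nullContr M s (hodge M (Z M F)) p b ^ 2 = ∑ b, nullContr M s (Z M F) p b ^ 2 := by
  have hZ := isExtreme_Z hM F
  simp only [hZ.nullContr_hodge hM hp hs, mul_pow, hs, one_mul]
  exact sum_sq_rotate (radius_pos hM hp) (hZ.toIsTransverse.isTangential_nullContr hp s)

theorem betaNullSq_nonneg : 0 ≤ betaNullSq M s F p := by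
  rw [betaNullSq]
  positivity

theorem betaTanSq_nonneg : 0 ≤ betaTanSq M F p := by
  rw [betaTanSq]
  positivity

theorem nullComp_currentXi_nonneg (hM : 0 ≤ M) (hp : p ∈ exterior M) (hs : s ^ 2 = 1) :
    0 ≤ nullComp M s p (currentXi M F p) := by
  rw [nullComp_currentXi hM hp hs]
  have := betaNullSq_nonneg (M := M) (s := s) (F := F) (p := p)
  have := betaTanSq_nonneg (M := M) (F := F) (p := p)
  have := lapseSq_pos hM hp
  positivity

theorem nullComp_bounds (hM : 0 ≤ M) (hp : p ∈ exterior M)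
    (hF : ∀ a b, ContDiffAt ℝ 1 (fun y => F y a b) p) (hs : s ^ 2 = 1) :
    1 / 8 * (9 / 10 + s * ((radius p - 3 * M) / (2 * radius p)))
          * poincareDefect (nullContr M s (Z M F)) p
        ≤ nullComp M s p (currentXiAq M F p) - 1 / 10 * nullComp M s p (currentXi M F p) ∧
      1 / 8 * (9 / 10 - s * ((radius p - 3 * M) / (2 * radius p)))
          * poincareDefect (nullContr M s (Z M F)) p
        ≤ 19 / 10 * nullComp M s p (currentXi M F p) - nullComp M s p (currentXiAq M F p) := by
  rw [nullComp_currentXiAq hM hp hs, nullComp_currentXi hM hp hs, betaNullSq_eq hM hp hF hs,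
    poincareDefect]
  have hcross := sq_sum_mul_add_mul_le (tangential p (betaRe M F p)) (tangential p (betaIm M F p))
    (sum_sq_nullContr_hodge_Z (F := F) hM hp hs)
  rw [← betaTanSq] at hcross
  set C := ∑ b, (tangential p (betaRe M F p) b * nullContr M s (Z M F) p b
    + tangential p (betaIm M F p) b * nullContr M s (hodge M (Z M F)) p b)
  have hB : 0 ≤ betaTanSq M F p := betaTanSq_nonneg
  have hW : 0 ≤ ∑ b, nullContr M s (Z M F) p b ^ 2 := by positivity
  set W := ∑ b, nullContr M s (Z M F) p b ^ 2
  have hc : (1 / 2 * q M p * C) ^ 2 ≤ 1 / 2 * q M p ^ 2 * betaTanSq M F p * W := by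
    linear_combination 1 / 4 * q M p ^ 2 * hcross
  have hlower := two_mul_abs_le hM hp hs hB hW hc
  have hupper := two_mul_abs_le hM hp (s := -s) (by rwa [neg_sq]) hB hW hc
  have hle := le_abs_self (1 / 2 * q M p * C)
  have hge := neg_abs_le (1 / 2 * q M p * C)
  have hhalf : 2 * W / radius p ^ 2 = 4 * (W / (2 * radius p ^ 2)) := by
    have := radius_pos hM hp
    field_simp
    ring
  rw [hhalf]
  constructor <;> linarith

theorem poincareDefect_nullContr_Z_le (hM : 0 ≤ M) (hp : p ∈ exterior M)
    (hF : ∀ a b, ContDiffAt ℝ 1 (fun y => F y a b) p) (hs : s ^ 2 = 1) :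
    poincareDefect (nullContr M s (Z M F)) p ≤ 8 * nullComp M s p (currentXi M F p) := by
  have hZ : 0 ≤ 2 * (∑ b, nullContr M s (Z M F) p b ^ 2) / radius p ^ 2 := by positivity
  have hβ := mul_nonneg (lapseSq_pos hM hp).le (betaTanSq_nonneg (M := M) (F := F) (p := p))
  rw [nullComp_currentXi hM hp hs, betaNullSq_eq hM hp hF hs, poincareDefect]
  linarith

end PointwiseEstimate

/-! ### Rotations of space -/

/-- An orientation-preserving linear isometry of space, that is, an element of `SO(3)`. -/
def IsRotation (R : Space ≃ₗᵢ[ℝ] Space) : Prop :=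
  LinearMap.det (R.toLinearEquiv : Space →ₗ[ℝ] Space) = 1

theorem IsRotation.symm {R : Space ≃ₗᵢ[ℝ] Space} (hR : IsRotation R) : IsRotation R.symm := by
  have h : LinearMap.det (R.symm.toLinearEquiv : Space →ₗ[ℝ] Space)
      = (LinearMap.det (R.toLinearEquiv : Space →ₗ[ℝ] Space))⁻¹ :=
    LinearEquiv.det_coe_symm R.toLinearEquiv
  rw [IsRotation, h, show LinearMap.det (R.toLinearEquiv : Space →ₗ[ℝ] Space) = 1 from hR, inv_one]

/-- A union of orbits of `SO(3)`. -/
def IsRotInvariant (K : Set Space) : Prop := ∀ R, IsRotation R → Set.MapsTo R K K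

theorem IsRotInvariant.preimage_eq {K : Set Space} (hK : IsRotInvariant K)
    {R : Space ≃ₗᵢ[ℝ] Space} (hR : IsRotation R) : R ⁻¹' K = K :=
  Set.ext fun x => ⟨fun hx => by simpa using hK R.symm hR.symm hx, fun hx => hK R hR hx⟩

theorem IsRotInvariant.setIntegral_comp {K : Set Space} (hK : IsRotInvariant K)
    {R : Space ≃ₗᵢ[ℝ] Space} (hR : IsRotation R) (g : Space → ℝ) :
    ∫ x in K, g (R x) = ∫ x in K, g x := by
  have h := R.measurePreserving.setIntegral_preimage_emb
    R.toHomeomorph.measurableEmbedding g K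
  rwa [hK.preimage_eq hR] at h

/-- The vector field `x ↦ e_i × x`, which generates the rotations about the `i`-th axis. -/
def rotGen (i : Fin 3) : Space →L[ℝ] Space :=
  (EuclideanSpace.proj (i + 1)).smulRight (EuclideanSpace.single (i + 2) 1)
    - (EuclideanSpace.proj (i + 2)).smulRight (EuclideanSpace.single (i + 1) 1)

theorem rotGen_apply (i : Fin 3) (x : Space) : rotGen i x
    = x (i + 1) • EuclideanSpace.single (i + 2) (1 : ℝ)
      - x (i + 2) • EuclideanSpace.single (i + 1) (1 : ℝ) := rfl

theorem rotGen_rotGen_sub (i j : Fin 3) (x : Space) :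
    rotGen j (rotGen i x) - rotGen i (rotGen j x)
      = x j • EuclideanSpace.single i (1 : ℝ) - x i • EuclideanSpace.single j (1 : ℝ) := by
  ext m
  fin_cases i <;> fin_cases j <;> fin_cases m <;> simp [rotGen_apply]

/-- The rotation by the angle `s` about the `i`-th axis, by Rodrigues' formula. -/
def rotMap (i : Fin 3) (s : ℝ) : Space →ₗ[ℝ] Space :=
  LinearMap.id + Real.sin s • (rotGen i : Space →ₗ[ℝ] Space)
    + (1 - Real.cos s) • ((rotGen i : Space →ₗ[ℝ] Space) ∘ₗ (rotGen i : Space →ₗ[ℝ] Space))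

theorem rotMap_apply (i : Fin 3) (s : ℝ) (x : Space) :
    rotMap i s x = x + Real.sin s • rotGen i x + (1 - Real.cos s) • rotGen i (rotGen i x) := rfl

theorem norm_rotMap (i : Fin 3) (s : ℝ) (x : Space) : ‖rotMap i s x‖ = ‖x‖ := by
  have h := Real.sin_sq_add_cos_sq s
  rw [EuclideanSpace.norm_eq, EuclideanSpace.norm_eq]
  congr 1
  simp only [Real.norm_eq_abs, sq_abs, Fin.sum_univ_three, rotMap_apply, PiLp.add_apply,
    PiLp.sub_apply, PiLp.smul_apply, PiLp.single_apply, smul_eq_mul, rotGen_apply]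
  fin_cases i <;> simp <;> grind

/-- `rotMap i s` as an isometry. -/
def rot (i : Fin 3) (s : ℝ) : Space ≃ₗᵢ[ℝ] Space :=
  LinearIsometry.toLinearIsometryEquiv ⟨rotMap i s, norm_rotMap i s⟩ rfl

theorem rot_apply (i : Fin 3) (s : ℝ) (x : Space) :
    rot i s x = x + Real.sin s • rotGen i x + (1 - Real.cos s) • rotGen i (rotGen i x) := rfl

theorem isRotation_rot (i : Fin 3) (s : ℝ) : IsRotation (rot i s) := by
  have h := Real.sin_sq_add_cos_sq s
  rw [IsRotation, show ((rot i s).toLinearEquiv : Space →ₗ[ℝ] Space) = rotMap i s from rfl,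
    ← LinearMap.det_toMatrix (EuclideanSpace.basisFun (Fin 3) ℝ).toBasis, Matrix.det_fin_three]
  simp only [LinearMap.toMatrix_apply, OrthonormalBasis.coe_toBasis, EuclideanSpace.basisFun_apply,
    OrthonormalBasis.coe_toBasis_repr_apply, EuclideanSpace.basisFun_repr, rotMap_apply,
    PiLp.add_apply, PiLp.sub_apply, PiLp.smul_apply, PiLp.single_apply, smul_eq_mul, rotGen_apply]
  fin_cases i <;> simp <;> grind

theorem rot_zero (i : Fin 3) (x : Space) : rot i 0 x = x := by
  simp [rot_apply]

theorem hasDerivAt_rot (i : Fin 3) (s : ℝ) (x : Space) :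
    HasDerivAt (fun t => rot i t x)
      (Real.cos s • rotGen i x + Real.sin s • rotGen i (rotGen i x)) s := by
  have hsin := (Real.hasDerivAt_sin s).smul_const (rotGen i x)
  have hcos := ((Real.hasDerivAt_cos s).const_sub 1).smul_const (rotGen i (rotGen i x))
  exact ((hsin.const_add x).fun_add hcos).congr_deriv (by simp)

section DifferentiateUnderIntegral

variable {E : Type*} [NormedAddCommGroup E] [NormedSpace ℝ E] [MeasurableSpace E]
  [OpensMeasurableSpace E] {μ : Measure E} [IsFiniteMeasureOnCompacts μ] {D K : Set E}

theorem hasDerivAt_setIntegral_mul_comp_flow (hD : IsOpen D) (hK : IsCompact K) (hKD : K ⊆ D)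
    {φ g : E → ℝ} (hφ : ContinuousOn φ K) (hg : ContDiffOn ℝ 1 g D) {Φ V : ℝ → E → E}
    (hΦ : Continuous fun y : ℝ × E => Φ y.1 y.2) (hV : Continuous fun y : ℝ × E => V y.1 y.2)
    (hΦV : ∀ s x, HasDerivAt (fun t => Φ t x) (V s x) s) (hmaps : ∀ s, Set.MapsTo (Φ s) K K) :
    HasDerivAt (fun s => ∫ x in K, φ x * g (Φ s x) ∂μ)
      (∫ x in K, φ x * fderiv ℝ g (Φ 0 x) (V 0 x) ∂μ) 0 := by
  have hcont (s : ℝ) : ContinuousOn (fun x => φ x * g (Φ s x)) K :=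
    hφ.mul ((hg.continuousOn.mono hKD).comp (by fun_prop) (hmaps s))
  have hcontDeriv : ContinuousOn (fun y : ℝ × E => φ y.2 * fderiv ℝ g (Φ y.1 y.2) (V y.1 y.2))
      (Set.Icc (-1) 1 ×ˢ K) :=
    (hφ.comp continuousOn_snd fun _ hy => hy.2).mul
      ((((hg.continuousOn_fderiv_of_isOpen hD le_rfl).mono hKD).comp hΦ.continuousOn
        fun y hy => hmaps y.1 hy.2).clm_apply hV.continuousOn)
  obtain ⟨C, hC⟩ := (isCompact_Icc.prod hK).exists_bound_of_continuousOn hcontDeriv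
  refine (hasDerivAt_integral_of_dominated_loc_of_deriv_le (bound := fun _ => C)
    (F' := fun s x => φ x * fderiv ℝ g (Φ s x) (V s x))
    (Icc_mem_nhds (by norm_num : (-1 : ℝ) < 0) one_pos)
    (.of_forall fun s => (hcont s).aestronglyMeasurable_of_isCompact hK hK.measurableSet)
    ((hcont 0).integrableOn_compact hK) ?_ ?_ (integrableOn_const hK.measure_lt_top.ne) ?_).2
  · exact (hcontDeriv.comp (f := fun x => ((0 : ℝ), x)) (by fun_prop)
      fun x hx => ⟨by norm_num, hx⟩).aestronglyMeasurable_of_isCompact hK hK.measurableSet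
  · filter_upwards [ae_restrict_mem hK.measurableSet] with x hx s hs using hC (s, x) ⟨hs, hx⟩
  · filter_upwards [ae_restrict_mem hK.measurableSet] with x hx s _
    have hgx : DifferentiableAt ℝ g (Φ s x) := (hg.differentiableOn one_ne_zero).differentiableAt
      (hD.mem_nhds (hKD (hmaps s hx)))
    exact (hgx.hasFDerivAt.comp_hasDerivAt s (hΦV s x)).const_mul (φ x)

end DifferentiateUnderIntegral

/-- The derivative along the rotations about the `i`-th axis. -/
def rotDer (i : Fin 3) (g : Space → ℝ) (x : Space) : ℝ := fderiv ℝ g x (rotGen i x)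

theorem hasDerivAt_comp_rot {g : Space → ℝ} {x : Space} (hg : DifferentiableAt ℝ g x)
    (i : Fin 3) : HasDerivAt (fun s => g (rot i s x)) (rotDer i g x) 0 := by
  have h := hasDerivAt_rot i 0 x
  rw [Real.cos_zero, Real.sin_zero, one_smul, zero_smul, add_zero] at h
  exact HasFDerivAt.comp_hasDerivAt 0 (f := fun s => rot i s x)
    (by rw [rot_zero]; exact hg.hasFDerivAt) h

theorem setIntegral_mul_rotDer_eq_zero {D K : Set Space} (hD : IsOpen D) (hK : IsCompact K)
    (hKD : K ⊆ D) (hinv : IsRotInvariant K) {φ g : Space → ℝ} (hφ : ContinuousOn φ K)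
    (hφinv : ∀ R, IsRotation R → ∀ x ∈ K, φ (R x) = φ x) (hg : ContDiffOn ℝ 1 g D) (i : Fin 3) :
    ∫ x in K, φ x * rotDer i g x = 0 := by
  have hconst (s : ℝ) : ∫ x in K, φ x * g (rot i s x) = ∫ x in K, φ x * g x := by
    rw [← hinv.setIntegral_comp (isRotation_rot i s) fun x => φ x * g x]
    exact setIntegral_congr_fun hK.measurableSet fun x hx => by
      simp only [hφinv _ (isRotation_rot i s) x hx]
  have hderiv := hasDerivAt_setIntegral_mul_comp_flow (μ := volume) hD hK hKD hφ hg
    (Φ := fun s => rot i s) (by simp only [rot_apply]; fun_prop) (by fun_prop) (hasDerivAt_rot i)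
    fun s => hinv _ (isRotation_rot i s)
  simp only [hconst] at hderiv
  simpa [rot_zero, rotDer] using hderiv.unique (hasDerivAt_const 0 _)

/-! ### The Poincaré inequality for tangential vector fields -/

theorem fderiv_eq_sum_mul_spd (g : Space → ℝ) (x v : Space) :
    fderiv ℝ g x v = ∑ j, v j * spd j g x := by
  conv_lhs => rw [← (EuclideanSpace.basisFun (Fin 3) ℝ).sum_repr v]
  simp [spd]

theorem rotDer_eq (i : Fin 3) (g : Space → ℝ) (x : Space) :
    rotDer i g x = x (i + 1) * spd (i + 2) g x - x (i + 2) * spd (i + 1) g x := by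
  rw [rotDer, rotGen_apply, map_sub, map_smul, map_smul]
  rfl

/-- The Euclidean divergence. -/
def flatDiv (X : Fin 3 → Space → ℝ) (x : Space) : ℝ := ∑ i, spd i (X i) x

/-- The scalar product of the position vector with the Euclidean curl. -/
def positionCurl (X : Fin 3 → Space → ℝ) (x : Space) : ℝ := ∑ i, rotDer i (X i) x

section Bochner

variable {D : Set Space}

theorem contDiffOn_rotDer (hD : IsOpen D) {g : Space → ℝ} {n : WithTop ℕ∞}
    (hg : ContDiffOn ℝ (n + 1) g D) (i : Fin 3) : ContDiffOn ℝ n (rotDer i g) D :=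
  (hg.fderiv_of_isOpen hD le_rfl).clm_apply (by fun_prop)

theorem rotDer_rotDer_sub {g : Space → ℝ} {x : Space} (hg : ContDiffAt ℝ 2 g x) (i j : Fin 3) :
    rotDer i (rotDer j g) x - rotDer j (rotDer i g) x = x j * spd i g x - x i * spd j g x := by
  have hfderiv : DifferentiableAt ℝ (fderiv ℝ g) x :=
    (hg.fderiv_right (m := 1) (by norm_num)).differentiableAt (by simp)
  have hrot (k : Fin 3) : HasFDerivAt (rotDer k g) _ x :=
    hfderiv.hasFDerivAt.clm_apply (rotGen k).hasFDerivAt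
  have hsymm : IsSymmSndFDerivAt ℝ g x := hg.isSymmSndFDerivAt (by simp)
  have hcomm := congrArg (fderiv ℝ g x) (rotGen_rotGen_sub i j x)
  simp only [map_sub, map_smul, smul_eq_mul] at hcomm
  rw [rotDer, rotDer, (hrot j).fderiv, (hrot i).fderiv]
  simp only [add_apply, ContinuousLinearMap.comp_apply, ContinuousLinearMap.flip_apply]
  rw [hsymm.eq (rotGen i x) (rotGen j x), spd, spd, ← hcomm]
  ring

theorem sum_mul_spd {X : Fin 3 → Space → ℝ} {x : Space} (hX : ∀ j, DifferentiableAt ℝ (X j) x)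
    (htan : ∀ᶠ y in nhds x, ∑ j, y j * X j y = 0) (b : Fin 3) :
    ∑ j, x j * spd b (X j) x = -X b x := by
  have hsum : HasFDerivAt (fun y : Space => ∑ j, y j * X j y) _ x :=
    HasFDerivAt.fun_sum (u := Finset.univ) fun j _ =>
      (EuclideanSpace.proj (𝕜 := ℝ) (ι := Fin 3) j).hasFDerivAt.fun_mul (hX j).hasFDerivAt
  have hzero := congrArg (fun l => l (EuclideanSpace.single b (1 : ℝ)))
    (hsum.unique ((hasFDerivAt_const (0 : ℝ) x).congr_of_eventuallyEq htan))
  simp only [sum_apply, add_apply, smul_apply, smul_eq_mul, PiLp.proj_apply,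
    PiLp.single_apply, zero_apply, Finset.sum_add_distrib, mul_ite, mul_one,
    mul_zero, Finset.sum_ite_eq', Finset.mem_univ, if_true] at hzero
  exact eq_neg_of_add_eq_zero_left hzero

/-- The field whose rotational divergence appears in the Bochner identity. -/
def bochnerField (X : Fin 3 → Space → ℝ) (i : Fin 3) (x : Space) : ℝ :=
  ∑ j, (X j x * rotDer j (X i) x - X i x * rotDer j (X j) x)

theorem contDiffOn_bochnerField (hD : IsOpen D) {X : Fin 3 → Space → ℝ}
    (hX : ∀ j, ContDiffOn ℝ 2 (X j) D) (i : Fin 3) : ContDiffOn ℝ 1 (bochnerField X i) D := by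
  have hX1 (j : Fin 3) : ContDiffOn ℝ 1 (X j) D := (hX j).of_le one_le_two
  have hrot (i j : Fin 3) : ContDiffOn ℝ 1 (rotDer i (X j)) D :=
    contDiffOn_rotDer hD (one_add_one_eq_two (R := WithTop ℕ∞) ▸ hX j) i
  exact ContDiffOn.sum fun j _ => ((hX1 j).mul (hrot j i)).sub ((hX1 i).mul (hrot j j))

theorem sum_rotDer_bochnerField {X : Fin 3 → Space → ℝ} {x : Space}
    (hX : ∀ j, DifferentiableAt ℝ (X j) x)
    (hrot : ∀ i j, DifferentiableAt ℝ (rotDer i (X j)) x) :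
    ∑ i, rotDer i (bochnerField X i) x
      = ∑ i, ∑ j, rotDer i (X j) x * rotDer j (X i) x - positionCurl X x ^ 2
        + ∑ i, ∑ j, X j x * (rotDer i (rotDer j (X i)) x - rotDer j (rotDer i (X i)) x) := by
  have hprod (i : Fin 3) : rotDer i (bochnerField X i) x = ∑ j,
      (rotDer i (X j) x * rotDer j (X i) x - rotDer i (X i) x * rotDer j (X j) x
        + (X j x * rotDer i (rotDer j (X i)) x - X i x * rotDer i (rotDer j (X j)) x)) := by
    have hfield : HasFDerivAt (bochnerField X i) _ x :=
      HasFDerivAt.fun_sum (u := Finset.univ) fun j _ =>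
        ((hX j).hasFDerivAt.fun_mul (hrot j i).hasFDerivAt).fun_sub
          ((hX i).hasFDerivAt.fun_mul (hrot j j).hasFDerivAt)
    rw [rotDer, hfield.fderiv]
    simp only [sum_apply, sub_apply, add_apply, smul_apply, smul_eq_mul]
    exact Finset.sum_congr rfl fun j _ => by simp only [← rotDer.eq_1]; ring
  simp only [hprod, positionCurl, mul_sub, Finset.sum_add_distrib, Finset.sum_sub_distrib, sq,
    Finset.sum_mul_sum]
  rw [Finset.sum_comm (f := fun i j => X i x * rotDer i (rotDer j (X j)) x)]

theorem sum_mul_rotDer_comm {X : Fin 3 → Space → ℝ} {x : Space}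
    (hX : ∀ j, ContDiffAt ℝ 2 (X j) x) (htan : ∀ᶠ y in nhds x, ∑ j, y j * X j y = 0) :
    ∑ i, ∑ j, X j x * (rotDer i (rotDer j (X i)) x - rotDer j (rotDer i (X i)) x)
      = ∑ j, X j x ^ 2 := by
  have hJ := sum_mul_spd (fun j => (hX j).differentiableAt two_ne_zero) htan
  calc ∑ i, ∑ j, X j x * (rotDer i (rotDer j (X i)) x - rotDer j (rotDer i (X i)) x)
      = (∑ i, spd i (X i) x) * ∑ j, x j * X j x
          - ∑ j, X j x * ∑ i, x i * spd j (X i) x := by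
        simp only [rotDer_rotDer_sub (hX _), mul_sub, Finset.sum_sub_distrib, Finset.mul_sum,
          Finset.sum_mul]
        rw [Finset.sum_comm (f := fun i j => X j x * (x i * spd j (X i) x)), Finset.sum_comm]
        congr 1
        exact Finset.sum_congr rfl fun i _ => Finset.sum_congr rfl fun j _ => by ring
    _ = ∑ j, X j x ^ 2 := by
        simp only [htan.self_of_nhds, hJ]
        simp [← Finset.sum_neg_distrib, sq]

/-- The difference of the two sides is, up to a positive factor, the squared length of the
conformal Killing operator on the sphere applied to `X`. -/
theorem two_mul_minors_le {x X : Fin 3 → ℝ} {J L : Fin 3 → Fin 3 → ℝ}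
    (hL : ∀ i j, L i j = x (i + 1) * J (i + 2) j - x (i + 2) * J (i + 1) j)
    (hx : 0 < ∑ i, x i ^ 2) (hX : ∑ i, x i * X i = 0) (hJ : ∀ b, ∑ j, x j * J b j = -X b) :
    2 * ((∑ i, L i i) ^ 2 - ∑ i, ∑ j, L i j * L j i)
      ≤ (∑ i, x i ^ 2) * (∑ i, J i i) ^ 2 + (∑ i, L i i) ^ 2 := by
  have hrad : ∑ b, x b * ∑ j, x j * J b j = 0 := by
    simp only [hJ, mul_neg, Finset.sum_neg_distrib, hX, neg_zero]
  set ρ := ∑ i, x i ^ 2 with hρ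
  have hsq : 2 * ρ ^ 2 * (ρ * (∑ i, J i i) ^ 2 + (∑ i, L i i) ^ 2
      - 2 * ((∑ i, L i i) ^ 2 - ∑ i, ∑ j, L i j * L j i))
      = ∑ i, ∑ j, (ρ * (L i j + L j i) - (∑ k, L i k * x k) * x j - (∑ k, L j k * x k) * x i
        - (∑ k, L k k) * ((if i = j then ρ else 0) - x i * x j)) ^ 2 := by
    have hdiv : ρ * (∑ i, J i i) ^ 2 * ρ ^ 2
        = ρ * (ρ * (∑ i, J i i) - ∑ b, x b * ∑ j, x j * J b j) ^ 2 := by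
      rw [hrad]
      ring
    have hsplit : 2 * ρ ^ 2 * (ρ * (∑ i, J i i) ^ 2 + (∑ i, L i i) ^ 2
        - 2 * ((∑ i, L i i) ^ 2 - ∑ i, ∑ j, L i j * L j i))
        = 2 * (ρ * (∑ i, J i i) ^ 2 * ρ ^ 2) + 2 * ρ ^ 2 * ((∑ i, L i i) ^ 2
          - 2 * ((∑ i, L i i) ^ 2 - ∑ i, ∑ j, L i j * L j i)) := by ring
    rw [hsplit, hdiv]
    simp only [Fin.sum_univ_three, hL, hρ]
    simp
    ring
  have hnonneg := hsq.symm ▸ Finset.sum_nonneg fun i _ => Finset.sum_nonneg fun j _ => sq_nonneg _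
  exact sub_nonneg.mp (nonneg_of_mul_nonneg_right hnonneg (by positivity))

theorem neg_sum_rotDer_bochnerField_le {X : Fin 3 → Space → ℝ} {x : Space} (hx : x ≠ 0)
    (hX : ∀ j, ContDiffAt ℝ 2 (X j) x) (htan : ∀ᶠ y in nhds x, ∑ j, y j * X j y = 0) :
    -(2 * ∑ i, rotDer i (bochnerField X i) x)
      ≤ ‖x‖ ^ 2 * flatDiv X x ^ 2 + positionCurl X x ^ 2 - 2 * ∑ j, X j x ^ 2 := by
  have hX1 (j : Fin 3) : DifferentiableAt ℝ (X j) x := (hX j).differentiableAt two_ne_zero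
  have hrot (i j : Fin 3) : DifferentiableAt ℝ (rotDer i (X j)) x :=
    (((hX j).fderiv_right (m := 1) (by norm_num)).differentiableAt one_ne_zero).clm_apply
      (rotGen i).differentiableAt
  have hnorm : ‖x‖ ^ 2 = ∑ i, x i ^ 2 := by simp [EuclideanSpace.norm_sq_eq]
  have hpos : 0 < ∑ i, x i ^ 2 := by
    rw [← hnorm]
    positivity
  have hminors := two_mul_minors_le (J := fun b j => spd b (X j) x)
    (L := fun i j => rotDer i (X j) x) (fun i j => rotDer_eq i (X j) x) hpos
    htan.self_of_nhds (sum_mul_spd hX1 htan)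
  rw [sum_rotDer_bochnerField hX1 hrot, sum_mul_rotDer_comm hX htan, hnorm, flatDiv]
  rw [← positionCurl.eq_1] at hminors
  linarith

theorem poincare_inequality {K : Set Space} (hD : IsOpen D) (hD0 : (0 : Space) ∉ D)
    (hK : IsCompact K) (hKD : K ⊆ D) (hinv : IsRotInvariant K) {φ : Space → ℝ}
    (hφ : ContinuousOn φ K) (hφ0 : ∀ x ∈ K, 0 ≤ φ x)
    (hφinv : ∀ R, IsRotation R → ∀ x ∈ K, φ (R x) = φ x)
    {X : Fin 3 → Space → ℝ} (hX : ∀ j, ContDiffOn ℝ 2 (X j) D)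
    (htan : ∀ x ∈ D, ∑ j, x j * X j x = 0) :
    0 ≤ ∫ x in K, φ x * (‖x‖ ^ 2 * flatDiv X x ^ 2 + positionCurl X x ^ 2
      - 2 * ∑ j, X j x ^ 2) := by
  have hXK (j : Fin 3) : ContinuousOn (X j) K := (hX j).continuousOn.mono hKD
  have hfderiv {g : Space → ℝ} (hg : ContDiffOn ℝ 1 g D) : ContinuousOn (fderiv ℝ g) K :=
    (hg.continuousOn_fderiv_of_isOpen hD le_rfl).mono hKD
  have hspd (i j : Fin 3) : ContinuousOn (spd i (X j)) K :=
    (hfderiv ((hX j).of_le one_le_two)).clm_apply continuousOn_const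
  have hrot {g : Space → ℝ} (hg : ContDiffOn ℝ 1 g D) (i : Fin 3) : ContinuousOn (rotDer i g) K :=
    (hfderiv hg).clm_apply (by fun_prop)
  have hrotX (i j : Fin 3) : ContinuousOn (rotDer i (X j)) K :=
    hrot ((hX j).of_le one_le_two) i
  have hboch (i : Fin 3) := contDiffOn_bochnerField hD hX i
  have hzero : ∫ x in K, φ x * -(2 * ∑ i, rotDer i (bochnerField X i) x) = 0 := by
    simp only [mul_neg, mul_left_comm _ (2 : ℝ), Finset.mul_sum, integral_neg, neg_eq_zero]
    rw [integral_finsetSum _ fun i _ =>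
      ((hφ.fun_mul (hrot (hboch i) i)).const_mul 2).integrableOn_compact hK]
    refine Finset.sum_eq_zero fun i _ => ?_
    rw [integral_const_mul, setIntegral_mul_rotDer_eq_zero hD hK hKD hinv hφ hφinv (hboch i) i,
      mul_zero]
  rw [← hzero]
  refine setIntegral_mono_on ?_ ?_ hK.measurableSet fun x hx => ?_
  · refine ContinuousOn.integrableOn_compact hK (hφ.mul ?_)
    exact (continuousOn_const.mul (continuousOn_finsetSum _ fun i _ => hrot (hboch i) i)).neg
  · refine ContinuousOn.integrableOn_compact hK ?_
    unfold flatDiv positionCurl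
    fun_prop
  · have hnhds := hD.mem_nhds (hKD hx)
    gcongr
    · exact hφ0 x hx
    · exact neg_sum_rotDer_bochnerField_le (fun h => hD0 (h ▸ hKD hx))
        (fun j => (hX j).contDiffAt hnhds) (Filter.eventually_of_mem hnhds htan)

end Bochner

/-! ### Spherically symmetric slices -/

@[simp] theorem point_zero (t : ℝ) (x : Space) : point t x 0 = t := rfl

@[simp] theorem point_succ (t : ℝ) (x : Space) (i : Fin 3) : point t x i.succ = x i := by
  fin_cases i <;> rfl

theorem point_injective {t t' : ℝ} {x x' : Space} (h : point t x = point t' x') :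
    t = t' ∧ x = x' := by
  refine ⟨by simpa using congrFun h 0, ?_⟩
  ext i
  simpa using congrFun h i.succ

theorem radius_point (t : ℝ) (x : Space) : radius (point t x) = ‖x‖ := by
  rw [EuclideanSpace.norm_eq, radius]
  simp [Fin.sum_univ_three, point]

theorem dr_point (t : ℝ) (x : Space) (i : Fin 3) : dr (point t x) i.succ = x i / ‖x‖ := by
  rw [dr_of_ne_zero _ (Fin.succ_ne_zero i), radius_point, point_succ]

theorem sum_dr_point_mul (t : ℝ) (x : Space) (v : Fin 4 → ℝ) :
    ∑ b, dr (point t x) b * v b = (∑ i : Fin 3, x i * v i.succ) / ‖x‖ := by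
  rw [Fin.sum_univ_succ, dr_zero, zero_mul, zero_add, Finset.sum_div]
  exact Finset.sum_congr rfl fun i _ => by rw [dr_point]; ring

namespace SpacelikeSlice

variable {M : ℝ} (S : SpacelikeSlice M)

/-- The embedding `x ↦ (h x, x)` of the slice in spacetime. -/
def graph (x : Space) : Point := point (S.height x) x

/-- The radial derivative `∂_r h` of the time function `h`. -/
def slope (x : Space) : ℝ := fderiv ℝ S.height x x / ‖x‖

variable {S} {x : Space}

theorem graph_mem (hx : x ∈ S.dom) : S.graph x ∈ exterior M := by
  have := S.dom_subset x hx
  rwa [exterior, Set.mem_ofPred_eq, graph, radius_point]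

theorem norm_pos (hM : 0 ≤ M) (hx : x ∈ S.dom) : 0 < ‖x‖ := by
  linarith [S.dom_subset x hx]

theorem differentiableAt_height (hx : x ∈ S.dom) : DifferentiableAt ℝ S.height x :=
  (S.smooth.differentiableOn (by simp)).differentiableAt (S.isOpen_dom.mem_nhds hx)

theorem mem_dom_and_height_of_isRotation (hS : S.IsSphericallySymmetric)
    {R : Space ≃ₗᵢ[ℝ] Space} (hR : IsRotation R) (hx : x ∈ S.dom) :
    R x ∈ S.dom ∧ S.height (R x) = S.height x := by
  obtain ⟨y, hy, h⟩ := hS R hR (S.height x) x ⟨x, hx, rfl⟩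
  obtain ⟨height_eq, rfl⟩ := point_injective h
  exact ⟨hy, height_eq.symm⟩

theorem isRotInvariant_dom (hS : S.IsSphericallySymmetric) : IsRotInvariant S.dom :=
  fun _ hR _ hx => (mem_dom_and_height_of_isRotation hS hR hx).1

theorem rotDer_height (hS : S.IsSphericallySymmetric) (hx : x ∈ S.dom) (i : Fin 3) :
    rotDer i S.height x = 0 := by
  have h := hasDerivAt_comp_rot (differentiableAt_height hx) i
  simp only [(mem_dom_and_height_of_isRotation hS (isRotation_rot i _) hx).2] at h
  exact h.unique (hasDerivAt_const 0 _)

theorem spd_height (hM : 0 ≤ M) (hS : S.IsSphericallySymmetric) (hx : x ∈ S.dom) (i : Fin 3) :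
    spd i S.height x = S.slope x * (x i / ‖x‖) := by
  have gradient_parallel : spd i S.height x * ‖x‖ ^ 2 = (∑ j, x j * spd j S.height x) * x i := by
    have h0 := rotDer_height hS hx 0
    have h1 := rotDer_height hS hx 1
    have h2 := rotDer_height hS hx 2
    simp only [rotDer_eq, Fin.reduceAdd, zero_add] at h0 h1 h2
    rw [EuclideanSpace.real_norm_sq_eq]
    simp only [Fin.sum_univ_three]
    match i with
    | 0 => linear_combination x 2 * h1 - x 1 * h2
    | 1 => linear_combination x 0 * h2 - x 2 * h0
    | 2 => linear_combination x 1 * h0 - x 0 * h1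
  have := norm_pos hM hx
  rw [slope, fderiv_eq_sum_mul_spd]
  field_simp
  exact gradient_parallel

theorem conormal_eq (hM : 0 ≤ M) (hS : S.IsSphericallySymmetric) (hx : x ∈ S.dom) (b : Fin 4) :
    S.conormal x b = dt b - S.slope x * dr (S.graph x) b := by
  refine Fin.cases ?_ (fun i => ?_) b
  · simp [conormal, dt]
  · rw [graph, dr_point, ← spd_height hM hS hx]
    fin_cases i <;> simp [conormal, dt]

theorem sum_invMetric_conormal (hM : 0 ≤ M) (hS : S.IsSphericallySymmetric) (hx : x ∈ S.dom)
    (a : Fin 4) : ∑ b, invMetric M (S.graph x) a b * S.conormal x b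
      = (lapseSq M (S.graph x))⁻¹ * dt a
        + lapseSq M (S.graph x) * S.slope x * dr (S.graph x) a := by
  have hp := graph_mem hx
  have summand_eq : ∀ b, invMetric M (S.graph x) a b * S.conormal x b
      = invMetric M (S.graph x) a b * dt b
        - S.slope x * (invMetric M (S.graph x) a b * dr (S.graph x) b) := by
    intro b
    rw [conormal_eq hM hS hx]
    ring
  simp only [summand_eq, Finset.sum_sub_distrib, ← Finset.mul_sum, sum_invMetric_dt hM hp,
    sum_invMetric_dr hM hp]
  ring

theorem conormal_sq (hM : 0 ≤ M) (hS : S.IsSphericallySymmetric) (hx : x ∈ S.dom) :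
    ∑ b, ∑ c, invMetric M (S.graph x) b c * S.conormal x b * S.conormal x c
      = (lapseSq M (S.graph x))⁻¹ - lapseSq M (S.graph x) * S.slope x ^ 2 := by
  have hr := radius_pos hM (graph_mem hx)
  have row_eq : ∀ b, ∑ c, invMetric M (S.graph x) b c * S.conormal x b * S.conormal x c
      = (lapseSq M (S.graph x))⁻¹ * (dt b * dt b)
        + (lapseSq M (S.graph x) * S.slope x - S.slope x * (lapseSq M (S.graph x))⁻¹)
          * (dt b * dr (S.graph x) b)
        - lapseSq M (S.graph x) * S.slope x ^ 2 * (dr (S.graph x) b * dr (S.graph x) b) := by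
    intro b
    have summand_eq : ∀ c, invMetric M (S.graph x) b c * S.conormal x b * S.conormal x c
        = S.conormal x b * (invMetric M (S.graph x) b c * S.conormal x c) := fun c => by ring
    simp only [summand_eq, ← Finset.mul_sum, sum_invMetric_conormal hM hS hx]
    rw [conormal_eq hM hS hx]
    ring
  simp only [row_eq, Finset.sum_add_distrib, Finset.sum_sub_distrib, ← Finset.mul_sum, sum_dt_mul,
    sum_dr_mul_dr hr, dr_zero, show dt 0 = 1 from rfl]
  ring

theorem neg_inducedMetric_apply (hM : 0 ≤ M) (hS : S.IsSphericallySymmetric) (hx : x ∈ S.dom)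
    (i j : Fin 3) : (-inducedMetric M S.height x) i j = (if i = j then 1 else 0)
      - (1 - (lapseSq M (S.graph x))⁻¹ + lapseSq M (S.graph x) * S.slope x ^ 2)
        * (dr (S.graph x) i.succ * dr (S.graph x) j.succ) := by
  have spd_eq : ∀ i : Fin 3, spd i S.height x = S.slope x * dr (S.graph x) i.succ := fun i => by
    rw [graph, dr_point, spd_height hM hS hx]
  have tangent_succ : ∀ i j : Fin 3, graphTangent S.height x i j.succ = if i = j then 1 else 0 := by
    intro i j
    rw [graphTangent, point_succ, PiLp.single_apply]
    simp [eq_comm]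
  have tangent_zero : ∀ i : Fin 3,
      graphTangent S.height x i 0 = S.slope x * dr (S.graph x) i.succ := by
    intro i
    rw [graphTangent, point_zero, spd_eq]
  rw [Matrix.neg_apply, inducedMetric]
  change -(∑ a, ∑ b, metric M (S.graph x) a b * _ * _) = _
  rw [Fin.sum_univ_succ]
  simp only [Fin.sum_univ_succ (n := 3), tangent_succ, tangent_zero, mul_ite, mul_one, mul_zero,
    Finset.sum_ite_eq, Finset.mem_univ, if_true, metric_eq, dr_zero]
  simp only [dt, ↓reduceIte, mul_one, spatialDelta, ne_eq, not_true_eq_false, and_false, sub_zero,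
    add_zero, Fin.succ_ne_zero, mul_zero, sub_self, zero_mul, not_false_eq_true, and_true, ite_self,
    Fin.succ_inj, zero_sub, zero_add, Finset.sum_ite_eq, Finset.mem_univ, neg_add_rev, neg_neg]
  split_ifs <;> ring

theorem det_neg_inducedMetric (hM : 0 ≤ M) (hS : S.IsSphericallySymmetric) (hx : x ∈ S.dom) :
    (-inducedMetric M S.height x).det
      = (lapseSq M (S.graph x))⁻¹ - lapseSq M (S.graph x) * S.slope x ^ 2 := by
  have h := sum_dr_sq (radius_pos hM (graph_mem hx))
  rw [Matrix.det_fin_three]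
  simp only [neg_inducedMetric_apply hM hS hx]
  simp only [↓reduceIte, Fin.succ_zero_eq_one, Fin.succ_one_eq_two, Fin.reduceSucc, Fin.reduceEq,
    zero_sub, mul_neg, neg_mul, neg_neg, zero_ne_one, one_ne_zero]
  linear_combination -(1 - (lapseSq M (S.graph x))⁻¹ + lapseSq M (S.graph x) * S.slope x ^ 2) * h

theorem conormal_sq_pos (hM : 0 ≤ M) (hS : S.IsSphericallySymmetric) (hx : x ∈ S.dom) :
    0 < (lapseSq M (S.graph x))⁻¹ - lapseSq M (S.graph x) * S.slope x ^ 2 := by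
  rw [← det_neg_inducedMetric hM hS hx]
  exact (S.spacelike x hx).det_pos

/-- The velocity `v = (1 - 2M/r) h'` of the slice relative to the static observers. Its normal is a
positive combination of the null vectors `l₊`, `l₋` with weights `1 + v`, `1 - v`. -/
def velocity (S : SpacelikeSlice M) (x : Space) : ℝ := lapseSq M (S.graph x) * S.slope x

theorem abs_velocity_lt (hM : 0 ≤ M) (hS : S.IsSphericallySymmetric) (hx : x ∈ S.dom) :
    |S.velocity x| < 1 := by
  have hf := lapseSq_pos hM (graph_mem hx)
  have conormal_sq_eq : lapseSq M (S.graph x) * ((lapseSq M (S.graph x))⁻¹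
      - lapseSq M (S.graph x) * S.slope x ^ 2) = 1 - S.velocity x ^ 2 := by
    rw [velocity]
    field_simp
  rw [← sq_lt_one_iff_abs_lt_one]
  linarith [mul_pos hf (conormal_sq_pos hM hS hx)]

theorem fluxDensity_eq (hM : 0 ≤ M) (hS : S.IsSphericallySymmetric) (hx : x ∈ S.dom)
    (J : Point → Fin 4 → ℝ) : S.fluxDensity J x = (2 * lapseSq M (S.graph x))⁻¹
      * ((1 + S.velocity x) * nullComp M 1 (S.graph x) (J (S.graph x))
        + (1 - S.velocity x) * nullComp M (-1) (S.graph x) (J (S.graph x))) := by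
  have hf := (lapseSq_pos hM (graph_mem hx)).ne'
  have hpos := conormal_sq_pos hM hS hx
  have summand_eq : ∀ a, J (S.graph x) a * S.normal x a * S.volDensity x
      = (lapseSq M (S.graph x))⁻¹ * (dt a * J (S.graph x) a)
        + S.velocity x * (dr (S.graph x) a * J (S.graph x) a) := by
    intro a
    have normal_eq : S.normal x a = (∑ b, invMetric M (S.graph x) a b * S.conormal x b) /
      Real.sqrt (∑ b, ∑ c, invMetric M (S.graph x) b c * S.conormal x b * S.conormal x c) := rfl
    rw [normal_eq, volDensity, det_neg_inducedMetric hM hS hx, conormal_sq hM hS hx,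
      sum_invMetric_conormal hM hS hx, mul_assoc, div_mul_cancel₀ _ (Real.sqrt_pos.mpr hpos).ne',
      velocity]
    ring
  have flux_eq_sum : S.fluxDensity J x = ∑ a, J (S.graph x) a * S.normal x a * S.volDensity x := by
    rw [fluxDensity, Finset.sum_mul]
    rfl
  rw [flux_eq_sum]
  simp only [summand_eq, Finset.sum_add_distrib, ← Finset.mul_sum, sum_dt_mul, nullComp_eq]
  field_simp
  ring

theorem velocity_comp (hS : S.IsSphericallySymmetric) (hx : x ∈ S.dom)
    {R : Space ≃ₗᵢ[ℝ] Space} (hR : IsRotation R) : S.velocity (R x) = S.velocity x := by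
  have hRx := (mem_dom_and_height_of_isRotation hS hR hx).1
  have fderiv_comp : HasFDerivAt (fun y => S.height (R y)) _ x :=
    HasFDerivAt.comp x (f := R) (differentiableAt_height hRx).hasFDerivAt
      R.toContinuousLinearEquiv.hasFDerivAt
  have comp_eq : (fun y => S.height (R y)) =ᶠ[nhds x] S.height := by
    filter_upwards [S.isOpen_dom.mem_nhds hx] with y hy
    exact (mem_dom_and_height_of_isRotation hS hR hy).2
  have radial_eq : fderiv ℝ S.height (R x) (R x) = fderiv ℝ S.height x x := by
    rw [← comp_eq.fderiv_eq, fderiv_comp.fderiv]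
    rfl
  simp only [velocity, slope, lapseSq, graph, radius_point, radial_eq, LinearIsometryEquiv.norm_map]

end SpacelikeSlice

/-! ### Comparison of improper integrals -/

/-- The points of the ball of radius `n` at distance at least `1 / n` from the complement of `D`.
For open `D` these sets are compact and exhaust `D`, and they inherit the linear isometric
symmetries of `D`. -/
def exhaustion {E : Type*} [NormedAddCommGroup E] (D : Set E) (n : ℕ) : Set E :=
  {x | (n : ENNReal)⁻¹ ≤ Metric.infEDist x Dᶜ} ∩ Metric.closedBall 0 n

section exhaustion

variable {E : Type*} [NormedAddCommGroup E] {D : Set E}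

theorem isCompact_exhaustion [ProperSpace E] (D : Set E) (n : ℕ) : IsCompact (exhaustion D n) :=
  (isCompact_closedBall 0 (n : ℝ)).inter_left
    (isClosed_le continuous_const Metric.continuous_infEDist)

theorem exhaustion_subset (D : Set E) (n : ℕ) : exhaustion D n ⊆ D := by
  intro x hx
  by_contra hxD
  have h : (n : ENNReal)⁻¹ ≤ Metric.infEDist x Dᶜ := hx.1
  simp [Metric.infEDist_zero_of_mem (Set.mem_compl hxD)] at h

theorem eventually_mem_exhaustion (hD : IsOpen D) {x : E} (hx : x ∈ D) :
    ∀ᶠ n in Filter.atTop, x ∈ exhaustion D n := by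
  have dist_pos : 0 < Metric.infEDist x Dᶜ :=
    Metric.infEDist_pos_iff_notMem_closure.mpr (by simpa [hD.isClosed_compl.closure_eq] using hx)
  filter_upwards [ENNReal.tendsto_inv_nat_nhds_zero.eventually (gt_mem_nhds dist_pos),
    tendsto_natCast_atTop_atTop.eventually_ge_atTop ‖x‖] with n far_from_compl norm_le
  exact ⟨far_from_compl.le, mem_closedBall_zero_iff.mpr norm_le⟩

theorem aecover_exhaustion [ProperSpace E] [MeasurableSpace E] [BorelSpace E] (μ : Measure E)
    (hD : IsOpen D) : AECover (μ.restrict D) Filter.atTop (exhaustion D) where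
  ae_eventually_mem := by
    filter_upwards [ae_restrict_mem hD.measurableSet] with x hx
    exact eventually_mem_exhaustion hD hx
  measurableSet n := (isCompact_exhaustion D n).measurableSet

theorem integrableOn_exhaustion [ProperSpace E] [MeasurableSpace E] [BorelSpace E]
    {μ : Measure E} [IsFiniteMeasureOnCompacts μ] {f : E → ℝ} (hf : ContinuousOn f D) (n : ℕ) :
    IntegrableOn f (exhaustion D n) μ :=
  (hf.mono (exhaustion_subset D n)).integrableOn_compact (isCompact_exhaustion D n)

end exhaustion

theorem IsRotInvariant.exhaustion {D : Set Space} (hD : IsRotInvariant D) (n : ℕ) :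
    IsRotInvariant (exhaustion D n) := by
  intro R hR x ⟨far_from_compl, mem_ball⟩
  have image_compl : R '' Dᶜ = Dᶜ := by
    rw [Set.image_compl_eq R.bijective, ← hD.preimage_eq hR, Set.image_preimage_eq _ R.surjective,
      hD.preimage_eq hR]
  refine ⟨?_, by simpa using mem_ball⟩
  rw [← image_compl, Set.mem_ofPred_eq, Metric.infEDist_image R.isometry]
  exact far_from_compl

section comparison

variable {X : Type*} [MeasurableSpace X] {μ : Measure X} {D : Set X} {K : ℕ → Set X}

theorem tendsto_setIntegral_of_aecover (hK : AECover (μ.restrict D) Filter.atTop K)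
    (hKD : ∀ n, K n ⊆ D) {f : X → ℝ} (hf : IntegrableOn f D μ) :
    Filter.Tendsto (fun n => ∫ x in K n, f x ∂μ) Filter.atTop (nhds (∫ x in D, f x ∂μ)) := by
  have h := hK.integral_tendsto_of_countably_generated hf
  simpa only [Measure.restrict_restrict_of_subset (hKD _)] using h

theorem integrableOn_of_setIntegral_norm_le (hK : AECover (μ.restrict D) Filter.atTop K)
    (hKD : ∀ n, K n ⊆ D) {f g : X → ℝ} {C : ℝ} (hC : 0 ≤ C) (hf : ∀ n, IntegrableOn f (K n) μ)
    (hg : IntegrableOn g D μ) (h : ∀ n, ∫ x in K n, ‖f x‖ ∂μ ≤ C * ∫ x in K n, ‖g x‖ ∂μ) :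
    IntegrableOn f D μ := by
  refine hK.integrable_of_integral_norm_bounded (C * ∫ x in D, ‖g x‖ ∂μ) (fun n => ?_)
    (Filter.Eventually.of_forall fun n => ?_)
  · rw [IntegrableOn, Measure.restrict_restrict_of_subset (hKD n)]
    exact hf n
  · rw [Measure.restrict_restrict_of_subset (hKD n)]
    refine (h n).trans (mul_le_mul_of_nonneg_left ?_ hC)
    exact setIntegral_mono_set hg.norm (Filter.Eventually.of_forall fun _ => norm_nonneg _)
      (hKD n).eventuallyLE

variable {a b e₁ e₂ : X → ℝ} {k₁ k₂ k₃ : ℝ} {s : Set X}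

theorem mul_setIntegral_le_of_excess (hs : MeasurableSet s) (ha : IntegrableOn a s μ)
    (hb : IntegrableOn b s μ) (he : IntegrableOn e₁ s μ) (he0 : 0 ≤ ∫ x in s, e₁ x ∂μ)
    (h : ∀ x ∈ s, e₁ x ≤ b x - k₁ * a x) : k₁ * ∫ x in s, a x ∂μ ≤ ∫ x in s, b x ∂μ := by
  have := setIntegral_mono_on he (hb.sub (ha.const_mul k₁)) hs h
  rw [integral_sub' hb (ha.const_mul k₁), integral_const_mul] at this
  linarith

theorem setIntegral_le_mul_of_excess (hs : MeasurableSet s) (ha : IntegrableOn a s μ)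
    (hb : IntegrableOn b s μ) (he : IntegrableOn e₂ s μ) (he0 : 0 ≤ ∫ x in s, e₂ x ∂μ)
    (h : ∀ x ∈ s, e₂ x ≤ k₂ * a x - b x) : ∫ x in s, b x ∂μ ≤ k₂ * ∫ x in s, a x ∂μ := by
  have := setIntegral_mono_on he ((ha.const_mul k₂).sub hb) hs h
  rw [integral_sub' (ha.const_mul k₂) hb, integral_const_mul] at this
  linarith

theorem setIntegral_norm_le_of_excess (hs : MeasurableSet s) (hk₁ : 0 ≤ k₁)
    (ha : IntegrableOn a s μ) (hb : IntegrableOn b s μ) (he₁ : IntegrableOn e₁ s μ)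
    (he₂ : IntegrableOn e₂ s μ) (ha0 : ∀ x ∈ s, 0 ≤ a x)
    (h₁ : ∀ x ∈ s, e₁ x ≤ b x - k₁ * a x) (h₂ : ∀ x ∈ s, e₂ x ≤ k₂ * a x - b x)
    (h₁' : ∀ x ∈ s, e₁ x ≤ k₃ * a x) (h₂' : ∀ x ∈ s, e₂ x ≤ k₃ * a x)
    (he₁0 : 0 ≤ ∫ x in s, e₁ x ∂μ) (he₂0 : 0 ≤ ∫ x in s, e₂ x ∂μ) :
    ∫ x in s, ‖b x‖ ∂μ ≤ (|k₂| + k₃) * ∫ x in s, a x ∂μ := by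
  have hsum : IntegrableOn (fun x => e₁ x + e₂ x) s μ := he₁.add he₂
  have pointwise : ∀ x ∈ s, ‖b x‖ ≤ (|k₂| + k₃) * a x - (e₁ x + e₂ x) := by
    intro x hx
    have := mul_le_mul_of_nonneg_right (le_abs_self k₂) (ha0 x hx)
    have := mul_nonneg (abs_nonneg k₂) (ha0 x hx)
    have := mul_nonneg hk₁ (ha0 x hx)
    rw [Real.norm_eq_abs, abs_le]
    constructor <;> linarith [h₁ x hx, h₂ x hx, h₁' x hx, h₂' x hx]
  have h := setIntegral_mono_on hb.norm ((ha.const_mul _).sub hsum) hs pointwise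
  rw [integral_sub' (ha.const_mul _) hsum, integral_const_mul, integral_add he₁ he₂] at h
  linarith

-- The bounds by `k₃ * a` make `b` absolutely integrable although it may change sign.
theorem integrableOn_iff_and_setIntegral_bounds (hK : AECover (μ.restrict D) Filter.atTop K)
    (hKD : ∀ n, K n ⊆ D) (hk₁ : 0 < k₁) (hk₃ : 0 ≤ k₃)
    (ha : ∀ n, IntegrableOn a (K n) μ) (hb : ∀ n, IntegrableOn b (K n) μ)
    (he₁ : ∀ n, IntegrableOn e₁ (K n) μ) (he₂ : ∀ n, IntegrableOn e₂ (K n) μ)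
    (ha0 : ∀ x ∈ D, 0 ≤ a x)
    (h₁ : ∀ x ∈ D, e₁ x ≤ b x - k₁ * a x) (h₂ : ∀ x ∈ D, e₂ x ≤ k₂ * a x - b x)
    (h₁' : ∀ x ∈ D, e₁ x ≤ k₃ * a x) (h₂' : ∀ x ∈ D, e₂ x ≤ k₃ * a x)
    (he₁0 : ∀ n, 0 ≤ ∫ x in K n, e₁ x ∂μ) (he₂0 : ∀ n, 0 ≤ ∫ x in K n, e₂ x ∂μ) :
    (IntegrableOn a D μ ↔ IntegrableOn b D μ) ∧
      k₁ * ∫ x in D, a x ∂μ ≤ ∫ x in D, b x ∂μ ∧ ∫ x in D, b x ∂μ ≤ k₂ * ∫ x in D, a x ∂μ := by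
  have lower n : k₁ * ∫ x in K n, a x ∂μ ≤ ∫ x in K n, b x ∂μ :=
    mul_setIntegral_le_of_excess (hK.measurableSet n) (ha n) (hb n) (he₁ n) (he₁0 n)
      fun x hx => h₁ x (hKD n hx)
  have upper n : ∫ x in K n, b x ∂μ ≤ k₂ * ∫ x in K n, a x ∂μ :=
    setIntegral_le_mul_of_excess (hK.measurableSet n) (ha n) (hb n) (he₂ n) (he₂0 n)
      fun x hx => h₂ x (hKD n hx)
  have norm_eq n : ∫ x in K n, ‖a x‖ ∂μ = ∫ x in K n, a x ∂μ :=
    setIntegral_congr_fun (hK.measurableSet n) fun x hx => Real.norm_of_nonneg (ha0 x (hKD n hx))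
  have integrable_b (h : IntegrableOn a D μ) : IntegrableOn b D μ := by
    refine integrableOn_of_setIntegral_norm_le hK hKD (C := |k₂| + k₃) (by positivity) hb h
      fun n => ?_
    rw [norm_eq n]
    have restrict {P : X → Prop} (h : ∀ x ∈ D, P x) : ∀ x ∈ K n, P x := fun x hx => h x (hKD n hx)
    exact setIntegral_norm_le_of_excess (hK.measurableSet n) hk₁.le (ha n) (hb n) (he₁ n) (he₂ n)
      (restrict ha0) (restrict h₁) (restrict h₂) (restrict h₁') (restrict h₂') (he₁0 n) (he₂0 n)
  have integrable_a (h : IntegrableOn b D μ) : IntegrableOn a D μ := by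
    refine integrableOn_of_setIntegral_norm_le hK hKD (C := k₁⁻¹) (by positivity) ha h fun n => ?_
    rw [norm_eq n, le_inv_mul_iff₀ hk₁]
    exact (lower n).trans ((Real.le_norm_self _).trans (norm_integral_le_integral_norm _))
  refine ⟨⟨integrable_b, integrable_a⟩, ?_⟩
  by_cases h : IntegrableOn a D μ
  · have tendsto_a := tendsto_setIntegral_of_aecover hK hKD h
    have tendsto_b := tendsto_setIntegral_of_aecover hK hKD (integrable_b h)
    exact ⟨le_of_tendsto_of_tendsto' (tendsto_a.const_mul k₁) tendsto_b lower,
      le_of_tendsto_of_tendsto' tendsto_b (tendsto_a.const_mul k₂) upper⟩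
  · rw [integral_undef h, integral_undef (mt integrable_a h)]
    simp

end comparison

/-! ### Continuity of the currents -/

section Continuity

variable {M : ℝ} {p : Point} {F : TensorField}

theorem continuousAt_pd {f : Point → ℝ} (hf : ContDiffAt ℝ 1 f p) (a : Fin 4) :
    ContinuousAt (pd a f) p :=
  ((hf.fderiv_right (m := 0) (by simp)).continuousAt).clm_apply continuousAt_const

theorem contDiffAt_metric (hM : 0 ≤ M) (hp : p ∈ exterior M) {n : WithTop ℕ∞} (a b : Fin 4) :
    ContDiffAt ℝ n (fun y => metric M y a b) p := by
  have hf := contDiffAt_lapseSq (radius_pos hM hp) M (n := n)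
  have hn := fun a => contDiffAt_dr (radius_pos hM hp) a (n := n)
  have hf0 := (lapseSq_pos hM hp).ne'
  simp only [metric_eq]
  fun_prop (disch := assumption)

theorem continuousAt_invMetric (hM : 0 ≤ M) (hp : p ∈ exterior M) (a b : Fin 4) :
    ContinuousAt (fun y => invMetric M y a b) p :=
  (contDiffAt_invMetric hM hp a b (n := 0)).continuousAt

theorem continuousAt_divSnd (hM : 0 ≤ M) (hp : p ∈ exterior M) {T : TensorField}
    (hT : ∀ a b, ContDiffAt ℝ 1 (fun y => T y a b) p) (a : Fin 4) :
    ContinuousAt (fun y => divSnd M T y a) p := by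
  have hg := continuousAt_invMetric hM hp
  have hT0 := fun a b => (hT a b).continuousAt
  have hpdT := fun c a b => continuousAt_pd (hT a b) c
  have hpdg := fun c a b => continuousAt_pd (contDiffAt_metric hM hp a b) c
  unfold divSnd covDeriv christoffel
  fun_prop

theorem continuousAt_Uup (hM : 0 ≤ M) (hp : p ∈ exterior M) (a : Fin 4) :
    ContinuousAt (fun y => Uup M y a) p := by
  have hr := radius_pos hM hp
  have hg := continuousAt_invMetric hM hp
  have hdr := fun c => continuousAt_pd (contDiffAt_radius hr) c
  have hr_cont := (contDiffAt_radius hr (n := 0)).continuousAt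
  have hr0 := hr.ne'
  unfold Uup U
  fun_prop (disch := assumption)

theorem continuousAt_ofReal {f : Point → ℝ} (hf : ContinuousAt f p) :
    ContinuousAt (fun y => (f y : ℂ)) p :=
  Complex.continuous_ofReal.continuousAt.comp hf

theorem continuousAt_re {f : Point → ℂ} (hf : ContinuousAt f p) :
    ContinuousAt (fun y => (f y).re) p :=
  Complex.continuous_re.continuousAt.comp hf

theorem continuousAt_beta (hM : 0 ≤ M) (hp : p ∈ exterior M)
    (hF : ∀ a b, ContDiffAt ℝ 1 (fun y => F y a b) p) (a : Fin 4) :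
    ContinuousAt (fun y => beta M F y a) p := by
  have hZ := contDiffAt_Z hM hp hF
  have hhZ := contDiffAt_hodge hM hp hZ
  have hZ0 := fun a b => (hZ a b).continuousAt
  have hhZ0 := fun a b => (hhZ a b).continuousAt
  have hdivZ := continuousAt_divSnd hM hp hZ
  have hdivhZ := continuousAt_divSnd hM hp hhZ
  have hU := continuousAt_Uup hM hp
  have hUZ : ContinuousAt (fun y => ∑ b, Uup M y b * Z M F y a b) p := by fun_prop
  have hUhZ : ContinuousAt (fun y => ∑ b, Uup M y b * hodge M (Z M F) y a b) p := by fun_prop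
  exact (((continuousAt_const.mul (continuousAt_ofReal hUZ)).sub
    (continuousAt_const.mul (continuousAt_ofReal hUhZ))).sub
    (continuousAt_const.mul (continuousAt_ofReal (hdivZ a)))).sub
    (continuousAt_const.mul (continuousAt_ofReal (hdivhZ a)))

theorem continuousAt_betaUp (hM : 0 ≤ M) (hp : p ∈ exterior M)
    (hF : ∀ a b, ContDiffAt ℝ 1 (fun y => F y a b) p) (a : Fin 4) :
    ContinuousAt (fun y => betaUp M F y a) p := by
  have hg := continuousAt_invMetric hM hp
  have hβ := continuousAt_beta hM hp hF
  unfold betaUp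
  fun_prop

theorem continuousAt_H (hM : 0 ≤ M) (hp : p ∈ exterior M)
    (hF : ∀ a b, ContDiffAt ℝ 1 (fun y => F y a b) p) (a b : Fin 4) :
    ContinuousAt (fun y => H M F y a b) p := by
  have hg := (contDiffAt_metric hM hp a b (n := 0)).continuousAt
  have hβ := continuousAt_beta hM hp hF
  have hβUp := continuousAt_betaUp hM hp hF
  have hββ : ContinuousAt (fun y => beta M F y a * star (beta M F y b)) p :=
    (hβ a).mul (hβ b).star
  have hβ_sq : ContinuousAt (fun y => ∑ c, betaUp M F y c * star (beta M F y c)) p :=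
    tendsto_finsetSum _ fun c _ => (hβUp c).mul (hβ c).star
  exact (continuousAt_re hββ).sub ((continuousAt_const.mul hg).mul (continuousAt_re hβ_sq))

theorem continuousAt_currentXi (hM : 0 ≤ M) (hp : p ∈ exterior M)
    (hF : ∀ a b, ContDiffAt ℝ 1 (fun y => F y a b) p) (a : Fin 4) :
    ContinuousAt (fun y => currentXi M F y a) p :=
  tendsto_finsetSum _ fun b _ => (continuousAt_H hM hp hF a b).mul continuousAt_const

theorem contDiffAt_q (hM : 0 ≤ M) (hp : p ∈ exterior M) {n : WithTop ℕ∞} :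
    ContDiffAt ℝ n (q M) p := by
  have hr := radius_pos hM hp
  have hr_contDiff := contDiffAt_radius hr (n := n)
  unfold q
  fun_prop (disch := positivity)

theorem continuousAt_A (hM : 0 ≤ M) (hp : p ∈ exterior M) (a : Fin 4) :
    ContinuousAt (fun y => A M y a) p := by
  have hr := radius_pos hM hp
  have hr_cont := (contDiffAt_radius hr (n := 0)).continuousAt
  have hdr := (contDiffAt_dr hr a (n := 0)).continuousAt
  unfold A
  exact ContinuousAt.mul (by fun_prop (disch := positivity)) hdr

theorem continuousAt_currentXiAq (hM : 0 ≤ M) (hp : p ∈ exterior M)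
    (hF : ∀ a b, ContDiffAt ℝ 1 (fun y => F y a b) p) (a : Fin 4) :
    ContinuousAt (fun y => currentXiAq M F y a) p := by
  have hg := continuousAt_invMetric hM hp
  have hZ := fun a b => (contDiffAt_Z hM hp hF a b).continuousAt
  have hhZ := fun a b => (contDiffAt_hodge hM hp (contDiffAt_Z hM hp hF) a b).continuousAt
  have hq := (contDiffAt_q hM hp (n := 0)).continuousAt
  have hpdq := continuousAt_pd (contDiffAt_q hM hp)
  have hβUp := continuousAt_betaUp hM hp hF
  have hHA : ContinuousAt (fun y => ∑ b, H M F y a b * A M y b) p :=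
    tendsto_finsetSum _ fun b _ => (continuousAt_H hM hp hF a b).mul (continuousAt_A hM hp b)
  have hcross : ContinuousAt (fun y => crossTerm M F y a) p := by
    unfold crossTerm
    fun_prop
  have hZZ (a b : Fin 4) : ContinuousAt (fun y => ZZ M F y a b) p := by
    unfold ZZ
    fun_prop
  exact (continuousAt_currentXi hM hp hF a).add
    (((hHA.add (continuousAt_re hcross)).add (by fun_prop)).sub (by fun_prop))

theorem continuousAt_nullComp (hM : 0 ≤ M) (hp : p ∈ exterior M) {J : Point → Fin 4 → ℝ}
    (hJ : ∀ a, ContinuousAt (fun y => J y a) p) (s : ℝ) :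
    ContinuousAt (fun y => nullComp M s y (J y)) p := by
  have hf := (contDiffAt_lapseSq (radius_pos hM hp) M (n := 0)).continuousAt
  have hn := fun a => (contDiffAt_dr (radius_pos hM hp) a (n := 0)).continuousAt
  unfold nullComp nullVec
  fun_prop

theorem continuousAt_poincareDefect (hr : 0 < radius p) {w : Point → Fin 4 → ℝ}
    (hw : ∀ b, ContDiffAt ℝ 1 (fun y => w y b) p) : ContinuousAt (poincareDefect w) p := by
  have hw0 := fun b => (hw b).continuousAt
  have hpdw := fun a b => continuousAt_pd (hw b) a
  have hn := fun a => (contDiffAt_dr hr a (n := 0)).continuousAt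
  have hr_cont := (contDiffAt_radius hr (n := 0)).continuousAt
  unfold poincareDefect divergence radialCurl
  fun_prop (disch := positivity)

end Continuity

/-! ### Energy fluxes through spherically symmetric slices -/

namespace SpacelikeSlice

variable {M : ℝ} {S : SpacelikeSlice M} {x : Space}

theorem hasFDerivAt_graph (hx : x ∈ S.dom) :
    HasFDerivAt S.graph (ContinuousLinearMap.pi (Fin.cases (fderiv ℝ S.height x)
      fun j => (EuclideanSpace.proj j : Space →L[ℝ] ℝ))) x := by
  refine hasFDerivAt_pi.mpr fun b => Fin.cases ?_ (fun j => ?_) b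
  · exact (differentiableAt_height hx).hasFDerivAt
  · simp only [graph, point_succ, Fin.cases_succ]
    exact (EuclideanSpace.proj j : Space →L[ℝ] ℝ).hasFDerivAt

theorem contDiffOn_graph (S : SpacelikeSlice M) : ContDiffOn ℝ ∞ S.graph S.dom := by
  refine contDiffOn_pi.mpr fun b => Fin.cases ?_ (fun j => ?_) b
  · exact S.smooth
  · simp only [graph, point_succ]
    exact (EuclideanSpace.proj j : Space →L[ℝ] ℝ).contDiff.contDiffOn

theorem spd_comp_graph (hx : x ∈ S.dom) {f : Point → ℝ} (hf : DifferentiableAt ℝ f (S.graph x))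
    (i : Fin 3) : spd i (fun y => f (S.graph y)) x
      = spd i S.height x * pd 0 f (S.graph x) + pd i.succ f (S.graph x) := by
  have chain : HasFDerivAt (fun y => f (S.graph y)) _ x :=
    hf.hasFDerivAt.comp x (hasFDerivAt_graph hx)
  have graph_tangent : (ContinuousLinearMap.pi (Fin.cases (fderiv ℝ S.height x)
      fun j => (EuclideanSpace.proj j : Space →L[ℝ] ℝ)) : Space →L[ℝ] Point)
        (EuclideanSpace.single i 1)
      = spd i S.height x • Pi.single 0 1 + Pi.single i.succ 1 := by
    funext b
    refine Fin.cases ?_ (fun j => ?_) b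
    · simp [spd, (Fin.succ_ne_zero i).symm]
    · simp [Pi.single_apply, Fin.succ_ne_zero]
  rw [spd, chain.fderiv, ContinuousLinearMap.comp_apply, graph_tangent, map_add, map_smul,
    smul_eq_mul]
  rfl

/-- The pull-back of a one-form without time component to the domain of a slice, as a vector field
on Euclidean space. -/
def pullback (S : SpacelikeSlice M) (w : Point → Fin 4 → ℝ) (j : Fin 3) (x : Space) : ℝ :=
  w (S.graph x) j.succ

section Pullback

variable {w : Point → Fin 4 → ℝ}

theorem contDiffOn_pullback {n : ℕ∞}
    (hw : ∀ p ∈ exterior M, ∀ b, ContDiffAt ℝ n (fun y => w y b) p) (j : Fin 3) :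
    ContDiffOn ℝ n (S.pullback w j) S.dom := fun x hx =>
  (hw _ (graph_mem hx) j.succ).comp_contDiffWithinAt x
    ((S.contDiffOn_graph x hx).of_le (mod_cast le_top))

variable (hM : 0 ≤ M) (hx : x ∈ S.dom)

include hM hx in
theorem sum_mul_pullback (hw : IsTangential (S.graph x) (w (S.graph x))) :
    ∑ j, x j * S.pullback w j x = 0 := by
  have h := hw.sum_dr_eq_zero
  rw [graph, sum_dr_point_mul, div_eq_zero_iff] at h
  exact h.resolve_right (norm_pos hM hx).ne'

theorem sum_pullback_sq (hw : IsTangential (S.graph x) (w (S.graph x))) :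
    ∑ j, S.pullback w j x ^ 2 = ∑ b, w (S.graph x) b ^ 2 := by
  simp [Fin.sum_univ_succ (n := 3), hw.time_eq_zero, pullback]

variable (hS : S.IsSphericallySymmetric)
  (hd : ∀ b, DifferentiableAt ℝ (fun y => w y b) (S.graph x))

include hM hx hS hd

theorem spd_pullback (i j : Fin 3) : spd i (S.pullback w j) x
    = S.slope x * (x i / ‖x‖) * pd 0 (fun y => w y j.succ) (S.graph x)
      + pd i.succ (fun y => w y j.succ) (S.graph x) := by
  rw [← spd_height hM hS hx, ← spd_comp_graph hx (hd j.succ)]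
  rfl

theorem positionCurl_pullback :
    positionCurl (S.pullback w) x = -(‖x‖ * radialCurl w (S.graph x)) := by
  have hn := (norm_pos hM hx).ne'
  have dr_succ (i : Fin 3) : dr (S.graph x) i.succ = x i / ‖x‖ := dr_point _ _ _
  have dr_one : dr (S.graph x) 1 = x 0 / ‖x‖ := dr_succ 0
  have dr_two : dr (S.graph x) 2 = x 1 / ‖x‖ := dr_succ 1
  have dr_three : dr (S.graph x) 3 = x 2 / ‖x‖ := dr_succ 2
  simp only [positionCurl, rotDer_eq, spd_pullback hM hx hS hd, Fin.sum_univ_three]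
  rw [radialCurl_eq, dr_one, dr_two, dr_three]
  simp only [Fin.isValue, Fin.succ_zero_eq_one, Fin.succ_one_eq_two, Fin.reduceSucc, Fin.reduceAdd,
    zero_add]
  field_simp
  ring

variable (htan : ∀ p ∈ exterior M, IsTangential p (w p))

include htan

/-- The graph moves in time only along the radius, and `∂_t w` is again orthogonal to the radius. -/
theorem flatDiv_pullback : flatDiv (S.pullback w) x = divergence w (S.graph x) := by
  have hp := graph_mem hx
  have hw : ∀ᶠ y in nhds (S.graph x), IsTangential y (w y) :=
    Filter.eventually_of_mem ((isOpen_exterior M).mem_nhds hp) htan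
  have pd_time_radial := sum_dr_mul_pd_of_isTangential (radius_pos hM hp) hw hd 0
  rw [(htan _ hp).time_eq_zero, neg_zero, zero_div, graph, sum_dr_point_mul] at pd_time_radial
  simp only [flatDiv, spd_pullback hM hx hS hd, Finset.sum_add_distrib]
  rw [divergence, Fin.sum_univ_succ (n := 3), pd_time_of_isTangential hw, zero_add, add_eq_right,
    ← mul_zero (S.slope x), ← pd_time_radial, Finset.sum_div, Finset.mul_sum]
  exact Finset.sum_congr rfl fun i _ => by rw [graph]; ring

theorem poincareDefect_graph :
    ‖x‖ ^ 2 * flatDiv (S.pullback w) x ^ 2 + positionCurl (S.pullback w) x ^ 2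
      - 2 * ∑ j, S.pullback w j x ^ 2 = ‖x‖ ^ 2 * poincareDefect w (S.graph x) := by
  have hn := (norm_pos hM hx).ne'
  rw [flatDiv_pullback hM hx hS hd htan, positionCurl_pullback hM hx hS hd,
    sum_pullback_sq (htan _ (graph_mem hx)), poincareDefect,
    show radius (S.graph x) = ‖x‖ from radius_point _ _]
  field_simp

end Pullback

theorem setIntegral_poincareDefect_nonneg (hM : 0 ≤ M) (hS : S.IsSphericallySymmetric)
    {w : Point → Fin 4 → ℝ} (hw : ∀ p ∈ exterior M, ∀ b, ContDiffAt ℝ 2 (fun y => w y b) p)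
    (htan : ∀ p ∈ exterior M, IsTangential p (w p)) {K : Set Space} (hK : IsCompact K)
    (hKD : K ⊆ S.dom) (hinv : IsRotInvariant K) {ψ : Space → ℝ} (hψ : ContinuousOn ψ K)
    (hψ0 : ∀ x ∈ K, 0 ≤ ψ x) (hψinv : ∀ R, IsRotation R → ∀ x ∈ K, ψ (R x) = ψ x) :
    0 ≤ ∫ x in K, ψ x * poincareDefect w (S.graph x) := by
  have hn {x : Space} (hx : x ∈ S.dom) : ‖x‖ ≠ 0 := (norm_pos hM hx).ne'
  have h := poincare_inequality S.isOpen_dom (fun h => hn h norm_zero) hK hKD hinv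
    (φ := fun x => ψ x / ‖x‖ ^ 2)
    (hψ.div (by fun_prop) fun x hx => pow_ne_zero 2 (hn (hKD hx)))
    (fun x hx => div_nonneg (hψ0 x hx) (by positivity))
    (fun R hR x hx => by rw [hψinv R hR x hx, LinearIsometryEquiv.norm_map])
    (contDiffOn_pullback hw) (fun x hx => sum_mul_pullback hM hx (htan _ (graph_mem hx)))
  refine h.trans_eq (setIntegral_congr_fun hK.measurableSet fun x hx => ?_)
  have := hn (hKD hx)
  rw [poincareDefect_graph hM (hKD hx) hS
    (fun b => (hw _ (graph_mem (hKD hx)) b).differentiableAt two_ne_zero) htan]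
  field_simp

theorem continuousOn_comp_graph {f : Point → ℝ} (hf : ∀ p ∈ exterior M, ContinuousAt f p) :
    ContinuousOn (fun x => f (S.graph x)) S.dom := fun x hx =>
  (hf _ (graph_mem hx)).comp_continuousWithinAt (S.contDiffOn_graph.continuousOn x hx)

theorem continuousOn_lapseSq_graph (hM : 0 ≤ M) :
    ContinuousOn (fun x => lapseSq M (S.graph x)) S.dom :=
  continuousOn_comp_graph fun _ hp =>
    (contDiffAt_lapseSq (radius_pos hM hp) M (n := 0)).continuousAt

theorem continuousOn_velocity (hM : 0 ≤ M) : ContinuousOn S.velocity S.dom := by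
  have hfderiv := S.smooth.continuousOn_fderiv_of_isOpen S.isOpen_dom (by simp)
  exact (continuousOn_lapseSq_graph hM).mul ((hfderiv.clm_apply continuousOn_id).div
    continuousOn_id.norm fun x hx => (norm_pos hM hx).ne')

/-- The weight of the null vector `l_s` in the flux through a slice, for `s = ± 1`. -/
def nullWeight (S : SpacelikeSlice M) (s : ℝ) (x : Space) : ℝ :=
  (2 * lapseSq M (S.graph x))⁻¹ * (1 + s * S.velocity x)

theorem continuousOn_nullWeight (hM : 0 ≤ M) (s : ℝ) : ContinuousOn (S.nullWeight s) S.dom := by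
  have hf := continuousOn_lapseSq_graph (S := S) hM
  have hv := continuousOn_velocity (S := S) hM
  have hf0 : ∀ x ∈ S.dom, 2 * lapseSq M (S.graph x) ≠ 0 := fun x hx =>
    (mul_pos two_pos (lapseSq_pos hM (graph_mem hx))).ne'
  unfold nullWeight
  fun_prop (disch := assumption)

theorem nullWeight_nonneg (hM : 0 ≤ M) (hS : S.IsSphericallySymmetric) (hx : x ∈ S.dom) {s : ℝ}
    (hs : s ^ 2 = 1) : 0 ≤ S.nullWeight s x := by
  have hv := abs_lt.mp (abs_velocity_lt hM hS hx)
  have hf := lapseSq_pos hM (graph_mem hx)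
  have : 0 ≤ 1 + s * S.velocity x := by rcases sq_eq_one_iff.mp hs with rfl | rfl <;> linarith
  unfold nullWeight
  positivity

theorem nullWeight_comp (hS : S.IsSphericallySymmetric) (hx : x ∈ S.dom) (s : ℝ)
    {R : Space ≃ₗᵢ[ℝ] Space} (hR : IsRotation R) : S.nullWeight s (R x) = S.nullWeight s x := by
  simp only [nullWeight, velocity_comp hS hx hR, lapseSq, graph, radius_point,
    LinearIsometryEquiv.norm_map]

theorem fluxDensity_eq_nullWeight (hM : 0 ≤ M) (hS : S.IsSphericallySymmetric) (hx : x ∈ S.dom)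
    (J : Point → Fin 4 → ℝ) : S.fluxDensity J x
      = S.nullWeight 1 x * nullComp M 1 (S.graph x) (J (S.graph x))
        + S.nullWeight (-1) x * nullComp M (-1) (S.graph x) (J (S.graph x)) := by
  rw [fluxDensity_eq hM hS hx, nullWeight, nullWeight]
  ring

theorem continuousOn_fluxDensity (hM : 0 ≤ M) (hS : S.IsSphericallySymmetric)
    {J : Point → Fin 4 → ℝ} (hJ : ∀ p ∈ exterior M, ∀ a, ContinuousAt (fun y => J y a) p) :
    ContinuousOn (S.fluxDensity J) S.dom := by
  have hnull := fun s => continuousOn_comp_graph (S := S)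
    fun p hp => continuousAt_nullComp hM hp (hJ p hp) s
  have hweight := continuousOn_nullWeight (S := S) hM
  exact (((hweight 1).mul (hnull 1)).add ((hweight (-1)).mul (hnull (-1)))).congr
    fun x hx => fluxDensity_eq_nullWeight hM hS hx J

theorem fluxDensity_currentXi_nonneg (F : TensorField) (hM : 0 ≤ M)
    (hS : S.IsSphericallySymmetric) (hx : x ∈ S.dom) :
    0 ≤ S.fluxDensity (currentXi M F) x := by
  have hweight {s : ℝ} (hs : s ^ 2 = 1) := nullWeight_nonneg hM hS hx hs
  have hnull {s : ℝ} (hs : s ^ 2 = 1) :=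
    nullComp_currentXi_nonneg (F := F) hM (graph_mem hx) hs
  rw [fluxDensity_eq_nullWeight hM hS hx]
  exact add_nonneg (mul_nonneg (hweight (by norm_num)) (hnull (by norm_num)))
    (mul_nonneg (hweight (by norm_num)) (hnull (by norm_num)))

/-- The coefficient of the Poincaré defect of `l_s^a Z_{ab}` in the comparison of the two flux
densities; `k` is `s` in the lower bound for the modified flux and `-s` in the upper bound. -/
def defectWeight (S : SpacelikeSlice M) (s k : ℝ) (x : Space) : ℝ :=
  S.nullWeight s x * (1 / 8 * (9 / 10 + k * ((‖x‖ - 3 * M) / (2 * ‖x‖))))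

theorem continuousOn_defectWeight (hM : 0 ≤ M) (s k : ℝ) :
    ContinuousOn (S.defectWeight s k) S.dom := by
  have hweight := continuousOn_nullWeight (S := S) hM s
  have hn : ∀ x ∈ S.dom, 2 * ‖x‖ ≠ 0 := fun x hx => (mul_pos two_pos (norm_pos hM hx)).ne'
  unfold defectWeight
  fun_prop (disch := assumption)

theorem defectWeight_bounds (hM : 0 ≤ M) (hS : S.IsSphericallySymmetric) (hx : x ∈ S.dom)
    {s k : ℝ} (hs : s ^ 2 = 1) (hk : k ^ 2 = 1) :
    0 ≤ S.defectWeight s k x ∧ S.defectWeight s k x ≤ S.nullWeight s x * (7 / 40) := by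
  have hn := norm_pos hM hx
  have hr := S.dom_subset x hx
  have hweight := nullWeight_nonneg hM hS hx hs
  have hupper : (‖x‖ - 3 * M) / (2 * ‖x‖) ≤ 1 / 2 := by
    rw [div_le_iff₀ (by positivity)]
    linarith
  have hlower : -(1 / 2) ≤ (‖x‖ - 3 * M) / (2 * ‖x‖) := by
    rw [le_div_iff₀ (by positivity)]
    linarith
  constructor
  · refine mul_nonneg hweight ?_
    rcases sq_eq_one_iff.mp hk with rfl | rfl <;> linarith
  · refine mul_le_mul_of_nonneg_left ?_ hweight
    rcases sq_eq_one_iff.mp hk with rfl | rfl <;> linarith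

theorem defectWeight_comp (hS : S.IsSphericallySymmetric) (hx : x ∈ S.dom) (s k : ℝ)
    {R : Space ≃ₗᵢ[ℝ] Space} (hR : IsRotation R) :
    S.defectWeight s k (R x) = S.defectWeight s k x := by
  simp only [defectWeight, nullWeight_comp hS hx s hR, LinearIsometryEquiv.norm_map]

section Excess

variable {F : TensorField}

/-- The contribution of `l_s` to `excess`. -/
def nullExcess (S : SpacelikeSlice M) (F : TensorField) (s k : ℝ) (x : Space) : ℝ :=
  S.defectWeight s k x * poincareDefect (nullContr M s (Z M F)) (S.graph x)

/-- A pointwise lower bound for the modified flux density minus `1/10` of the energy density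
(`k = 1`), and for `19/10` of the energy density minus the modified flux density (`k = -1`). It has
no sign, but its integrals over rotation-invariant sets are nonnegative. -/
def excess (S : SpacelikeSlice M) (F : TensorField) (k : ℝ) (x : Space) : ℝ :=
  S.nullExcess F 1 k x + S.nullExcess F (-1) (-k) x

variable (hM : 0 ≤ M) (hF : ∀ p ∈ exterior M, ∀ a b, ContDiffAt ℝ 2 (fun y => F y a b) p)

include hM hF

theorem contDiffAt_nullContr_Z {p : Point} (hp : p ∈ exterior M) (s : ℝ) (b : Fin 4) :
    ContDiffAt ℝ 2 (fun y => nullContr M s (Z M F) y b) p :=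
  contDiffAt_nullContr (radius_pos hM hp) (contDiffAt_Z hM hp (hF p hp)) s b

theorem continuousOn_nullExcess (s k : ℝ) : ContinuousOn (S.nullExcess F s k) S.dom :=
  (continuousOn_defectWeight hM s k).mul (continuousOn_comp_graph fun _ hp =>
    continuousAt_poincareDefect (radius_pos hM hp)
      fun b => (contDiffAt_nullContr_Z hM hF hp s b).of_le one_le_two)

theorem continuousOn_excess (k : ℝ) : ContinuousOn (S.excess F k) S.dom :=
  (continuousOn_nullExcess hM hF 1 k).add (continuousOn_nullExcess hM hF (-1) (-k))

variable (hS : S.IsSphericallySymmetric)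

include hS

theorem setIntegral_nullExcess_nonneg {s k : ℝ} (hs : s ^ 2 = 1) (hk : k ^ 2 = 1) {K : Set Space}
    (hK : IsCompact K) (hKD : K ⊆ S.dom) (hinv : IsRotInvariant K) :
    0 ≤ ∫ x in K, S.nullExcess F s k x :=
  setIntegral_poincareDefect_nonneg hM hS (fun _ hp => contDiffAt_nullContr_Z hM hF hp s)
    (fun _ hp => (isExtreme_Z hM F).toIsTransverse.isTangential_nullContr hp s) hK hKD hinv
    ((continuousOn_defectWeight hM s k).mono hKD)
    (fun _ hx => (defectWeight_bounds hM hS (hKD hx) hs hk).1)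
    fun _ hR _ hx => defectWeight_comp hS (hKD hx) s k hR

theorem setIntegral_excess_nonneg {k : ℝ} (hk : k ^ 2 = 1) {K : Set Space} (hK : IsCompact K)
    (hKD : K ⊆ S.dom) (hinv : IsRotInvariant K) : 0 ≤ ∫ x in K, S.excess F k x := by
  have hint (s k : ℝ) : IntegrableOn (S.nullExcess F s k) K :=
    ((continuousOn_nullExcess hM hF s k).mono hKD).integrableOn_compact hK
  simp only [excess]
  rw [integral_add (hint 1 k) (hint (-1) (-k))]
  exact add_nonneg (setIntegral_nullExcess_nonneg hM hF hS (by norm_num) hk hK hKD hinv)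
    (setIntegral_nullExcess_nonneg hM hF hS (by norm_num) (by rwa [neg_sq]) hK hKD hinv)

theorem nullExcess_le {s k : ℝ} (hs : s ^ 2 = 1) (hk : k ^ 2 = 1) (hx : x ∈ S.dom) :
    S.nullExcess F s k x
      ≤ 7 / 5 * (S.nullWeight s x * nullComp M s (S.graph x) (currentXi M F (S.graph x))) := by
  have hp := graph_mem hx
  obtain ⟨hnonneg, hle⟩ := defectWeight_bounds hM hS hx hs hk
  have hJ := nullComp_currentXi_nonneg (F := F) hM hp hs
  have hF1 : ∀ a b, ContDiffAt ℝ 1 (fun y => F y a b) (S.graph x) :=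
    fun a b => (hF _ hp a b).of_le one_le_two
  calc S.nullExcess F s k x
      ≤ S.defectWeight s k x * (8 * nullComp M s (S.graph x) (currentXi M F (S.graph x))) :=
        mul_le_mul_of_nonneg_left (poincareDefect_nullContr_Z_le hM hp hF1 hs) hnonneg
    _ ≤ S.nullWeight s x * (7 / 40)
          * (8 * nullComp M s (S.graph x) (currentXi M F (S.graph x))) := by gcongr
    _ = _ := by ring

theorem excess_le {k : ℝ} (hk : k ^ 2 = 1) (hx : x ∈ S.dom) :
    S.excess F k x ≤ 7 / 5 * S.fluxDensity (currentXi M F) x := by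
  rw [excess, fluxDensity_eq_nullWeight hM hS hx, mul_add]
  exact add_le_add (nullExcess_le hM hF hS (by norm_num) hk hx)
    (nullExcess_le hM hF hS (by norm_num) (by rwa [neg_sq]) hx)

theorem nullExcess_bounds {s : ℝ} (hs : s ^ 2 = 1) (hx : x ∈ S.dom) :
    S.nullExcess F s s x
        ≤ S.nullWeight s x * (nullComp M s (S.graph x) (currentXiAq M F (S.graph x))
          - 1 / 10 * nullComp M s (S.graph x) (currentXi M F (S.graph x))) ∧
      S.nullExcess F s (-s) x
        ≤ S.nullWeight s x * (19 / 10 * nullComp M s (S.graph x) (currentXi M F (S.graph x))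
          - nullComp M s (S.graph x) (currentXiAq M F (S.graph x))) := by
  have hp := graph_mem hx
  have hweight := nullWeight_nonneg hM hS hx hs
  obtain ⟨hlower, hupper⟩ :=
    nullComp_bounds hM hp (fun a b => (hF _ hp a b).of_le one_le_two) hs
  simp only [show radius (S.graph x) = ‖x‖ from radius_point _ _] at hlower hupper
  rw [nullExcess, nullExcess, defectWeight, defectWeight, mul_assoc (S.nullWeight s x),
    mul_assoc (S.nullWeight s x), neg_mul, ← sub_eq_add_neg]
  exact ⟨mul_le_mul_of_nonneg_left hlower hweight, mul_le_mul_of_nonneg_left hupper hweight⟩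

theorem excess_one_le (hx : x ∈ S.dom) : S.excess F 1 x
    ≤ S.fluxDensity (currentXiAq M F) x - 1 / 10 * S.fluxDensity (currentXi M F) x := by
  have hplus := (nullExcess_bounds hM hF hS (s := 1) (by norm_num) hx).1
  have hminus := (nullExcess_bounds hM hF hS (s := -1) (by norm_num) hx).1
  rw [excess, fluxDensity_eq_nullWeight hM hS hx, fluxDensity_eq_nullWeight hM hS hx]
  linear_combination hplus + hminus

theorem excess_neg_one_le (hx : x ∈ S.dom) : S.excess F (-1) x
    ≤ 19 / 10 * S.fluxDensity (currentXi M F) x - S.fluxDensity (currentXiAq M F) x := by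
  have hplus := (nullExcess_bounds hM hF hS (s := 1) (by norm_num) hx).2
  have hminus := (nullExcess_bounds hM hF hS (s := -1) (by norm_num) hx).2
  rw [excess, fluxDensity_eq_nullWeight hM hS hx, fluxDensity_eq_nullWeight hM hS hx]
  linear_combination hplus + hminus

end Excess

end SpacelikeSlice

end Schwarzschild

end

open Schwarzschild SpacelikeSlice in
theorem mainTheorem4_general (M : ℝ) (hM : 0 ≤ M) (F : TensorField)
    (hF : ∀ a b, ContDiffOn ℝ 2 (fun p => F p a b) (exterior M)) (S : SpacelikeSlice M)
    (hS : S.IsSphericallySymmetric) :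
    (S.FluxIntegrable (currentXi M F) ↔ S.FluxIntegrable (currentXiAq M F)) ∧
      1 / 10 * energyXi F S ≤ energyXiAq F S ∧ energyXiAq F S ≤ 19 / 10 * energyXi F S := by
  have hF2 : ∀ p ∈ exterior M, ∀ a b, ContDiffAt ℝ 2 (fun y => F y a b) p :=
    fun p hp a b => (hF a b).contDiffAt ((isOpen_exterior M).mem_nhds hp)
  have hF1 p (hp : p ∈ exterior M) a b := (hF2 p hp a b).of_le one_le_two
  have excess_nonneg {k : ℝ} (hk : k ^ 2 = 1) (n : ℕ) :
      0 ≤ ∫ x in exhaustion S.dom n, S.excess F k x :=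
    setIntegral_excess_nonneg hM hF2 hS hk (isCompact_exhaustion S.dom n)
      (exhaustion_subset S.dom n) ((isRotInvariant_dom hS).exhaustion n)
  exact integrableOn_iff_and_setIntegral_bounds (aecover_exhaustion volume S.isOpen_dom)
    (exhaustion_subset S.dom) (k₃ := 7 / 5) (by norm_num) (by norm_num)
    (integrableOn_exhaustion (continuousOn_fluxDensity hM hS fun p hp =>
      continuousAt_currentXi hM hp (hF1 p hp)))
    (integrableOn_exhaustion (continuousOn_fluxDensity hM hS fun p hp =>
      continuousAt_currentXiAq hM hp (hF1 p hp)))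
    (integrableOn_exhaustion (continuousOn_excess hM hF2 1))
    (integrableOn_exhaustion (continuousOn_excess hM hF2 (-1)))
    (fun _ hx => fluxDensity_currentXi_nonneg F hM hS hx)
    (fun _ hx => excess_one_le hM hF2 hS hx)
    (fun _ hx => excess_neg_one_le hM hF2 hS hx)
    (fun _ hx => excess_le hM hF2 hS (by norm_num) hx)
    (fun _ hx => excess_le hM hF2 hS (by norm_num) hx)
    (excess_nonneg (by norm_num)) (excess_nonneg (by norm_num))

theorem mainTheorem4 (M : ℝ) (hM : 0 < M) (F : Schwarzschild.TensorField)
    (hF : Schwarzschild.IsMaxwellField M F) (S : Schwarzschild.SpacelikeSlice M)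
    (hS : S.IsSphericallySymmetric) :
    (S.FluxIntegrable (Schwarzschild.currentXi M F) ↔
        S.FluxIntegrable (Schwarzschild.currentXiAq M F)) ∧
      1 / 10 * Schwarzschild.energyXi F S ≤ Schwarzschild.energyXiAq F S ∧
      Schwarzschild.energyXiAq F S ≤ 19 / 10 * Schwarzschild.energyXi F S :=
  mainTheorem4_general M hM.le F
    (fun a b => (hF.smooth a b).of_le (WithTop.coe_le_coe.mpr le_top)) S hS
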